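/- Let $d\ge 1$ and let $A$ be a set of $n\ge 1$ agents. Every agent $a\in A$ has a preference list $\succ_a$, a strict total order on the set of all $(d-1)$-subsets of $A\setminus\{a\}$. Let $\succeq$ be a partial order on $A$ (the master poset). The preferences are derived from $\succeq$ if, for every $a$, whenever $\{a_1,\dots,a_{d-1}\}$ and $\{b_1,\dots,b_{d-1}\}$ are $(d-1)$-subsets of $A\setminus\{a\}$ with $a_i\succeq b_i$ for all $i$, then $a$ weakly prefers $\{a_1,\dots,a_{d-1}\}$ to $\{b_1,\dots,b_{d-1}\}$. A matching is a set $M$ of pairwise disjoint $d$-subsets of $A$. A $d$-subset $B$ of $A$ is blocking for $M$ if every $a\in B$ is either in no set of $M$ or prefers $B\setminus\{a\}$ to $T\setminus\{a\}$, where $T$ is the set of $M$ that contains $a$. A matching is stable if it has no blocking $d$-set. An instance of MDSR-Poset consists of $d$, $A$, the preference lists and a master poset from which they are derived; the question is whether a stable matching exists. Let $\kappa$ be the maximum, over all agents $v$, of the number of agents that are incomparable to $v$ in the master poset. (1) MDSR-Poset can be solved in $O(n^2)+(\kappa d^4)^{O(\kappa d^4)}\cdot n$ time. That is, there are a constant $C$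 and a single program for a random access machine (unit cost for addition, subtraction and memory access) which, given $n$ and $d$, access to the master poset by queries "is $a\succeq b$?" of unit cost, and access to the preferences by queries "does $a$ prefer $s$ to $t$?" of cost $2d-1$ for an agent $a$ and two $(d-1)$-sets $s,t$, halts on every instance after at most $Cn^2+(\kappa d^4)^{C\kappa d^4}\cdot n$ steps (with $0^0=1$) and answers correctly whether a stable matching exists. (2) For every instance there is an order $a_1,\dots,a_n$ of the agents such that $a_i\succ a_j$ or $a_i,a_j$ are incomparable for all $i<j$, and $a_i\succ a_j$ whenever $j>i+2\kappa$. For every such order, every stable matching $M$ and every set $\{a_{i_1},\dots,a_{i_d}\}\in M$ with $i_1<\dots<i_d$, we have $i_{j+1}-i_j\le 2\kappa d^2+4\kappa+3d+1$ for all $1\le j<d$. -/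

import Mathlib

namespace MDSR

/-- The possible partner sets of agent `a`: the `(d-1)`-sets of agents that do not contain `a`. -/
abbrev Partners (A : Type) (d : ℕ) (a : A) : Type :=
  {t : Finset A // a ∉ t ∧ t.card + 1 = d}

/-- An instance of `d`-dimensional stable roommates with complete strict preferences that are
derived from a master poset. `ge a b` means that `a` is at least as good as `b` in the master
poset; `pref a s t` means that agent `a` strictly prefers `s` to `t`. -/
structure Instance (A : Type) [DecidableEq A] (d : ℕ) where
  ge : A → A → Prop
  ge_partialOrder : IsPartialOrder A ge
  pref : (a : A) → Partners A d a → Partners A d a → Prop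
  pref_strictOrder : ∀ a, IsStrictTotalOrder (Partners A d a) (pref a)
  derived : ∀ (a : A) (s t : Partners A d a) (f g : Fin (d - 1) → A),
    Finset.univ.image f = s.1 → Finset.univ.image g = t.1 → (∀ i, ge (f i) (g i)) →
      s = t ∨ pref a s t

namespace Instance

variable {A : Type} [DecidableEq A] {d : ℕ}

/-- `u` is strictly better than `v` in the master poset. -/
def gt (I : Instance A d) (u v : A) : Prop := I.ge u v ∧ u ≠ v

/-- The maximum, over all agents `v`, of the number of agents incomparable to `v`. -/
noncomputable def kappa [Fintype A] (I : Instance A d) : ℕ :=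
  Finset.univ.sup fun v : A => {w : A | IncompRel I.ge v w}.ncard

/-- Agent `a` strictly prefers the set `s` to the set `t` (both being possible partner sets). -/
def Prefers (I : Instance A d) (a : A) (s t : Finset A) : Prop :=
  ∃ (hs : a ∉ s ∧ s.card + 1 = d) (ht : a ∉ t ∧ t.card + 1 = d), I.pref a ⟨s, hs⟩ ⟨t, ht⟩

/-- A `d`-dimensional matching: a set of pairwise disjoint `d`-sets of agents. -/
def IsMatching (_I : Instance A d) (M : Finset (Finset A)) : Prop :=
  (∀ t ∈ M, t.card = d) ∧ ∀ s ∈ M, ∀ t ∈ M, s ≠ t → Disjoint s t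

/-- `B` is a blocking `d`-set: every member is unmatched or prefers the rest of `B` to its
partners in `M`. -/
def IsBlocking (I : Instance A d) (M : Finset (Finset A)) (B : Finset A) : Prop :=
  B.card = d ∧ ∀ a ∈ B,
    (∀ t ∈ M, a ∉ t) ∨ ∃ t ∈ M, a ∈ t ∧ I.Prefers a (B.erase a) (t.erase a)

/-- A stable matching: a matching without a blocking `d`-set. -/
def IsStable (I : Instance A d) (M : Finset (Finset A)) : Prop :=
  I.IsMatching M ∧ ¬ ∃ B, I.IsBlocking M B

/-- The order `σ 0, σ 1, …, σ (n-1)` of the agents approximates the master poset: an earlier agent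
is better than or incomparable to a later one, and an agent that is more than `2κ` positions
earlier is better. -/
def Approximates {n : ℕ} (I : Instance (Fin n) d) (σ : Equiv.Perm (Fin n)) : Prop :=
  (∀ i j : Fin n, i < j → I.gt (σ i) (σ j) ∨ IncompRel I.ge (σ i) (σ j)) ∧
  ∀ i j : Fin n, (i : ℕ) + 2 * I.kappa < j → I.gt (σ i) (σ j)

/-- `M` is local with bound `D` along the order `σ`: whenever `σ i` and `σ j` with `i < j` are
consecutive members of a set in `M`, their positions differ by at most `D`. -/
def GapsAtMost {n : ℕ} (σ : Equiv.Perm (Fin n)) (M : Finset (Finset (Fin n))) (D : ℕ) : Prop :=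
  ∀ t ∈ M, ∀ i j : Fin n, i < j → σ i ∈ t → σ j ∈ t → (∀ l, i < l → l < j → σ l ∉ t) →
    (j : ℕ) ≤ i + D

open Classical in
/-- Answer to a comparison query about the master poset (agents are named by `0, …, n-1`). -/
noncomputable def orderAnswer {n : ℕ} (I : Instance (Fin n) d) (a b : ℕ) : ℕ :=
  if ∃ u v : Fin n, (u : ℕ) = a ∧ (v : ℕ) = b ∧ I.ge u v then 1 else 0

open Classical in
/-- Answer to the query whether agent `a` prefers the set `S` to the set `T`. Queries that do not
name an agent and two possible partner sets of it are answered by `0`. -/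
noncomputable def prefAnswer {n : ℕ} (I : Instance (Fin n) d) (a : ℕ) (S T : Finset ℕ) : ℕ :=
  if ∃ (v : Fin n) (s t : Finset (Fin n)), (v : ℕ) = a ∧ s.image Fin.val = S ∧
    t.image Fin.val = T ∧ I.Prefers v s t then 1 else 0

end Instance

/-! A random access machine with unit cost for additions, subtractions and memory accesses (there
is no multiplication, so numbers cannot grow fast enough to hide work in arithmetic), programmed by
structured programs. The memory has registers and arrays of natural numbers; which registers and
which arrays are accessed is fixed in the program, array indices are computed. -/

/-- Expressions. Subtraction is truncated at `0`. -/
inductive Expr where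
  | num (c : ℕ)
  | reg (x : ℕ)
  | get (arr : ℕ) (i : Expr)
  | add (e f : Expr)
  | sub (e f : Expr)

/-- Programs. `askOrder x e f` stores in register `x` whether agent `e` is at least as good as
agent `f` in the master poset. `askPref x e p i q j` stores in register `x` whether agent `e`
prefers the `(d-1)`-set listed in array `p` from index `i` on to the `(d-1)`-set listed in array `q`
from index `j` on. Conditions are true if they are nonzero. -/
inductive Program where
  | skip
  | assign (x : ℕ) (e : Expr)
  | put (arr : ℕ) (i e : Expr)
  | askOrder (x : ℕ) (e f : Expr)
  | askPref (x : ℕ) (e : Expr) (p : ℕ) (i : Expr) (q : ℕ) (j : Expr)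
  | seq (c c' : Program)
  | ite (e : Expr) (c c' : Program)
  | loop (e : Expr) (c : Program)

/-- Memory contents. -/
@[ext]
structure Memory where
  reg : ℕ → ℕ
  arr : ℕ → ℕ → ℕ

/-- Store `v` in register `x`. -/
def Memory.setReg (m : Memory) (x v : ℕ) : Memory :=
  { m with reg := Function.update m.reg x v }

/-- Store `v` in array `p` at index `i`. -/
def Memory.setArr (m : Memory) (p i v : ℕ) : Memory :=
  { m with arr := Function.update m.arr p (Function.update (m.arr p) i v) }

/-- The set of the `k` numbers in array `p` at the indices `i, …, i + k - 1`. -/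
def Memory.segment (m : Memory) (p i k : ℕ) : Finset ℕ :=
  (Finset.range k).image fun l => m.arr p (i + l)

/-- Value of an expression. -/
def Expr.val (m : Memory) : Expr → ℕ
  | num c => c
  | reg x => m.reg x
  | get p i => m.arr p (i.val m)
  | add e f => e.val m + f.val m
  | sub e f => e.val m - f.val m

/-- Time to evaluate an expression: one step per operation. -/
def Expr.cost : Expr → ℕ
  | num _ => 1
  | reg _ => 1
  | get _ i => i.cost + 1
  | add e f => e.cost + f.cost + 1
  | sub e f => e.cost + f.cost + 1

/-- `Exec I c m m' t`: with queries answered according to the instance `I`, the program `c` started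
with memory `m` halts with memory `m'` after exactly `t` steps. A preference query is charged for
the `2 (d-1) + 1` agents that it names. -/
inductive Exec {n d : ℕ} (I : Instance (Fin n) d) : Program → Memory → Memory → ℕ → Prop
  | skip (m : Memory) : Exec I .skip m m 1
  | assign (m : Memory) (x : ℕ) (e : Expr) :
      Exec I (.assign x e) m (m.setReg x (e.val m)) (e.cost + 1)
  | put (m : Memory) (p : ℕ) (i e : Expr) :
      Exec I (.put p i e) m (m.setArr p (i.val m) (e.val m)) (i.cost + e.cost + 1)
  | askOrder (m : Memory) (x : ℕ) (e f : Expr) :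
      Exec I (.askOrder x e f) m (m.setReg x (I.orderAnswer (e.val m) (f.val m)))
        (e.cost + f.cost + 1)
  | askPref (m : Memory) (x : ℕ) (e : Expr) (p : ℕ) (i : Expr) (q : ℕ) (j : Expr) :
      Exec I (.askPref x e p i q j) m
        (m.setReg x (I.prefAnswer (e.val m) (m.segment p (i.val m) (d - 1))
          (m.segment q (j.val m) (d - 1))))
        (e.cost + i.cost + j.cost + (2 * (d - 1) + 1))
  | seq {c c' : Program} {m m' m'' : Memory} {t t' : ℕ} :
      Exec I c m m' t → Exec I c' m' m'' t' → Exec I (.seq c c') m m'' (t + t')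
  | ite_true {e : Expr} {c c' : Program} {m m' : Memory} {t : ℕ} :
      e.val m ≠ 0 → Exec I c m m' t → Exec I (.ite e c c') m m' (e.cost + 1 + t)
  | ite_false {e : Expr} {c c' : Program} {m m' : Memory} {t : ℕ} :
      e.val m = 0 → Exec I c' m m' t → Exec I (.ite e c c') m m' (e.cost + 1 + t)
  | loop_done {e : Expr} {c : Program} {m : Memory} :
      e.val m = 0 → Exec I (.loop e c) m m (e.cost + 1)
  | loop_step {e : Expr} {c : Program} {m m' m'' : Memory} {t t' : ℕ} :
      e.val m ≠ 0 → Exec I c m m' t → Exec I (.loop e c) m' m'' t' →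
        Exec I (.loop e c) m m'' (e.cost + 1 + t + t')

/-- A program has at most one halting run from a given memory. -/
theorem Exec.unique {n d : ℕ} {I : Instance (Fin n) d} {c : Program} {m m₁ m₂ : Memory}
    {t₁ t₂ : ℕ} (h₁ : Exec I c m m₁ t₁) (h₂ : Exec I c m m₂ t₂) : m₁ = m₂ ∧ t₁ = t₂ := by
  induction h₁ generalizing m₂ t₂ with
  | skip => cases h₂; exact ⟨rfl, rfl⟩
  | assign => cases h₂; exact ⟨rfl, rfl⟩
  | put => cases h₂; exact ⟨rfl, rfl⟩
  | askOrder => cases h₂; exact ⟨rfl, rfl⟩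
  | askPref => cases h₂; exact ⟨rfl, rfl⟩
  | seq _ _ ih ih' =>
    cases h₂ with
    | seq a b =>
      obtain ⟨rfl, rfl⟩ := ih a
      obtain ⟨rfl, rfl⟩ := ih' b
      exact ⟨rfl, rfl⟩
  | ite_true h _ ih =>
    cases h₂ with
    | ite_true _ a => obtain ⟨rfl, rfl⟩ := ih a; exact ⟨rfl, rfl⟩
    | ite_false h' _ => exact absurd h' h
  | ite_false h _ ih =>
    cases h₂ with
    | ite_true h' _ => exact absurd h h'
    | ite_false _ a => obtain ⟨rfl, rfl⟩ := ih a; exact ⟨rfl, rfl⟩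
  | loop_done h =>
    cases h₂ with
    | loop_done _ => exact ⟨rfl, rfl⟩
    | loop_step h' _ _ => exact absurd h h'
  | loop_step h _ _ ih ih' =>
    cases h₂ with
    | loop_done h' => exact absurd h' h
    | loop_step _ a b =>
      obtain ⟨rfl, rfl⟩ := ih a
      obtain ⟨rfl, rfl⟩ := ih' b
      exact ⟨rfl, rfl⟩

/-- Initial memory: register `0` holds `n`, register `1` holds `d`, everything else is `0`. -/
def initialMemory (n d : ℕ) : Memory where
  reg x := if x = 0 then n else if x = 1 then d else 0
  arr _ _ := 0

/-- On input `I`, the program `c` halts within `T` steps, with `1` in register `0` if `Q` holds and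
with `0` in register `0` otherwise. -/
def Program.DecidesWithin {n d : ℕ} (c : Program) (I : Instance (Fin n) d) (Q : Prop) (T : ℕ) :
    Prop :=
  ∃ (m : Memory) (t : ℕ), Exec I c (initialMemory n d) m t ∧ t ≤ T ∧
    (Q → m.reg 0 = 1) ∧ (¬ Q → m.reg 0 = 0)

end MDSR

namespace MDSR

open Finset

section

variable {n d : ℕ} {I : Instance (Fin n) d}

/-! ### Running programs -/

@[simp] theorem Memory.setReg_reg (m : Memory) (x v y : ℕ) :
    (m.setReg x v).reg y = if y = x then v else m.reg y := by
  simp [Memory.setReg, Function.update_apply]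

@[simp] theorem Memory.setReg_arr (m : Memory) (x v : ℕ) : (m.setReg x v).arr = m.arr := rfl

@[simp] theorem Memory.setArr_reg (m : Memory) (p i v : ℕ) : (m.setArr p i v).reg = m.reg := rfl

@[simp] theorem Memory.setArr_arr (m : Memory) (p i v q j : ℕ) :
    (m.setArr p i v).arr q j = if q = p ∧ j = i then v else m.arr q j := by
  by_cases h : q = p
  · subst h
    by_cases h' : j = i <;> simp [Memory.setArr, h']
  · simp [Memory.setArr, h]

/-- Started with memory `m`, the program `c` halts within `T` steps with a memory satisfying `Q`. -/
def Runs (I : Instance (Fin n) d) (c : Program) (m : Memory) (T : ℕ) (Q : Memory → Prop) : Prop :=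
  ∃ m' t, Exec I c m m' t ∧ t ≤ T ∧ Q m'

theorem Runs.mono {c : Program} {m : Memory} {T T' : ℕ} {Q Q' : Memory → Prop}
    (h : Runs I c m T Q) (hT : T ≤ T') (hQ : ∀ m', Q m' → Q' m') : Runs I c m T' Q' := by
  obtain ⟨m', t, h1, h2, h3⟩ := h
  exact ⟨m', t, h1, h2.trans hT, hQ _ h3⟩

theorem Runs.skip {m : Memory} {T : ℕ} {Q : Memory → Prop} (hT : 1 ≤ T) (hQ : Q m) :
    Runs I .skip m T Q := ⟨m, 1, .skip m, hT, hQ⟩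

theorem Runs.assign {m : Memory} {x : ℕ} {e : Expr} {T : ℕ} {Q : Memory → Prop}
    (hT : e.cost + 1 ≤ T) (hQ : Q (m.setReg x (e.val m))) : Runs I (.assign x e) m T Q :=
  ⟨_, _, .assign m x e, hT, hQ⟩

theorem Runs.put {m : Memory} {p : ℕ} {i e : Expr} {T : ℕ} {Q : Memory → Prop}
    (hT : i.cost + e.cost + 1 ≤ T) (hQ : Q (m.setArr p (i.val m) (e.val m))) :
    Runs I (.put p i e) m T Q :=
  ⟨_, _, .put m p i e, hT, hQ⟩

theorem Runs.askOrder {m : Memory} {x : ℕ} {e f : Expr} {T : ℕ} {Q : Memory → Prop}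
    (hT : e.cost + f.cost + 1 ≤ T)
    (hQ : Q (m.setReg x (I.orderAnswer (e.val m) (f.val m)))) : Runs I (.askOrder x e f) m T Q :=
  ⟨_, _, .askOrder m x e f, hT, hQ⟩

theorem Runs.seq {c c' : Program} {m : Memory} {T T' U : ℕ} {Q : Memory → Prop}
    (h : Runs I c m T fun m' => Runs I c' m' T' Q) (hU : T + T' ≤ U) :
    Runs I (.seq c c') m U Q := by
  obtain ⟨m', t, h1, h2, m'', t', h3, h4, h5⟩ := h
  exact ⟨m'', t + t', .seq h1 h3, by omega, h5⟩

theorem Runs.ite {e : Expr} {c c' : Program} {m : Memory} {T U : ℕ} {Q : Memory → Prop}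
    (h : e.val m ≠ 0 → Runs I c m T Q) (h' : e.val m = 0 → Runs I c' m T Q)
    (hU : e.cost + 1 + T ≤ U) : Runs I (.ite e c c') m U Q := by
  by_cases he : e.val m = 0
  · obtain ⟨m', t, h1, h2, h3⟩ := h' he
    exact ⟨m', _, .ite_false he h1, by omega, h3⟩
  · obtain ⟨m', t, h1, h2, h3⟩ := h he
    exact ⟨m', _, .ite_true he h1, by omega, h3⟩

/-- Run `c` with register `x` counting from `0` up to the value of register `y`. -/
def Program.forTo (x y : ℕ) (c : Program) : Program :=
  .seq (.assign x (.num 0))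
    (.loop (.sub (.reg y) (.reg x)) (.seq c (.assign x (.add (.reg x) (.num 1)))))

theorem Runs.forTo {x y : ℕ} {c : Program} {m : Memory} {B T U : ℕ} (Inv : ℕ → Memory → Prop)
    (h0 : Inv 0 (m.setReg x 0))
    (hInv : ∀ j m, Inv j m → m.reg x = j ∧ m.reg y = B)
    (hs : ∀ j, j < B → ∀ m, Inv j m →
      Runs I c m T fun m' => m'.reg x = j ∧ Inv (j + 1) (m'.setReg x (j + 1)))
    (hU : (T + 8) * (B + 1) ≤ U) :
    Runs I (Program.forTo x y c) m U (Inv B) := by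
  -- Per iteration, the guard and the increment cost 4 steps each, which gives `T + 8`; the failing
  -- guard at the end costs the last 4.
  have key : ∀ r j m, j + r = B → Inv j m →
      Runs I (.loop (.sub (.reg y) (.reg x)) (.seq c (.assign x (.add (.reg x) (.num 1))))) m
        ((T + 8) * r + 4) (Inv B) := by
    intro r
    induction r with
    | zero =>
      intro j m hj h
      obtain ⟨h1, h2⟩ := hInv j m h
      refine ⟨m, _, .loop_done ?_, ?_, ?_⟩
      · simp [Expr.val, h1, h2]; omega
      · simp [Expr.cost]
      · have : j = B := by omega
        exact this ▸ h
    | succ r ih =>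
      intro j m hj h
      obtain ⟨h1, h2⟩ := hInv j m h
      obtain ⟨m', t, e1, e2, e3, e4⟩ := hs j (by omega) m h
      have h5 : (m'.setReg x ((Expr.add (.reg x) (.num 1)).val m')) = m'.setReg x (j + 1) := by
        simp [Expr.val, e3]
      obtain ⟨m'', t', f1, f2, f3⟩ := ih (j + 1) _ (by omega) e4
      refine ⟨m'', _, .loop_step ?_ (.seq e1 (.assign m' x _)) (h5 ▸ f1), ?_, f3⟩
      · simp [Expr.val, h1, h2]; omega
      · simp only [Expr.cost]
        rw [Nat.mul_succ]; omega
  have := key B 0 (m.setReg x 0) (by omega) h0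
  refine Runs.seq (T := 2) (T' := (T + 8) * B + 4) ?_ ?_
  · exact Runs.assign (by simp [Expr.cost]) (by simpa [Expr.val] using this)
  · rw [Nat.mul_succ] at hU; omega

/-! ### Terms with bounded sums and queries -/

/-- Terms: arithmetic, memory access, comparison queries, bounded sums and preference queries about
sets given by comprehension. `sum x y b` adds the values of `b` for the values `0, 1, …` of register
`x` below register `y`. `pref v x y φ ψ a` asks whether agent `v` prefers the set of all `a` with
`φ` to the set of all `a` with `ψ`, where again register `x` runs below register `y`. -/
inductive Term where
  | num (c : ℕ)
  | reg (x : ℕ)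
  | get (p : ℕ) (e : Term)
  | add (e f : Term)
  | sub (e f : Term)
  | ord (e f : Term)
  | sum (x y : ℕ) (b : Term)
  | pref (v : Term) (x y : ℕ) (φ ψ a : Term)

namespace Term

/-- Value of a term. Preference queries about sets of the wrong size have value `0`. -/
noncomputable def val (I : Instance (Fin n) d) : Term → Memory → ℕ
  | num c, _ => c
  | reg x, m => m.reg x
  | get p e, m => m.arr p (e.val I m)
  | add e f, m => e.val I m + f.val I m
  | sub e f, m => e.val I m - f.val I m
  | ord e f, m => I.orderAnswer (e.val I m) (f.val I m)
  | sum x y b, m => ∑ j ∈ range (m.reg y), b.val I (m.setReg x j)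
  | pref v x y φ ψ a, m =>
    if #{j ∈ range (m.reg y) | φ.val I (m.setReg x j) ≠ 0} = d - 1 ∧
        #{j ∈ range (m.reg y) | ψ.val I (m.setReg x j) ≠ 0} = d - 1 then
      I.prefAnswer (v.val I m)
        ({j ∈ range (m.reg y) | φ.val I (m.setReg x j) ≠ 0}.image fun j => a.val I (m.setReg x j))
        ({j ∈ range (m.reg y) | ψ.val I (m.setReg x j) ≠ 0}.image fun j => a.val I (m.setReg x j))
    else 0

/-- All registers and arrays of the term are below `k`, and register `1` is not bound. -/
def wf (k : ℕ) : Term → Bool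
  | num _ => true
  | reg x => decide (x < k)
  | get p e => decide (p < k) && e.wf k
  | add e f => e.wf k && f.wf k
  | sub e f => e.wf k && f.wf k
  | ord e f => e.wf k && f.wf k
  | sum x y b => decide (x < k) && decide (x ≠ 1) && decide (y < k) && b.wf k
  | pref v x y φ ψ a => v.wf k && decide (x < k) && decide (x ≠ 1) && decide (y < k) && φ.wf k &&
      ψ.wf k && a.wf k

/-- All registers that bound sums are in the list `l` or are themselves bound. -/
def bounded : List ℕ → Term → Bool
  | _, num _ => true
  | _, reg _ => true
  | l, get _ e => e.bounded l
  | l, add e f => e.bounded l && f.bounded l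
  | l, sub e f => e.bounded l && f.bounded l
  | l, ord e f => e.bounded l && f.bounded l
  | l, sum x y b => decide (y ∈ l) && b.bounded (x :: l)
  | l, pref v x y φ ψ a => v.bounded l && decide (y ∈ l) && φ.bounded (x :: l) &&
      ψ.bounded (x :: l) && a.bounded (x :: l)

/-- Running time bound for a term whose sums have at most `V` summands. -/
def cost (V : ℕ) : Term → ℕ
  | num _ => 2
  | reg _ => 2
  | get _ e => e.cost V + 3
  | add e f => e.cost V + f.cost V + 4
  | sub e f => e.cost V + f.cost V + 4
  | ord e f => e.cost V + f.cost V + 4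
  | sum _ _ b => (b.cost V + 20) * (V + 1) + 20
  | pref v _ _ φ ψ a => v.cost V + (φ.cost V + a.cost V + 20) * (V + 1) +
      (ψ.cost V + a.cost V + 20) * (V + 1) + 2 * V + 60

/-- List in array `p` the values of `a` for the values of register `x` below register `y` with `φ`,
and count them in register `r`. -/
def collect (r x y p k : ℕ) (φ a : Program) : Program :=
  .seq (.assign r (.num 0))
    (.forTo x y (.seq φ (.ite (.reg k)
      (.seq a (.seq (.put p (.reg r) (.reg k)) (.assign r (.add (.reg r) (.num 1))))) .skip)))

/-- Program that stores the value of a term in register `k` and otherwise changes only registers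
and arrays from `k` on. -/
def comp : Term → ℕ → Program
  | num c, k => .assign k (.num c)
  | reg x, k => .assign k (.reg x)
  | get p e, k => .seq (e.comp k) (.assign k (.get p (.reg k)))
  | add e f, k => .seq (e.comp k) (.seq (f.comp (k + 1)) (.assign k (.add (.reg k) (.reg (k + 1)))))
  | sub e f, k => .seq (e.comp k) (.seq (f.comp (k + 1)) (.assign k (.sub (.reg k) (.reg (k + 1)))))
  | ord e f, k => .seq (e.comp k) (.seq (f.comp (k + 1)) (.askOrder k (.reg k) (.reg (k + 1))))
  | sum x y b, k =>
    .seq (.assign k (.num 0)) (.seq (.assign (k + 1) (.reg x)) (.seq (.assign (k + 2) (.reg y))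
      (.seq (.forTo x (k + 2) (.seq (b.comp (k + 3)) (.assign k (.add (.reg k) (.reg (k + 3))))))
        (.assign x (.reg (k + 1))))))
  | pref v x y φ ψ a, k =>
    .seq (v.comp k) (.seq (.assign (k + 1) (.reg x)) (.seq (.assign (k + 2) (.reg y))
      (.seq (collect (k + 3) x (k + 2) k (k + 5) (φ.comp (k + 5)) (a.comp (k + 5)))
      (.seq (collect (k + 4) x (k + 2) (k + 1) (k + 5) (ψ.comp (k + 5)) (a.comp (k + 5)))
      (.seq (.assign x (.reg (k + 1)))
      (.seq (.askPref k (.reg k) k (.num 0) (k + 1) (.num 0))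
        (.ite (.add
          (.add (.sub (.reg (k + 3)) (.sub (.reg 1) (.num 1)))
            (.sub (.sub (.reg 1) (.num 1)) (.reg (k + 3))))
          (.add (.sub (.reg (k + 4)) (.sub (.reg 1) (.num 1)))
            (.sub (.sub (.reg 1) (.num 1)) (.reg (k + 4)))))
          (.assign k (.num 0)) .skip)))))))

end Term

/-! ### Correctness and cost of compiled terms -/

/-- The memories agree on registers and arrays below `k`. -/
def Frame (k : ℕ) (m m' : Memory) : Prop :=
  (∀ y < k, m'.reg y = m.reg y) ∧ ∀ p < k, m'.arr p = m.arr p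

theorem Frame.refl (k : ℕ) (m : Memory) : Frame k m m := ⟨fun _ _ => rfl, fun _ _ => rfl⟩

theorem Frame.trans {k : ℕ} {m m' m'' : Memory} (h : Frame k m m') (h' : Frame k m' m'') :
    Frame k m m'' :=
  ⟨fun y hy => (h'.1 y hy).trans (h.1 y hy), fun y hy => (h'.2 y hy).trans (h.2 y hy)⟩

theorem Frame.anti {k l : ℕ} {m m' : Memory} (h : Frame l m m') (hk : k ≤ l) : Frame k m m' :=
  ⟨fun y hy => h.1 y (hy.trans_le hk), fun y hy => h.2 y (hy.trans_le hk)⟩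

theorem Frame.setReg {k : ℕ} {m m' : Memory} (h : Frame k m m') {x : ℕ} (v : ℕ) (hx : k ≤ x) :
    Frame k m (m'.setReg x v) :=
  ⟨fun y hy => by simp [show y ≠ x by omega, h.1 y hy], fun y hy => by simp [h.2 y hy]⟩

theorem Frame.setReg_both {k : ℕ} {m m' : Memory} (h : Frame k m m') (x v : ℕ) :
    Frame k (m.setReg x v) (m'.setReg x v) :=
  ⟨fun y hy => by simp [h.1 y hy], fun y hy => by simp [h.2 y hy]⟩

namespace Term

theorem val_congr {k : ℕ} (t : Term) {m m' : Memory} (ht : t.wf k = true) (h : Frame k m m') :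
    t.val I m' = t.val I m := by
  induction t generalizing m m' with
  | num c => rfl
  | reg x => simp [wf] at ht; simp [val, h.1 x ht]
  | get p e ih => simp [wf] at ht; simp [val, ih ht.2 h, h.2 p ht.1]
  | add e f ih ih' => simp [wf] at ht; simp [val, ih ht.1 h, ih' ht.2 h]
  | sub e f ih ih' => simp [wf] at ht; simp [val, ih ht.1 h, ih' ht.2 h]
  | ord e f ih ih' => simp [wf] at ht; simp [val, ih ht.1 h, ih' ht.2 h]
  | sum x y b ih =>
    simp [wf] at ht
    simp only [val, h.1 y ht.1.2]
    exact sum_congr rfl fun j _ => ih ht.2 (h.setReg_both x j)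
  | pref v x y φ ψ a ihv ihφ ihψ iha =>
    simp [wf] at ht
    obtain ⟨⟨⟨⟨⟨⟨h1, h2⟩, h3⟩, h4⟩, h5⟩, h6⟩, h7⟩ := ht
    have e1 := fun j => ihφ h5 (h.setReg_both x j)
    have e2 := fun j => ihψ h6 (h.setReg_both x j)
    have e3 := fun j => iha h7 (h.setReg_both x j)
    simp only [val, h.1 y h4, ihv h1 h, e1, e2, e3]

end Term

/-- The level `l` separates reading from writing. The terms read only below `l`, where the loop
changes nothing but `x`; the counter `r`, the bound `y` and the list `p` lie between `l` and `k`;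
the scratch space of the compiled terms starts at `k`. So neither side disturbs the other. -/
theorem Runs.collect {φ a : Term} {r x y p k l : ℕ} {m : Memory} {B Tφ Ta : ℕ}
    (hφ : φ.wf l = true) (ha : a.wf l = true)
    (hx : x < l) (hr : l ≤ r) (hrk : r < k) (hy : l ≤ y) (hyk : y < k) (hry : r ≠ y) (hp : l ≤ p)
    (hpk : p < k) (hB : m.reg y = B)
    (runφ : ∀ j < B, ∀ m', Frame l (m.setReg x j) m' →
      Runs I (φ.comp k) m' Tφ fun m'' => m''.reg k = φ.val I m' ∧ Frame k m' m'')
    (runa : ∀ j < B, ∀ m', Frame l (m.setReg x j) m' →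
      Runs I (a.comp k) m' Ta fun m'' => m''.reg k = a.val I m' ∧ Frame k m' m'') :
    Runs I (Term.collect r x y p k (φ.comp k) (a.comp k)) m ((Tφ + Ta + 20) * (B + 1) + 2)
      fun m' =>
        m'.reg r = #{j ∈ range B | φ.val I (m.setReg x j) ≠ 0} ∧
        m'.segment p 0 (m'.reg r) =
          {j ∈ range B | φ.val I (m.setReg x j) ≠ 0}.image (fun j => a.val I (m.setReg x j)) ∧
        (∀ z < k, z ≠ r → z ≠ x → m'.reg z = m.reg z) ∧ ∀ q < k, q ≠ p → m'.arr q = m.arr q := by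
  set S : ℕ → Finset ℕ := fun j => {i ∈ range j | φ.val I (m.setReg x i) ≠ 0} with hS
  set f : ℕ → ℕ := fun j => a.val I (m.setReg x j) with hf
  refine Runs.seq (T := 2) (T' := (Tφ + Ta + 20) * (B + 1)) ?_ (by omega)
  refine Runs.assign (by simp [Expr.cost]) ?_
  refine Runs.mono (Runs.forTo (B := B) (T := Tφ + Ta + 12) (fun j m' =>
    m'.reg x = j ∧ m'.reg y = B ∧ m'.reg r = #(S j) ∧ m'.segment p 0 (m'.reg r) = (S j).image f ∧
    (∀ z < k, z ≠ r → z ≠ x → m'.reg z = m.reg z) ∧ ∀ q < k, q ≠ p → m'.arr q = m.arr q)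
    ?_ (fun j m' h => ⟨h.1, h.2.1⟩) ?_ le_rfl) ?_ ?_
  · have h1 : y ≠ x := by omega
    have h2 : y ≠ r := Ne.symm hry
    have h3 : r ≠ x := by omega
    simp only [Memory.setReg_reg, Expr.val, h1, h2, h3, if_true, if_false, hB]
    refine ⟨trivial, trivial, by simp [hS], by simp [hS, Memory.segment], ?_, ?_⟩
    · intro z _ hz hz'; simp [hz, hz']
    · intro q _ _; rfl
  · rintro j hj m' ⟨i1, i2, i3, i4, i5, i6⟩
    have fr : Frame l (m.setReg x j) m' := by
      refine ⟨fun z hz => ?_, fun q hq => by rw [i6 q (by omega) (by omega)]; rfl⟩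
      by_cases hzx : z = x
      · subst hzx; simp [i1]
      · simp [hzx, i5 z (by omega) (by omega) hzx]
    have vφ : φ.val I m' = φ.val I (m.setReg x j) := φ.val_congr hφ fr
    refine Runs.seq (T := Tφ) (T' := Ta + 12) ?_ (by omega)
    refine (runφ j hj m' fr).mono le_rfl ?_
    rintro m₁ ⟨j1, j2⟩
    refine Runs.ite (T := Ta + 10) ?_ ?_ (by simp [Expr.cost]; omega)
    · intro hne
      have hne' : φ.val I (m.setReg x j) ≠ 0 := by simpa [Expr.val, j1, vφ] using hne
      have hSj : S (j + 1) = insert j (S j) := by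
        simp [hS, range_add_one, filter_insert, hne']
      have hjS : j ∉ S j := by simp [hS]
      refine Runs.seq (T := Ta) (T' := 10) ?_ (by omega)
      have fr' : Frame l (m.setReg x j) m₁ := fr.trans (j2.anti (by omega))
      refine (runa j hj m₁ fr').mono le_rfl ?_
      rintro m₂ ⟨k1, k2⟩
      have fr2 := j2.trans k2
      rw [a.val_congr ha fr'] at k1
      have er : m₂.reg r = #(S j) := by rw [fr2.1 r hrk, i3]
      refine Runs.seq (T := 3) (T' := 4) (Runs.put (by simp [Expr.cost]) ?_) (by omega)
      refine Runs.assign (by simp [Expr.cost]) ?_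
      have hxr : x ≠ r := by omega
      have hyr : y ≠ r := Ne.symm hry
      have hyx : y ≠ x := by omega
      have hxk : x < k := by omega
      simp only [Memory.setReg_reg, Expr.val, Memory.setArr_reg, hxr, hyr, hyx, hxr.symm, if_true,
        if_false, er, k1]
      refine ⟨by rw [fr2.1 x hxk, i1], trivial, by rw [fr2.1 y hyk, i2], ?_, ?_, ?_, ?_⟩
      · rw [hSj, card_insert_of_notMem hjS]
      · rw [hSj, image_insert, ← i4, i3]
        simp only [Memory.segment, Memory.setReg_arr, range_add_one, image_insert]
        congr 1
        · simp [hf]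
        · refine image_congr fun i hi => ?_
          have : i < #(S j) := by simpa using hi
          have h' : 0 + i ≠ #(S j) := by omega
          rw [Memory.setArr_arr, if_neg (by simp; omega), fr2.2 p hpk]
      · intro z hz hzr hzx
        simp only [hzr, hzx, if_false]
        rw [fr2.1 z hz, i5 z hz hzr hzx]
      · intro q hq hqp
        ext i
        simp only [Memory.setReg_arr, Memory.setArr_arr, hqp, false_and, if_false]
        rw [fr2.2 q hq, i6 q hq hqp]
    · intro heq
      have heq' : φ.val I (m.setReg x j) = 0 := by simpa [Expr.val, j1, vφ] using heq
      have hSj : S (j + 1) = S j := by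
        simp [hS, range_add_one, filter_insert, heq']
      refine Runs.skip (by omega) ?_
      have hrx : r ≠ x := by omega
      have hyx : y ≠ x := by omega
      have hxk : x < k := by omega
      simp only [Memory.setReg_reg, hrx, hyx, if_true, if_false, hSj, Memory.segment,
        Memory.setReg_arr, j2.1 r hrk, j2.2 p hpk, j2.1 x hxk, j2.1 y hyk]
      refine ⟨i1, trivial, i2, i3, i4, ?_, ?_⟩
      · intro z hz hzr hzx
        rw [if_neg hzx, j2.1 z hz, i5 z hz hzr hzx]
      · intro q hq hqp
        rw [j2.2 q hq, i6 q hq hqp]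
  · apply Nat.mul_le_mul_right; omega
  · rintro m' ⟨-, -, h⟩
    exact h

/-- Program for a binary operation on the values of two terms. -/
theorem Runs.binary {e f : Term} {k U W : ℕ} {c : Program} {g : ℕ → ℕ → ℕ} {m : Memory}
    (hf : f.wf k = true)
    (he : Runs I (e.comp k) m U fun m' => m'.reg k = e.val I m ∧ Frame k m m')
    (hf' : ∀ m', Frame k m m' → Runs I (f.comp (k + 1)) m' W fun m'' =>
      m''.reg (k + 1) = f.val I m' ∧ Frame (k + 1) m' m'')
    (hc : ∀ m, Runs I c m 4 fun m' => m' = m.setReg k (g (m.reg k) (m.reg (k + 1)))) :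
    Runs I (.seq (e.comp k) (.seq (f.comp (k + 1)) c)) m (U + W + 4) fun m' =>
      m'.reg k = g (e.val I m) (f.val I m) ∧ Frame k m m' := by
  refine Runs.seq (T := U) (T' := W + 4) (he.mono le_rfl ?_) (by omega)
  rintro m₁ ⟨h1, h2⟩
  refine Runs.seq (T := W) (T' := 4) ((hf' m₁ h2).mono le_rfl ?_) (by omega)
  rintro m₂ ⟨h3, h4⟩
  refine (hc m₂).mono le_rfl ?_
  rintro m₃ rfl
  refine ⟨?_, (h2.trans (h4.anti (by omega))).setReg _ le_rfl⟩
  rw [Memory.setReg_reg, if_pos rfl, h3, h4.1 k (by omega), h1, f.val_congr hf h2]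

theorem Term.wf_mono {k l : ℕ} (t : Term) (h : t.wf k = true) (hkl : k ≤ l) : t.wf l = true := by
  induction t with
  | num c => rfl
  | reg x => simp [wf] at *; omega
  | get p e ih => simp [wf] at *; exact ⟨by omega, ih h.2⟩
  | add e f ih ih' => simp [wf] at *; exact ⟨ih h.1, ih' h.2⟩
  | sub e f ih ih' => simp [wf] at *; exact ⟨ih h.1, ih' h.2⟩
  | ord e f ih ih' => simp [wf] at *; exact ⟨ih h.1, ih' h.2⟩
  | sum x y b ih => simp [wf] at *; exact ⟨⟨⟨by omega, h.1.1.2⟩, by omega⟩, ih h.2⟩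
  | pref v x y φ ψ a ihv ihφ ihψ iha =>
    simp [wf] at *
    obtain ⟨⟨⟨⟨⟨⟨h1, h2⟩, h3⟩, h4⟩, h5⟩, h6⟩, h7⟩ := h
    exact ⟨⟨⟨⟨⟨⟨ihv h1, by omega⟩, h3⟩, by omega⟩, ihφ h5⟩, ihψ h6⟩, iha h7⟩

/-- Registers in the list are below `k` and have values at most `V`, and register `1` holds `d`. -/
structure Small (d V k : ℕ) (l : List ℕ) (m : Memory) : Prop where
  one_lt : 1 < k
  le : d ≤ V
  reg_one : m.reg 1 = d
  lt : ∀ y ∈ l, y < k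
  reg_le : ∀ y ∈ l, m.reg y ≤ V

theorem Small.frame {V k : ℕ} {l : List ℕ} {m m' : Memory} (h : Small d V k l m)
    (hm : Frame k m m') : Small d V k l m' where
  one_lt := h.one_lt
  le := h.le
  reg_one := (hm.1 1 h.one_lt).trans h.reg_one
  lt := h.lt
  reg_le y hy := (hm.1 y (h.lt y hy)).trans_le (h.reg_le y hy)

theorem Small.mono {V k k' : ℕ} {l : List ℕ} {m : Memory} (h : Small d V k l m)
    (hk : k ≤ k') : Small d V k' l m where
  one_lt := h.one_lt.trans_le hk
  le := h.le
  reg_one := h.reg_one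
  lt y hy := (h.lt y hy).trans_le hk
  reg_le := h.reg_le

theorem Small.cons {V k x j : ℕ} {l : List ℕ} {m : Memory} (h : Small d V k l m)
    (hx : x < k) (hx1 : x ≠ 1) (hj : j ≤ V) : Small d V k (x :: l) (m.setReg x j) where
  one_lt := h.one_lt
  le := h.le
  reg_one := by simp [hx1.symm, h.reg_one]
  lt y hy := by
    rcases List.mem_cons.1 hy with rfl | hy
    · exact hx
    · exact h.lt y hy
  reg_le y hy := by
    by_cases hyx : y = x
    · simp [hyx, hj]
    · simpa [hyx] using h.reg_le y (by simpa [hyx] using hy)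

/-- Induction on the term. The scratch level rises above every intermediate value that is still
needed, and a bound register `x` is saved and restored, so that everything below `k` survives. The
invariant `Small` bounds the number of summands by `V` and, by `d ≤ V`, the charge for a preference
query. -/
theorem Runs.term (t : Term) {V k : ℕ} {m : Memory} {l : List ℕ} (hk : t.wf k = true)
    (hl : t.bounded l = true) (hm : Small d V k l m) :
    Runs I (t.comp k) m (t.cost V) fun m' => m'.reg k = t.val I m ∧ Frame k m m' := by
  induction t generalizing m l k with
  | num c =>
    refine Runs.assign (by simp [Expr.cost, Term.cost]) ?_
    exact ⟨by simp [Expr.val, Term.val], (Frame.refl _ _).setReg _ le_rfl⟩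
  | reg x =>
    refine Runs.assign (by simp [Expr.cost, Term.cost]) ?_
    exact ⟨by simp [Expr.val, Term.val], (Frame.refl _ _).setReg _ le_rfl⟩
  | get p e ih =>
    simp [Term.wf] at hk
    refine Runs.seq ((ih hk.2 hl hm).mono le_rfl ?_) (T' := 3) (by simp [Term.cost])
    rintro m' ⟨h1, h2⟩
    refine Runs.assign (by simp [Expr.cost]) ⟨?_, h2.setReg _ le_rfl⟩
    simp [Expr.val, Term.val, h1, h2.2 p hk.1]
  | add e f ih ih' =>
    simp [Term.wf] at hk
    simp [Term.bounded] at hl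
    exact Runs.binary (g := (· + ·)) hk.2 (ih hk.1 hl.1 hm)
      (fun m' h => ih' (f.wf_mono hk.2 (by omega)) hl.2 ((hm.frame h).mono (by omega)))
      (fun m => Runs.assign (by simp [Expr.cost]) rfl)
  | sub e f ih ih' =>
    simp [Term.wf] at hk
    simp [Term.bounded] at hl
    exact Runs.binary (g := (· - ·)) hk.2 (ih hk.1 hl.1 hm)
      (fun m' h => ih' (f.wf_mono hk.2 (by omega)) hl.2 ((hm.frame h).mono (by omega)))
      (fun m => Runs.assign (by simp [Expr.cost]) rfl)
  | ord e f ih ih' =>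
    simp [Term.wf] at hk
    simp [Term.bounded] at hl
    exact Runs.binary (g := I.orderAnswer) hk.2 (ih hk.1 hl.1 hm)
      (fun m' h => ih' (f.wf_mono hk.2 (by omega)) hl.2 ((hm.frame h).mono (by omega)))
      (fun m => Runs.askOrder (by simp [Expr.cost]) rfl)
  | sum x y b ih =>
    simp [Term.wf] at hk
    simp [Term.bounded] at hl
    obtain ⟨⟨⟨hx, hx1⟩, hy⟩, hb⟩ := hk
    have hyV := hm.reg_le y hl.1
    refine Runs.seq (T := 2) (T' := (b.cost V + 20) * (V + 1) + 10)
      (Runs.assign (by simp [Expr.cost]) ?_) (by simp [Term.cost]; omega)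
    refine Runs.seq (T := 2) (T' := (b.cost V + 20) * (V + 1) + 8)
      (Runs.assign (by simp [Expr.cost]) ?_) (by omega)
    refine Runs.seq (T := 2) (T' := (b.cost V + 20) * (V + 1) + 6)
      (Runs.assign (by simp [Expr.cost]) ?_) (by omega)
    refine Runs.seq (T := (b.cost V + 20) * (V + 1)) (T' := 2) ?_ (by omega)
    -- The loop runs up to the copy of the bound in register `k + 2`, since `x` and `y` may be the
    -- same register; register `k + 1` keeps the old value of `x`.
    refine Runs.mono (Runs.forTo (B := m.reg y) (T := b.cost V + 4) (fun j m' =>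
      m'.reg x = j ∧ m'.reg (k + 2) = m.reg y ∧ m'.reg (k + 1) = m.reg x ∧
      m'.reg k = ∑ i ∈ range j, b.val I (m.setReg x i) ∧ Frame k (m.setReg x j) m')
      ?_ (fun j m' h => ⟨h.1, h.2.1⟩) ?_ le_rfl) ?_ ?_
    · have e1 : x ≠ k := by omega
      have e2 : x ≠ k + 1 := by omega
      have e3 : y ≠ k + 1 := by omega
      have e4 : y ≠ k := by omega
      have e5 : k + 1 ≠ x := by omega
      have e6 : k + 2 ≠ x := by omega
      simp only [Memory.setReg_reg, Expr.val]
      refine ⟨by simp, by simp [e6, e3, e4], by simp [e5, e1], by simp [e1.symm], ?_⟩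
      exact ((((Frame.refl k m).setReg _ le_rfl).setReg _ (by omega)).setReg _
        (by omega)).setReg_both _ _
    · rintro j hj m' ⟨i1, i2, i3, i4, i5⟩
      refine Runs.seq (T := b.cost V) (T' := 4) ?_ le_rfl
      refine (ih (b.wf_mono hb (by omega)) hl.2 (k := k + 3)
        (((hm.cons hx hx1 (by omega)).frame i5).mono (by omega))).mono le_rfl ?_
      rintro m₁ ⟨j1, j2⟩
      rw [b.val_congr hb i5] at j1
      refine Runs.assign (by simp [Expr.cost]) ?_
      have e1 : x ≠ k := by omega
      have e5 : k + 1 ≠ x := by omega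
      have e6 : k + 2 ≠ x := by omega
      simp only [Memory.setReg_reg, Expr.val]
      refine ⟨?_, by simp, ?_, ?_, ?_, ?_⟩
      · rw [if_neg e1, j2.1 x (by omega), i1]
      · rw [if_neg e6, if_neg (by omega), j2.1 _ (by omega), i2]
      · rw [if_neg e5, if_neg (by omega), j2.1 _ (by omega), i3]
      · rw [if_neg e1.symm, if_pos trivial, j1, j2.1 _ (by omega), i4, sum_range_succ]
      · have := ((i5.trans (j2.anti (by omega))).setReg (m₁.reg k + m₁.reg (k + 3))
          le_rfl).setReg_both x (j + 1)
        refine ⟨fun z hz => ?_, this.2⟩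
        rw [this.1 z hz]
        by_cases hz : z = x <;> simp [hz]
    · exact Nat.mul_le_mul (by omega) (by omega)
    · rintro m' ⟨i1, i2, i3, i4, i5⟩
      refine Runs.assign (by simp [Expr.cost]) ⟨?_, fun z hz => ?_, fun p hp => ?_⟩
      · simp [show k ≠ x by omega, i4, Term.val]
      · by_cases hzx : z = x
        · simp [hzx, Expr.val, i3]
        · simp [hzx, i5.1 z hz]
      · simp [i5.2 p hp]
  | pref v x y φ ψ a ihv ihφ ihψ iha =>
    simp [Term.wf] at hk
    simp [Term.bounded] at hl
    obtain ⟨⟨⟨⟨⟨⟨hv, hx⟩, hx1⟩, hy⟩, hφ⟩, hψ⟩, ha⟩ := hk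
    obtain ⟨⟨⟨⟨lv, ly⟩, lφ⟩, lψ⟩, la⟩ := hl
    have hyV := hm.reg_le y ly
    have hd := hm.reg_one
    have h1k := hm.one_lt
    set B := m.reg y with hB
    set Cφ := (φ.cost V + a.cost V + 20) * (V + 1)
    set Cψ := (ψ.cost V + a.cost V + 20) * (V + 1)
    have cφ : (φ.cost V + a.cost V + 20) * (B + 1) ≤ Cφ := Nat.mul_le_mul le_rfl (by omega)
    have cψ : (ψ.cost V + a.cost V + 20) * (B + 1) ≤ Cψ := Nat.mul_le_mul le_rfl (by omega)
    refine Runs.seq (T := v.cost V) (T' := Cφ + Cψ + 2 * V + 60) ?_ (by simp [Term.cost]; omega)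
    refine (ihv hv lv hm).mono le_rfl ?_
    rintro m₁ ⟨h1, h2⟩
    refine Runs.seq (T := 2) (T' := Cφ + Cψ + 2 * V + 58)
      (Runs.assign (by simp [Expr.cost]) ?_) (by omega)
    refine Runs.seq (T := 2) (T' := Cφ + Cψ + 2 * V + 56)
      (Runs.assign (by simp [Expr.cost]) ?_) (by omega)
    set m₂ := (m₁.setReg (k + 1) ((Expr.reg x).val m₁)) with hm₂
    set m₃ := (m₂.setReg (k + 2) ((Expr.reg y).val m₂)) with hm₃
    have fr3 : Frame k m m₃ := (h2.setReg _ (by omega)).setReg _ (by omega)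
    have r1 : m₃.reg (k + 1) = m.reg x := by simp [hm₃, hm₂, Expr.val, h2.1 x hx]
    have r2 : m₃.reg (k + 2) = B := by
      simp [hm₃, hm₂, Expr.val, show y ≠ k + 1 by omega, h2.1 y hy, hB]
    have r3 : m₃.reg k = v.val I m := by simp [hm₃, hm₂, h1]
    refine Runs.seq (T := Cφ + 2) (T' := Cψ + 2 * V + 50) ?_ (by omega)
    have run : ∀ (u : Term), u.wf k = true → u.bounded (x :: l) = true →
        (∀ {k : ℕ} {m : Memory} {l : List ℕ}, u.wf k = true → u.bounded l = true →
          Small d V k l m → Runs I (u.comp k) m (u.cost V) fun m' =>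
          m'.reg k = u.val I m ∧ Frame k m m') →
        ∀ m₃, Frame k (m.setReg x (m₃.reg x)) m₃ → ∀ j < B, ∀ m', Frame k (m₃.setReg x j) m' →
        Runs I (u.comp (k + 5)) m' (u.cost V) fun m'' =>
          m''.reg (k + 5) = u.val I m' ∧ Frame (k + 5) m' m'' := by
      intro u hu lu ih m₃ hm₃ j hj m' hm'
      refine ih (u.wf_mono hu (by omega)) lu (Small.mono (k := k) ?_ (by omega))
      refine Small.frame (Small.cons hm hx hx1 (show j ≤ V by omega)) (Frame.trans ?_ hm')
      refine ⟨fun z hz => ?_, hm₃.2⟩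
      by_cases hzx : z = x
      · simp [hzx]
      · have := hm₃.1 z hz
        simp [hzx] at this
        simp [hzx, this]
    have fr3' : Frame k (m.setReg x (m₃.reg x)) m₃ := by
      refine ⟨fun z hz => ?_, fr3.2⟩
      by_cases hzx : z = x
      · simp [hzx]
      · simp [hzx, fr3.1 z hz]
    refine (Runs.collect (l := k) (B := B) (Tφ := φ.cost V) (Ta := a.cost V) hφ ha hx
      (by omega) (by omega) (by omega) (by omega) (by omega) le_rfl (by omega) r2
      (run φ hφ lφ ihφ m₃ fr3') (run a ha la iha m₃ fr3')).mono (by omega) ?_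
    rintro m₄ ⟨s1, s2, s3, s4⟩
    have fr4 : Frame k (m.setReg x (m₄.reg x)) m₄ := by
      refine ⟨fun z hz => ?_, fun q hq => ?_⟩
      · by_cases hzx : z = x
        · simp [hzx]
        · simp [hzx, s3 z (by omega) (by omega) hzx, fr3.1 z hz]
      · rw [s4 q (by omega) (by omega), fr3.2 q hq]; rfl
    refine Runs.seq (T := Cψ + 2) (T' := 2 * V + 45) ?_ (by omega)
    refine (Runs.collect (l := k) (B := B) (Tφ := ψ.cost V) (Ta := a.cost V) hψ ha hx
      (by omega) (by omega) (by omega) (by omega) (by omega) (by omega) (by omega)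
      (by rw [s3 _ (by omega) (by omega) (by omega), r2])
      (run ψ hψ lψ ihψ m₄ fr4) (run a ha la iha m₄ fr4)).mono (by omega) ?_
    rintro m₅ ⟨t1, t2, t3, t4⟩
    have val3 : ∀ u : Term, u.wf k = true → ∀ j, u.val I (m₃.setReg x j) = u.val I (m.setReg x j) :=
      fun u hu j => u.val_congr hu (fr3.setReg_both x j)
    have val4 : ∀ u : Term, u.wf k = true →
        ∀ j, u.val I (m₄.setReg x j) = u.val I (m.setReg x j) := fun u hu j => by
      refine u.val_congr hu ⟨fun z hz => ?_, fr4.2⟩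
      by_cases hzx : z = x
      · simp [hzx]
      · have := fr4.1 z hz
        simp [hzx] at this
        simp [hzx, this]
    simp only [val3 φ hφ, val3 a ha] at s1 s2
    simp only [val4 ψ hψ, val4 a ha] at t1 t2
    have u3 : m₅.reg (k + 3) = m₄.reg (k + 3) := t3 _ (by omega) (by omega) (by omega)
    have ua : m₅.arr k = m₄.arr k := t4 k (by omega) (by omega)
    refine Runs.seq (T := 2) (T' := 2 * V + 40) (Runs.assign (by simp [Expr.cost]) ?_) (by omega)
    refine Runs.seq (T := 2 * V + 10) (T' := 30) ?_ (by omega)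
    refine ⟨_, _, .askPref _ _ _ _ _ _ _, ?_, ?_⟩
    · have := hm.le
      simp [Expr.cost]; omega
    -- The query is made in any case and its answer discarded afterwards if a size is wrong. The sum
    -- of the four truncated differences is `0` exactly when both counts are `d - 1`.
    refine Runs.ite (T := 2) ?_ ?_ (by simp [Expr.cost])
    all_goals
      simp only [Expr.val, Memory.setReg_reg, Memory.segment, Memory.setReg_arr]
      have e0 : k ≠ x := by omega
      have e1 : k + 3 ≠ x := by omega
      have e2 : k + 4 ≠ x := by omega
      have e3 : (1 : ℕ) ≠ k := by omega
      have e4 : m₅.reg 1 = d := by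
        rw [t3 1 (by omega) (by omega) (Ne.symm hx1), s3 1 (by omega) (by omega) (Ne.symm hx1),
          fr3.1 1 h1k, hd]
      have e5 : m₅.reg k = v.val I m := by
        rw [t3 k (by omega) (by omega) e0, s3 k (by omega) (by omega) e0, r3]
      have e6 : m₅.reg (k + 1) = m.reg x := by
        rw [t3 _ (by omega) (by omega) (by omega), s3 _ (by omega) (by omega) (by omega), r1]
      have fr : ∀ w, Frame k m ((m₅.setReg x (m₅.reg (k + 1))).setReg k w) := by
        intro w
        refine ⟨fun z hz => ?_, fun q hq => ?_⟩
        · by_cases hzx : z = x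
          · simp [hzx, e0.symm, e6]
          · simp [hzx, show z ≠ k by omega, t3 z (by omega) (by omega) hzx,
              s3 z (by omega) (by omega) hzx, fr3.1 z hz]
        · simp [t4 q (by omega) (by omega), s4 q (by omega) (by omega), fr3.2 q hq]
      simp only [e0, e1, e2, e3, Ne.symm hx1, if_false, e4, t1, u3, s1,
        show k + 3 ≠ k by omega, show k + 4 ≠ k by omega]
      intro hc
    · have hc' : ¬ (#{j ∈ range B | φ.val I (m.setReg x j) ≠ 0} = d - 1 ∧
        #{j ∈ range B | ψ.val I (m.setReg x j) ≠ 0} = d - 1) := by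
        rintro ⟨q1, q2⟩
        rw [q1, q2] at hc
        simp at hc
      refine Runs.assign (by simp [Expr.cost]) ⟨?_, (fr _).setReg _ le_rfl⟩
      simp only [Memory.setReg_reg, if_true, Expr.val, Term.val]
      rw [if_neg hc']
    · have hc' : #{j ∈ range B | φ.val I (m.setReg x j) ≠ 0} = d - 1 ∧
        #{j ∈ range B | ψ.val I (m.setReg x j) ≠ 0} = d - 1 := by omega
      refine Runs.skip (by omega) ⟨?_, fr _⟩
      simp only [Memory.setReg_reg, if_true, Term.val]
      rw [if_pos hc', e5, ← s2, ← t2, s1, t1, hc'.1, hc'.2, ua]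
      rfl

end

/-! ### Exchange arguments -/

theorem exists_initial {A : Type} [DecidableEq A] (pos : A → ℕ) (hpos : pos.Injective)
    (U : Finset A) (k : ℕ) (hk : k ≤ #U) :
    ∃ F ⊆ U, #F = k ∧ ∀ u ∈ F, ∀ v ∈ U \ F, pos u < pos v := by
  induction k with
  | zero => exact ⟨∅, by simp, by simp, by simp⟩
  | succ k ih =>
    obtain ⟨F, hF, hc, h⟩ := ih (by omega)
    have hne : (U \ F).Nonempty := by
      rw [← card_pos, card_sdiff_of_subset hF]; omega
    obtain ⟨w, hw, hmin⟩ := exists_min_image (U \ F) pos hne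
    have hw' := mem_sdiff.1 hw
    refine ⟨insert w F, insert_subset hw'.1 hF, by rw [card_insert_of_notMem hw'.2, hc], ?_⟩
    intro u hu v hv
    simp only [mem_sdiff, mem_insert, not_or] at hv
    rcases mem_insert.1 hu with rfl | hu
    · have := hmin v (by simp [hv])
      have hne : pos u ≠ pos v := fun e => hv.2.1 (hpos e).symm
      omega
    · exact h u hu v (by simp [hv])

namespace Instance

variable {A : Type} [DecidableEq A] {d : ℕ} (I : Instance A d)

theorem Prefers.trans {I : Instance A d} {a : A} {s t u : Finset A} (h : I.Prefers a s t)
    (h' : I.Prefers a t u) : I.Prefers a s u := by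
  obtain ⟨hs, ht, h⟩ := h
  obtain ⟨_, hu, h'⟩ := h'
  exact ⟨hs, hu, (I.pref_strictOrder a).toIsStrictOrder.toIsTrans.trans _ _ _ h h'⟩

theorem Prefers.irrefl {I : Instance A d} {a : A} {s : Finset A} (h : I.Prefers a s s) : False := by
  obtain ⟨hs, _, h⟩ := h
  exact (I.pref_strictOrder a).toIsStrictOrder.toIrrefl.irrefl _ h

/-- Any bijection from `S \ T` to `T \ S`, extended by the identity, matches the partners in `S`
with those in `T` so that each is at least as good as its image. Therefore `derived` applies, and
its alternative of equality is ruled out by `S ≠ T`. -/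
theorem prefers_of_sdiff {S T : Finset A} (hS : #S = d) (hT : #T = d) (hne : S ≠ T)
    (h : ∀ u ∈ S \ T, ∀ v ∈ T \ S, I.gt u v) {a : A} (haS : a ∈ S) (haT : a ∈ T) :
    I.Prefers a (S.erase a) (T.erase a) := by
  have hd : 0 < d := hS ▸ card_pos.2 ⟨a, haS⟩
  have hs : a ∉ S.erase a ∧ #(S.erase a) + 1 = d := by simp [haS, hS]; omega
  have ht : a ∉ T.erase a ∧ #(T.erase a) + 1 = d := by simp [haT, hT]; omega
  have hcard : #(S \ T) = #(T \ S) := card_sdiff_comm (hS.trans hT.symm)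
  let e := Finset.equivOfCardEq hcard
  let g : A → A := fun u => if hu : u ∈ S \ T then (e ⟨u, hu⟩ : A) else u
  have hg : (S.erase a).image g = T.erase a := by
    ext v
    simp only [mem_image, mem_erase]
    constructor
    · rintro ⟨u, ⟨hua, hu⟩, rfl⟩
      by_cases hu' : u ∈ S \ T
      · simp only [g, dif_pos hu']
        have := mem_sdiff.1 (e ⟨u, hu'⟩).2
        exact ⟨fun h => this.2 (h ▸ haS), this.1⟩
      · simp only [g, dif_neg hu']
        refine ⟨hua, ?_⟩
        by_contra h'
        exact hu' (mem_sdiff.2 ⟨hu, h'⟩)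
    · rintro ⟨hva, hv⟩
      by_cases hv' : v ∈ S
      · exact ⟨v, ⟨hva, hv'⟩, by simp [g, hv]⟩
      · have hv2 : v ∈ T \ S := by simp [hv, hv']
        obtain ⟨⟨u, hu⟩, hu'⟩ := e.surjective ⟨v, hv2⟩
        refine ⟨u, ⟨?_, (mem_sdiff.1 hu).1⟩, by simp only [g, dif_pos hu, hu']⟩
        rintro rfl
        exact (mem_sdiff.1 hu).2 haT
  have hcd : #(S.erase a) = d - 1 := by omega
  let f : Fin (d - 1) → A := fun i => ((S.erase a).equivFinOfCardEq hcd).symm i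
  have hf : univ.image f = S.erase a := by
    ext v
    simp only [mem_image, mem_univ, true_and, f]
    constructor
    · rintro ⟨i, rfl⟩; exact Subtype.prop _
    · intro hv
      exact ⟨(S.erase a).equivFinOfCardEq hcd ⟨v, hv⟩, by simp⟩
  refine ⟨hs, ht, (I.derived a ⟨_, hs⟩ ⟨_, ht⟩ f (g ∘ f) hf ?_ ?_).resolve_left ?_⟩
  · rw [← image_image, hf, hg]
  · intro i
    simp only [Function.comp]
    by_cases hu : f i ∈ S \ T
    · simp only [g, dif_pos hu]
      exact (h _ hu _ (e ⟨f i, hu⟩).2).1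
    · simp only [g, dif_neg hu]
      exact I.ge_partialOrder.toIsPreorder.toRefl.refl _
  · intro heq
    apply hne
    rw [← insert_erase haS, ← insert_erase haT, Subtype.mk.inj heq]

/-- `pos` is injective and places better agents first. -/
structure IsPosition (pos : A → ℕ) : Prop where
  injective : pos.Injective
  lt_of_gt : ∀ u v, I.gt u v → pos u < pos v

variable {I} {pos : A → ℕ}

theorem IsPosition.gt_of_lt (hp : I.IsPosition pos) {u v : A} (h : pos u < pos v)
    (hc : ¬ IncompRel I.ge u v) : I.gt u v := by
  have hne : u ≠ v := by rintro rfl; omega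
  refine ⟨?_, hne⟩
  by_contra hge
  refine hc ⟨hge, fun h' => ?_⟩
  have := hp.lt_of_gt v u ⟨h', hne.symm⟩
  omega

/-- The first `d` elements of `S ∪ T` improve on `S` for their members in `S`. -/
theorem IsPosition.prefers_initial (hp : I.IsPosition pos) {S T F : Finset A} (hS : #S = d)
    (hF : #F = d) (hFST : F ⊆ S ∪ T) (hmin : ∀ u ∈ F, ∀ v ∈ (S ∪ T) \ F, pos u < pos v)
    (hc : ∀ u ∈ S, ∀ v ∈ T, ¬ IncompRel I.ge u v) (hne : F ≠ S) {a : A} (haF : a ∈ F)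
    (haS : a ∈ S) : I.Prefers a (F.erase a) (S.erase a) := by
  refine I.prefers_of_sdiff hF hS hne (fun u hu v hv => ?_) haF haS
  simp only [mem_sdiff] at hu hv
  have huT : u ∈ T := by simpa [hu.2] using hFST hu.1
  refine hp.gt_of_lt (hmin u hu.1 v (by simp [hv])) fun h => hc v hv.1 u huT h.symm

theorem IsMatching.eq_of_mem {M : Finset (Finset A)} (hM : I.IsMatching M) {S T : Finset A}
    (hS : S ∈ M) (hT : T ∈ M) {a : A} (haS : a ∈ S) (haT : a ∈ T) : S = T := by
  by_contra h
  exact disjoint_left.1 (hM.2 S hS T hT h) haS haT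

/-- If every member of `S` is comparable to every member of the matched set `T` and `S` blocks or
is matched, then the first `d` elements of `S ∪ T` block unless they are `S` or `T`. -/
theorem IsPosition.isBlocking_initial (hp : I.IsPosition pos) {M : Finset (Finset A)}
    (hM : I.IsMatching M) {S T F : Finset A} (hS : I.IsBlocking M S ∨ S ∈ M) (hT : T ∈ M)
    (hF : #F = d) (hFST : F ⊆ S ∪ T) (hmin : ∀ u ∈ F, ∀ v ∈ (S ∪ T) \ F, pos u < pos v)
    (hc : ∀ u ∈ S, ∀ v ∈ T, ¬ IncompRel I.ge u v) (hne : F ≠ S) (hne' : F ≠ T) :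
    I.IsBlocking M F := by
  have hSd : #S = d := hS.elim (fun h => h.1) (hM.1 S)
  refine ⟨hF, fun a haF => ?_⟩
  by_cases haT : a ∈ T
  · refine .inr ⟨T, hT, haT, hp.prefers_initial (T := S) (hM.1 T hT) hF ?_ ?_ ?_ hne' haF haT⟩
    · rwa [union_comm]
    · rwa [union_comm]
    · exact fun u hu v hv h => hc v hv u hu h.symm
  · have haS : a ∈ S := by simpa [haT] using hFST haF
    have h1 := hp.prefers_initial hSd hF hFST hmin hc hne haF haS
    rcases hS with hS | hS
    · rcases hS.2 a haS with h | ⟨t, ht, hat, h⟩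
      · exact .inl h
      · exact .inr ⟨t, ht, hat, h1.trans h⟩
    · exact .inr ⟨S, hS, haS, h1⟩

theorem IsPosition.exists_initial_union (hp : I.IsPosition pos) {S T : Finset A} (hS : #S = d) :
    ∃ F, #F = d ∧ F ⊆ S ∪ T ∧ ∀ u ∈ F, ∀ v ∈ (S ∪ T) \ F, pos u < pos v := by
  obtain ⟨F, h1, h2, h3⟩ := exists_initial pos hp.injective (S ∪ T) d
    (hS ▸ card_le_card subset_union_left)
  exact ⟨F, h2, h1, h3⟩

/-- Mutually comparable sets of a stable matching are separated. -/
theorem IsPosition.separated (hp : I.IsPosition pos) {M : Finset (Finset A)} (hM : I.IsStable M)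
    {S T : Finset A} (hS : S ∈ M) (hT : T ∈ M) (hST : S ≠ T)
    (hc : ∀ u ∈ S, ∀ v ∈ T, ¬ IncompRel I.ge u v) :
    (∀ u ∈ S, ∀ v ∈ T, pos u < pos v) ∨ ∀ u ∈ S, ∀ v ∈ T, pos v < pos u := by
  obtain ⟨F, hF, hFST, hmin⟩ := hp.exists_initial_union (S := S) (T := T) (hM.1.1 S hS)
  have hdis := hM.1.2 S hS T hT hST
  by_cases hFS : F = S
  · subst hFS
    exact .inl fun u hu v hv => hmin u hu v (by simp [hv, disjoint_right.1 hdis hv])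
  by_cases hFT : F = T
  · subst hFT
    exact .inr fun u hu v hv => hmin v hv u (by simp [hu, disjoint_left.1 hdis hu])
  exact absurd ⟨F, hp.isBlocking_initial hM.1 (.inr hS) hT hF hFST hmin hc hFS hFT⟩ hM.2

/-- `F \ S` and `S \ F` have the same size, and each agent of the former precedes each agent of the
latter. This makes the sum of positions the potential that stops exchanges for blocking sets. -/
theorem sum_initial_lt {S U F : Finset A} (hS : #S = d) (hF : #F = d) (hSU : S ⊆ U)
    (hmin : ∀ u ∈ F, ∀ v ∈ U \ F, pos u < pos v) (hne : F ≠ S) :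
    ∑ u ∈ F, pos u < ∑ u ∈ S, pos u := by
  rw [← sum_inter_add_sum_sdiff F S, ← sum_inter_add_sum_sdiff S F, inter_comm S F]
  have hcard : #(F \ S) = #(S \ F) := card_sdiff_comm (hF.trans hS.symm)
  have hpos : 0 < #(S \ F) := by
    rw [card_pos, sdiff_nonempty]
    exact fun h => hne (eq_of_subset_of_card_le h (by omega)).symm
  obtain ⟨v, hv, hvmin⟩ := exists_min_image (S \ F) pos (card_pos.1 hpos)
  have hlt : ∀ u ∈ F \ S, pos u < pos v := fun u hu => hmin u (mem_sdiff.1 hu).1 v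
    (mem_sdiff.2 ⟨hSU (mem_sdiff.1 hv).1, (mem_sdiff.1 hv).2⟩)
  have h1 : ∑ u ∈ F \ S, pos u < ∑ u ∈ F \ S, pos v :=
    sum_lt_sum_of_nonempty (card_pos.1 (by omega)) hlt
  have h2 : ∑ u ∈ S \ F, pos v ≤ ∑ u ∈ S \ F, pos u := sum_le_sum fun u hu => hvmin u hu
  simp only [sum_const, smul_eq_mul] at h1 h2
  rw [hcard] at h1
  omega

/-- For a blocking set with least sum of positions, a disjoint comparable matched set is
separated from it. -/
theorem IsPosition.separated_of_isBlocking (hp : I.IsPosition pos) {M : Finset (Finset A)}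
    (hM : I.IsMatching M) {B T : Finset A} (hB : I.IsBlocking M B)
    (hleast : ∀ B', I.IsBlocking M B' → ∑ u ∈ B, pos u ≤ ∑ u ∈ B', pos u) (hT : T ∈ M)
    (hdis : Disjoint B T) (hc : ∀ u ∈ B, ∀ v ∈ T, ¬ IncompRel I.ge u v) :
    (∀ u ∈ B, ∀ v ∈ T, pos u < pos v) ∨ ∀ u ∈ B, ∀ v ∈ T, pos v < pos u := by
  obtain ⟨F, hF, hFST, hmin⟩ := hp.exists_initial_union (S := B) (T := T) hB.1
  by_cases hFS : F = B
  · subst hFS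
    exact .inl fun u hu v hv => hmin u hu v (by simp [hv, disjoint_right.1 hdis hv])
  by_cases hFT : F = T
  · subst hFT
    exact .inr fun u hu v hv => hmin v hv u (by simp [hu, disjoint_left.1 hdis hu])
  have h1 := hleast F (hp.isBlocking_initial hM (.inl hB) hT hF hFST hmin hc hFS hFT)
  have h2 := sum_initial_lt hB.1 hF subset_union_left hmin hFS
  omega

/-- For a blocking set with least sum of positions, unmatched agents outside it are not better than
any of its members. -/
theorem IsPosition.not_gt_of_unmatched (hp : I.IsPosition pos) {M : Finset (Finset A)}
    {B : Finset A} (hB : I.IsBlocking M B)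
    (hleast : ∀ B', I.IsBlocking M B' → ∑ u ∈ B, pos u ≤ ∑ u ∈ B', pos u) {u v : A}
    (hu : ∀ t ∈ M, u ∉ t) (huB : u ∉ B) (hv : v ∈ B) : ¬ I.gt u v := by
  intro hgt
  have huv : u ∉ B.erase v := fun h => huB (mem_of_mem_erase h)
  have hBd := hB.1
  have hlt := hp.lt_of_gt _ _ hgt
  have hcard : #(insert u (B.erase v)) = d := by
    rw [card_insert_of_notMem huv, card_erase_add_one hv, hBd]
  have hsum : ∑ w ∈ insert u (B.erase v), pos w < ∑ w ∈ B, pos w := by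
    rw [sum_insert huv, ← add_sum_erase B pos hv]
    omega
  -- Replacing `v` by the better unmatched agent `u` keeps the set blocking: `u` agrees because it
  -- is unmatched, the others because their partners improve. But the sum of positions drops.
  refine absurd (hleast (insert u (B.erase v)) ⟨hcard, fun a ha => ?_⟩) (by omega)
  rcases mem_insert.1 ha with rfl | ha'
  · exact .inl hu
  · have haB := mem_of_mem_erase ha'
    have h1 : I.Prefers a ((insert u (B.erase v)).erase a) (B.erase a) := by
      refine I.prefers_of_sdiff hcard hBd (fun h => huB (h ▸ mem_insert_self _ _)) ?_ ha haB
      intro x hx y hy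
      simp only [mem_sdiff, mem_insert, mem_erase, not_or, not_and_or, not_not] at hx hy
      have hxu : x = u := by tauto
      have hyv : y = v := by tauto
      rwa [hxu, hyv]
    rcases hB.2 a haB with h | ⟨t, ht, hat, h⟩
    · exact .inl h
    · exact .inr ⟨t, ht, hat, h1.trans h⟩

/-! ### Counting -/

/-- Bound for the number of agents in sets of `M` that meet some `J s`. -/
theorem card_biUnion_le {M : Finset (Finset A)} (hM : I.IsMatching M) (S : Finset A)
    (J : A → Finset A) (k : ℕ) (hJ : ∀ s ∈ S, #(J s) ≤ k) :
    #(S.biUnion fun s => (J s).biUnion fun w => {T ∈ M | w ∈ T}.biUnion id) ≤ #S * (k * d) := by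
  refine card_biUnion_le_card_mul _ _ _ fun s hs => ?_
  -- Each agent `w` lies in at most one set of `M`, so it contributes at most `d` agents.
  refine (card_biUnion_le_card_mul _ _ d fun w _ => ?_).trans (Nat.mul_le_mul_right _ (hJ s hs))
  by_cases h : ∃ T ∈ M, w ∈ T
  · obtain ⟨T, hT, hw⟩ := h
    refine le_trans (card_le_card fun z hz => ?_) (hM.1 T hT).le
    simp only [mem_biUnion, mem_filter, id] at hz
    obtain ⟨T', ⟨hT', hw'⟩, hz⟩ := hz
    rwa [hM.eq_of_mem hT hT' hw hw']
  · have : {T ∈ M | w ∈ T} = ∅ := by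
      ext T; simp only [mem_filter]; simp; exact fun h1 h2 => h ⟨T, h1, h2⟩
    rw [this]; simp

section Counting

variable [Fintype A]

open Classical in
/-- Agents incomparable to `v`. -/
noncomputable def incomp (I : Instance A d) (v : A) : Finset A := {w | IncompRel I.ge v w}

theorem mem_incomp {v w : A} : w ∈ I.incomp v ↔ IncompRel I.ge v w := by simp [incomp]

theorem card_incomp_le (v : A) : #(I.incomp v) ≤ I.kappa := by
  classical
  refine le_trans (le_of_eq ?_) (Finset.le_sup (mem_univ v))
  rw [incomp, ← Set.ncard_coe_finset]
  simp

-- Any `d` unmatched agents would form a blocking set.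
open Classical in
theorem IsStable.card_unmatched_lt {M : Finset (Finset A)} (hM : I.IsStable M) :
    #({u | ∀ t ∈ M, u ∉ t} : Finset A) < d := by
  by_contra h
  obtain ⟨B, hB, hBd⟩ := exists_subset_card_eq (not_lt.1 h)
  exact hM.2 ⟨B, hBd, fun a ha => .inl (by simpa using hB ha)⟩

/-- The number of agents between two members of a set in a stable matching. -/
theorem IsPosition.card_between_le (hp : I.IsPosition pos) {M : Finset (Finset A)}
    (hM : I.IsStable M) {T : Finset A} (hT : T ∈ M) {u v : A} (hu : u ∈ T) (hv : v ∈ T) :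
    #({z | pos u ≤ pos z ∧ pos z ≤ pos v} : Finset A) ≤ I.kappa * d ^ 2 + 2 * d := by
  classical
  have hTd := hM.1.1 T hT
  -- A matched set with a member between `u` and `v` is not separated from `T`, so some member of it
  -- is incomparable to some member of `T`.
  have hsub : ({z | pos u ≤ pos z ∧ pos z ≤ pos v} : Finset A) ⊆
      T ∪ (({u | ∀ t ∈ M, u ∉ t} : Finset A) ∪
        T.biUnion fun s => (I.incomp s).biUnion fun w => {T ∈ M | w ∈ T}.biUnion id) := by
    intro z hz
    simp only [mem_filter, mem_univ, true_and] at hz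
    by_cases hzT : z ∈ T
    · exact mem_union_left _ hzT
    refine mem_union_right _ ?_
    by_cases hzu : ∀ t ∈ M, z ∉ t
    · exact mem_union_left _ (by simpa using hzu)
    refine mem_union_right _ ?_
    push Not at hzu
    obtain ⟨S, hS, hzS⟩ := hzu
    have hTS : T ≠ S := by rintro rfl; exact hzT hzS
    have hex : ∃ s ∈ T, ∃ w ∈ S, IncompRel I.ge s w := by
      by_contra hcon
      push Not at hcon
      rcases hp.separated hM hT hS hTS hcon with h | h
      · have := h v hv z hzS; omega
      · have := h u hu z hzS; omega
    obtain ⟨s, hs, w, hw, hsw⟩ := hex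
    simp only [mem_biUnion, mem_filter, id]
    exact ⟨s, hs, w, mem_incomp.2 hsw, S, ⟨hS, hw⟩, hzS⟩
  have h1 := card_biUnion_le hM.1 T I.incomp I.kappa fun s _ => card_incomp_le s
  have h2 := hM.card_unmatched_lt
  have h3 := card_le_card hsub
  have h4 := card_union_le T (({u | ∀ t ∈ M, u ∉ t} : Finset A) ∪
        T.biUnion fun s => (I.incomp s).biUnion fun w => {T ∈ M | w ∈ T}.biUnion id)
  have h5 := card_union_le ({u | ∀ t ∈ M, u ∉ t} : Finset A)
        (T.biUnion fun s => (I.incomp s).biUnion fun w => {T ∈ M | w ∈ T}.biUnion id)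
  have h6 : #T * (I.kappa * d) = I.kappa * d ^ 2 := by rw [hTd]; ring
  omega

/-- The number of agents between two members of a blocking set with least sum of positions. -/
theorem IsPosition.card_between_le_of_isBlocking (hp : I.IsPosition pos) {M : Finset (Finset A)}
    (hM : I.IsMatching M) {B : Finset A} (hB : I.IsBlocking M B)
    (hleast : ∀ B', I.IsBlocking M B' → ∑ u ∈ B, pos u ≤ ∑ u ∈ B', pos u) {u v : A}
    (hu : u ∈ B) (hv : v ∈ B) :
    #({z | pos u ≤ pos z ∧ pos z ≤ pos v} : Finset A) ≤ d + I.kappa + (I.kappa + 1) * d ^ 2 := by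
  classical
  have hBd := hB.1
  -- As `M` need not be stable, the unmatched agents cannot be bounded by `d`. Instead, an unmatched
  -- agent outside `B` positioned before `v` is not better than `v`, hence incomparable to `v`.
  -- Matched sets may also meet `B` itself; inserting `s` accounts for them and turns `κ` into `κ +
  -- 1`.
  have hsub : ({z | pos u ≤ pos z ∧ pos z ≤ pos v} : Finset A) ⊆
      B ∪ (I.incomp v ∪ B.biUnion fun s => (insert s (I.incomp s)).biUnion fun w =>
        {T ∈ M | w ∈ T}.biUnion id) := by
    intro z hz
    simp only [mem_filter, mem_univ, true_and] at hz
    by_cases hzB : z ∈ B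
    · exact mem_union_left _ hzB
    refine mem_union_right _ ?_
    by_cases hzu : ∀ t ∈ M, z ∉ t
    · refine mem_union_left _ (mem_incomp.2 ?_)
      by_contra hcon
      refine hp.not_gt_of_unmatched hB hleast hzu hzB hv (hp.gt_of_lt ?_ fun h => hcon h.symm)
      have : pos z ≠ pos v := fun e => hzB (hp.injective e ▸ hv)
      omega
    refine mem_union_right _ ?_
    push Not at hzu
    obtain ⟨S, hS, hzS⟩ := hzu
    have hex : ∃ s ∈ B, ∃ w ∈ S, w = s ∨ IncompRel I.ge s w := by
      by_contra hcon
      push Not at hcon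
      rcases hp.separated_of_isBlocking hM hB hleast hS
        (disjoint_left.2 fun s hs hs' => (hcon s hs s hs').1 rfl)
        (fun s hs w hw => (hcon s hs w hw).2) with h | h
      · have := h v hv z hzS; omega
      · have := h u hu z hzS; omega
    obtain ⟨s, hs, w, hw, hsw⟩ := hex
    simp only [mem_biUnion, mem_filter, id]
    exact ⟨s, hs, w, mem_insert.2 (hsw.imp id mem_incomp.2), S, ⟨hS, hw⟩, hzS⟩
  have h1 := card_biUnion_le hM B (fun s => insert s (I.incomp s)) (I.kappa + 1) fun s _ =>
    (card_insert_le _ _).trans (Nat.succ_le_succ (card_incomp_le s))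
  have h2 := card_incomp_le (I := I) v
  have h3 := card_le_card hsub
  have h4 := card_union_le B (I.incomp v ∪ B.biUnion fun s =>
    (insert s (I.incomp s)).biUnion fun w => {T ∈ M | w ∈ T}.biUnion id)
  have h5 := card_union_le (I.incomp v) (B.biUnion fun s =>
    (insert s (I.incomp s)).biUnion fun w => {T ∈ M | w ∈ T}.biUnion id)
  have h6 : #B * ((I.kappa + 1) * d) = (I.kappa + 1) * d ^ 2 := by rw [hBd]; ring
  omega

end Counting

end Instance

namespace Instance

variable {n d : ℕ} {I : Instance (Fin n) d}

/-! ### Orders of the agents -/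

/-- The position of an agent in an order. -/
def posOf (σ : Equiv.Perm (Fin n)) (v : Fin n) : ℕ := σ.symm v

theorem posOf_lt (σ : Equiv.Perm (Fin n)) (v : Fin n) : posOf σ v < n := (σ.symm v).2

theorem posOf_injective (σ : Equiv.Perm (Fin n)) : (posOf σ).Injective :=
  Fin.val_injective.comp σ.symm.injective

@[simp] theorem posOf_apply (σ : Equiv.Perm (Fin n)) (i : Fin n) : posOf σ (σ i) = i := by
  simp [posOf]

theorem card_between (σ : Equiv.Perm (Fin n)) (u v : Fin n) :
    #({z | posOf σ u ≤ posOf σ z ∧ posOf σ z ≤ posOf σ v} : Finset (Fin n)) =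
      posOf σ v + 1 - posOf σ u := by
  have : ({z | posOf σ u ≤ posOf σ z ∧ posOf σ z ≤ posOf σ v} : Finset (Fin n)) =
      (Finset.Icc (σ.symm u) (σ.symm v)).map σ.toEmbedding := by
    ext z
    simp only [mem_filter, mem_univ, true_and, mem_map, mem_Icc, Equiv.coe_toEmbedding]
    constructor
    · exact fun h => ⟨σ.symm z, h, by simp⟩
    · rintro ⟨a, ha, rfl⟩
      simp only [posOf, Equiv.symm_apply_apply]
      exact ha
  rw [this, card_map, Fin.card_Icc]
  rfl

/-- By antisymmetry, a better agent cannot come later. Hence the span bounds, proved for position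
functions, apply to every approximating order and not only to the sorted one. -/
theorem Approximates.isPosition {σ : Equiv.Perm (Fin n)} (h : I.Approximates σ) :
    I.IsPosition (posOf σ) := by
  refine ⟨posOf_injective σ, fun u v huv => ?_⟩
  by_contra hlt
  have hne : σ.symm v ≠ σ.symm u := fun e => huv.2 (σ.symm.injective e).symm
  have hlt' : σ.symm v < σ.symm u := lt_of_le_of_ne (not_lt.1 hlt) hne
  have := h.1 _ _ hlt'
  simp only [Equiv.apply_symm_apply] at this
  rcases this with h' | h'
  · exact huv.2 (I.ge_partialOrder.toAntisymm.antisymm _ _ huv.1 h'.1)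
  · exact h'.2 huv.1

/-- If the agents at positions `i < j` are incomparable, then by transitivity every agent strictly
between them is incomparable to one of the two. So the `j - i` agents after `i` up to `j` lie in a
union of two sets of at most `κ` agents each. -/
theorem IsPosition.approximates {σ : Equiv.Perm (Fin n)} (h : I.IsPosition (posOf σ)) :
    I.Approximates σ := by
  have hcmp : ∀ i j : Fin n, i < j → I.gt (σ i) (σ j) ∨ IncompRel I.ge (σ i) (σ j) := by
    intro i j hij
    by_cases hc : IncompRel I.ge (σ i) (σ j)
    · exact .inr hc
    · exact .inl (h.gt_of_lt (by simpa using hij) hc)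
  refine ⟨hcmp, fun i j hij => (hcmp i j (by rw [Fin.lt_def]; omega)).resolve_right fun hinc => ?_⟩
  have hsub : (Finset.Ioc i j).map σ.toEmbedding ⊆ I.incomp (σ i) ∪ I.incomp (σ j) := by
    intro z hz
    simp only [mem_map, mem_Ioc, Equiv.coe_toEmbedding] at hz
    obtain ⟨l, ⟨hl1, hl2⟩, rfl⟩ := hz
    rcases hl2.eq_or_lt with rfl | hl2
    · exact mem_union_left _ (mem_incomp.2 hinc)
    rcases hcmp i l hl1 with h1 | h1
    · rcases hcmp l j hl2 with h2 | h2
      · exact absurd (I.ge_partialOrder.toIsPreorder.toIsTrans.trans _ _ _ h1.1 h2.1) hinc.1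
      · exact mem_union_right _ (mem_incomp.2 h2.symm)
    · exact mem_union_left _ (mem_incomp.2 h1)
  have h1 := card_le_card hsub
  have h2 := card_union_le (I.incomp (σ i)) (I.incomp (σ j))
  have h3 := card_incomp_le (I := I) (σ i)
  have h4 := card_incomp_le (I := I) (σ j)
  rw [card_map, Fin.card_Ioc] at h1
  omega

open Classical in
/-- The number of agents at least as good as `v`. -/
noncomputable def key (I : Instance (Fin n) d) (v : Fin n) : ℕ := #{w | I.ge w v}

/-- The number of agents before `v` when agents are sorted by their keys. -/
noncomputable def rank (I : Instance (Fin n) d) (v : Fin n) : ℕ :=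
  #{w | I.key w < I.key v ∨ I.key w = I.key v ∧ w < v}

theorem key_lt {u v : Fin n} (h : I.gt u v) : I.key u < I.key v := by
  classical
  refine card_lt_card ⟨fun w hw => ?_, fun hsub => ?_⟩
  · simp only [mem_filter, mem_univ, true_and] at *
    exact I.ge_partialOrder.toIsPreorder.toIsTrans.trans _ _ _ hw h.1
  · have : v ∈ ({w | I.ge w u} : Finset (Fin n)) :=
      hsub (by simpa using I.ge_partialOrder.toIsPreorder.toRefl.refl v)
    exact h.2 (I.ge_partialOrder.toAntisymm.antisymm _ _ h.1 (by simpa using this))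

theorem rank_lt {u v : Fin n} (h : I.key u < I.key v ∨ I.key u = I.key v ∧ u < v) :
    I.rank u < I.rank v := by
  refine card_lt_card ⟨fun w hw => ?_, fun hsub => ?_⟩
  · simp only [mem_filter, mem_univ, true_and] at *
    rcases h with h | ⟨h, h'⟩ <;> rcases hw with hw | ⟨hw, hw'⟩
    · exact .inl (by omega)
    · exact .inl (by omega)
    · exact .inl (by omega)
    · exact .inr ⟨by omega, by omega⟩
  · have : u ∈ ({w | I.key w < I.key u ∨ I.key w = I.key u ∧ w < u} : Finset (Fin n)) :=
      hsub (by simpa using h)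
    simp at this

theorem rank_injective : Function.Injective I.rank := by
  intro u v huv
  by_contra hne
  rcases lt_trichotomy (I.key u) (I.key v) with h | h | h
  · have := rank_lt (.inl h); omega
  · rcases lt_or_gt_of_ne hne with h' | h'
    · have := rank_lt (.inr ⟨h, h'⟩); omega
    · have := rank_lt (.inr ⟨h.symm, h'⟩); omega
  · have := rank_lt (.inl h); omega

theorem rank_lt_card (v : Fin n) : I.rank v < n := by
  refine (card_lt_card (t := univ) ⟨subset_univ _, fun h => ?_⟩).trans_eq (by simp)
  have := h (mem_univ v)
  simp at this

/-- The agents sorted by their keys. -/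
noncomputable def sorted (I : Instance (Fin n) d) : Equiv.Perm (Fin n) :=
  (Equiv.ofBijective (fun v => (⟨I.rank v, rank_lt_card v⟩ : Fin n))
    (Finite.injective_iff_bijective.1 fun _ _ h => rank_injective (Fin.mk.inj h))).symm

theorem posOf_sorted (v : Fin n) : posOf I.sorted v = I.rank v := rfl

theorem isPosition_sorted : I.IsPosition (posOf I.sorted) :=
  ⟨posOf_injective _, fun _ _ h => rank_lt (.inl (key_lt h))⟩

/-- The span bound `κ d ^ 2 + 2 d` counts all positions between two members, whether consecutive or
not, and is already below the claimed gap. -/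
theorem gapsAtMost {σ : Equiv.Perm (Fin n)} (hσ : I.Approximates σ)
    {M : Finset (Finset (Fin n))} (hM : I.IsStable M) :
    GapsAtMost σ M (2 * I.kappa * d ^ 2 + 4 * I.kappa + 3 * d + 1) := by
  intro t ht i j hij hi hj _
  have h1 := hσ.isPosition.card_between_le hM ht hi hj
  rw [card_between, posOf_apply, posOf_apply] at h1
  have : 2 * I.kappa * d ^ 2 = I.kappa * d ^ 2 + I.kappa * d ^ 2 := by ring
  omega

/-! ### Instances that always have a stable matching -/

theorem exists_isStable_of_lt (h : n < d) : ∃ M, I.IsStable M := by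
  refine ⟨∅, ⟨by simp, by simp⟩, ?_⟩
  rintro ⟨B, hB, -⟩
  have := card_le_univ B
  simp at this
  omega

theorem exists_isStable_of_one (h : d = 1) : ∃ M, I.IsStable M := by
  subst h
  refine ⟨univ.image singleton, ⟨by simp, ?_⟩, ?_⟩
  · simp only [mem_image, mem_univ, true_and]
    rintro _ ⟨a, rfl⟩ _ ⟨b, rfl⟩ h
    simpa using h
  · rintro ⟨B, hB, h⟩
    obtain ⟨a, rfl⟩ := card_eq_one.1 hB
    rcases h a (by simp) with h | ⟨t, ht, hat, h⟩
    · exact h {a} (by simp) (by simp)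
    · simp only [mem_image, mem_univ, true_and] at ht
      obtain ⟨b, rfl⟩ := ht
      obtain rfl : a = b := by simpa using hat
      exact h.irrefl

/-- With `κ = 0` the poset is a total order, and cutting it into consecutive blocks of `d` agents is
stable. The first member `b` of a blocking set `B` has a full block `T`, since fewer than `d` agents
follow the last full block. The members of `B` outside `T` lie in later blocks, so `b` prefers `T`
to `B` unless they are equal. -/
theorem exists_isStable_of_kappa (hd : 1 ≤ d) (h : I.kappa = 0) : ∃ M, I.IsStable M := by
  classical
  have hp := isPosition_sorted (I := I)
  set pos := posOf I.sorted with hpos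
  have hgt : ∀ u v, pos u < pos v → I.gt u v := fun u v huv => hp.gt_of_lt huv fun hinc => by
    have h1 := card_incomp_le (I := I) u
    rw [h, Nat.le_zero, card_eq_zero] at h1
    have h2 := mem_incomp.2 hinc
    rw [h1] at h2
    simp at h2
  have hposlt : ∀ v, pos v < n := posOf_lt _
  have hsurj : ∀ q < n, ∃ v, pos v = q := fun q hq => ⟨I.sorted ⟨q, hq⟩, by simp [hpos]⟩
  let blk : ℕ → Finset (Fin n) := fun k => {v | pos v / d = k}
  have mem_blk : ∀ k v, v ∈ blk k ↔ pos v / d = k := fun k v => by simp [blk]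
  have card_blk : ∀ k, (k + 1) * d ≤ n → #(blk k) = d := by
    intro k hk
    have : (blk k).image pos = Finset.Ico (k * d) ((k + 1) * d) := by
      ext q
      simp only [mem_image, mem_blk, mem_Ico]
      constructor
      · rintro ⟨v, hv, rfl⟩
        rw [Nat.div_eq_iff hd] at hv
        rw [Nat.succ_mul]
        omega
      · rintro ⟨h1, h2⟩
        obtain ⟨v, rfl⟩ := hsurj q (by omega)
        refine ⟨v, ?_, rfl⟩
        rw [Nat.div_eq_iff hd]
        rw [Nat.succ_mul] at h2
        omega
    rw [← card_image_of_injective _ hp.injective, this, Nat.card_Ico, Nat.succ_mul]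
    omega
  have hk : ∀ k, k < n / d → (k + 1) * d ≤ n := fun k hk => (Nat.le_div_iff_mul_le hd).1 hk
  refine ⟨(range (n / d)).image blk, ⟨?_, ?_⟩, ?_⟩
  · simp only [mem_image, mem_range]
    rintro _ ⟨k, hk', rfl⟩
    exact card_blk k (hk k hk')
  · simp only [mem_image, mem_range]
    rintro _ ⟨k, -, rfl⟩ _ ⟨l, -, rfl⟩ hne
    refine disjoint_left.2 fun v h1 h2 => hne ?_
    rw [mem_blk] at h1 h2
    rw [← h1, ← h2]
  · rintro ⟨B, hBd, hB⟩
    obtain ⟨b, hb, hmin⟩ := exists_min_image B pos (card_pos.1 (by omega))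
    by_cases hbk : pos b / d < n / d
    · set T := blk (pos b / d) with hT
      have hTM : T ∈ (range (n / d)).image blk := mem_image_of_mem _ (mem_range.2 hbk)
      have hbT : b ∈ T := (mem_blk _ _).2 rfl
      rcases hB b hb with h | ⟨t, ht, hbt, h⟩
      · exact h T hTM hbT
      · simp only [mem_image, mem_range] at ht
        obtain ⟨l, -, rfl⟩ := ht
        obtain rfl : pos b / d = l := (mem_blk _ _).1 hbt
        by_cases hBT : T = B
        · exact Prefers.irrefl (hBT ▸ h)
        · refine Prefers.irrefl (h.trans (I.prefers_of_sdiff (card_blk _ (hk _ hbk)) hBd hBT ?_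
            hbT hb))
          intro u hu v hv
          rw [mem_sdiff, mem_blk] at hu hv
          apply hgt
          have h1 := Nat.div_le_div_right (c := d) (hmin v hv.1)
          by_contra hlt
          have h2 := Nat.div_le_div_right (c := d) (not_lt.1 hlt)
          omega
    · have h1 : B.image pos ⊆ Finset.Ico (n / d * d) n := by
        intro q hq
        obtain ⟨v, hv, rfl⟩ := mem_image.1 hq
        rw [mem_Ico]
        refine ⟨?_, hposlt v⟩
        calc n / d * d ≤ pos b / d * d := Nat.mul_le_mul_right _ (by omega)
          _ ≤ pos b := Nat.div_mul_le_self _ _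
          _ ≤ pos v := hmin v hv
      have h2 := card_le_card h1
      rw [card_image_of_injective _ hp.injective, hBd, Nat.card_Ico] at h2
      have h3 := Nat.div_add_mod n d
      have h4 := Nat.mod_lt n hd
      rw [mul_comm] at h3
      omega

/-! ### Matchings given by words -/

/-- The agents whose position minus the letter at that position is the same as for `u`. -/
def wordClass (σ : Equiv.Perm (Fin n)) (x : ℕ → ℕ) (u : Fin n) : Finset (Fin n) :=
  {v | posOf σ v + x (posOf σ u) = posOf σ u + x (posOf σ v)}

/-- The matching whose sets are the classes of size `d` of the word `x`. -/
def wordMatching (σ : Equiv.Perm (Fin n)) (d : ℕ) (x : ℕ → ℕ) : Finset (Finset (Fin n)) :=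
  {T ∈ univ.image (wordClass σ x) | #T = d}

variable {σ : Equiv.Perm (Fin n)} {x : ℕ → ℕ}

theorem mem_wordClass {u v : Fin n} :
    v ∈ wordClass σ x u ↔ posOf σ v + x (posOf σ u) = posOf σ u + x (posOf σ v) := by
  simp [wordClass]

theorem mem_wordClass_self (u : Fin n) : u ∈ wordClass σ x u := mem_wordClass.2 rfl

theorem wordClass_eq {u v : Fin n} (h : v ∈ wordClass σ x u) :
    wordClass σ x v = wordClass σ x u := by
  ext w
  rw [mem_wordClass] at *
  rw [mem_wordClass]
  omega

theorem isMatching_wordMatching (I : Instance (Fin n) d) :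
    I.IsMatching (wordMatching σ d x) := by
  refine ⟨fun t ht => (mem_filter.1 ht).2,
    fun s hs t ht hst => disjoint_left.2 fun v h1 h2 => hst ?_⟩
  simp only [wordMatching, mem_filter, mem_image, mem_univ, true_and] at hs ht
  obtain ⟨⟨a, rfl⟩, -⟩ := hs
  obtain ⟨⟨b, rfl⟩, -⟩ := ht
  rw [← wordClass_eq h1, ← wordClass_eq h2]

/-- The only set of the word matching that can contain `a` is its class, and it is present exactly
if it has `d` members; all other agents count as unmatched. -/
theorem isBlocking_wordMatching {B : Finset (Fin n)} :
    I.IsBlocking (wordMatching σ d x) B ↔ #B = d ∧ ∀ a ∈ B, #(wordClass σ x a) ≠ d ∨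
      I.Prefers a (B.erase a) ((wordClass σ x a).erase a) := by
  have hmem : ∀ a t, t ∈ wordMatching σ d x ∧ a ∈ t ↔ t = wordClass σ x a ∧
      #(wordClass σ x a) = d := by
    intro a t
    simp only [wordMatching, mem_filter, mem_image, mem_univ, true_and]
    constructor
    · rintro ⟨⟨⟨b, rfl⟩, hd⟩, ha⟩
      rw [wordClass_eq ha]
      exact ⟨rfl, hd⟩
    · rintro ⟨rfl, hd⟩
      exact ⟨⟨⟨a, rfl⟩, hd⟩, mem_wordClass_self a⟩
  refine and_congr_right fun _ => forall₂_congr fun a _ => ?_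
  constructor
  · rintro (h | ⟨t, ht, hat, h⟩)
    · exact .inl fun hd => have := (hmem a _).2 ⟨rfl, hd⟩; h _ this.1 this.2
    · obtain ⟨rfl, -⟩ := (hmem a t).1 ⟨ht, hat⟩
      exact .inr h
  · intro h
    by_cases hd : #(wordClass σ x a) = d
    · have := (hmem a _).2 ⟨rfl, hd⟩
      exact .inr ⟨_, this.1, this.2, h.resolve_left (not_not.2 hd)⟩
    · exact .inl fun t ht hat => hd ((hmem a t).1 ⟨ht, hat⟩).2

/-- Every matching whose sets span few positions is given by a word with small letters. -/
theorem exists_wordMatching_eq (σ : Equiv.Perm (Fin n)) (hd : 2 ≤ d) {M : Finset (Finset (Fin n))}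
    (hM : I.IsMatching M) {Y : ℕ}
    (hY : ∀ T ∈ M, ∀ u ∈ T, ∀ v ∈ T, posOf σ v ≤ posOf σ u + Y) :
    ∃ x : ℕ → ℕ, (∀ q, x q ≤ Y) ∧ wordMatching σ d x = M := by
  classical
  -- The leader `l` of a matched agent is the first member of its set; an unmatched agent is its own
  -- leader. The letter at a position will be the distance to the leader, so that classes are the
  -- sets of agents with a common leader.
  have hl : ∀ u, ∃ l, (∀ T ∈ M, u ∈ T → l ∈ T ∧ ∀ v ∈ T, posOf σ l ≤ posOf σ v) ∧
      ((∀ T ∈ M, u ∉ T) → l = u) := by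
    intro u
    by_cases hu : ∃ T ∈ M, u ∈ T
    · obtain ⟨T, hT, huT⟩ := hu
      obtain ⟨l, h1, h2⟩ := exists_min_image T (posOf σ) ⟨u, huT⟩
      refine ⟨l, fun S hS huS => ?_, fun h => absurd huT (h T hT)⟩
      rw [hM.eq_of_mem hS hT huS huT]
      exact ⟨h1, h2⟩
    · exact ⟨u, fun T hT huT => absurd ⟨T, hT, huT⟩ hu, fun _ => rfl⟩
  choose l hl hl' using hl
  have hle : ∀ u, posOf σ (l u) ≤ posOf σ u ∧ posOf σ u ≤ posOf σ (l u) + Y := by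
    intro u
    by_cases hu : ∃ T ∈ M, u ∈ T
    · obtain ⟨T, hT, huT⟩ := hu
      have := hl u T hT huT
      exact ⟨this.2 u huT, hY T hT _ this.1 _ huT⟩
    · rw [hl' u fun T hT huT => hu ⟨T, hT, huT⟩]
      omega
  let x : ℕ → ℕ := fun q => if h : q < n then q - posOf σ (l (σ ⟨q, h⟩)) else 0
  have hx : ∀ u, x (posOf σ u) = posOf σ u - posOf σ (l u) := by
    intro u
    simp only [x, dif_pos (posOf_lt σ u)]
    congr 4
    simp [posOf]
  have hcls : ∀ u v, v ∈ wordClass σ x u ↔ l v = l u := by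
    intro u v
    rw [mem_wordClass, hx, hx, ← (posOf_injective σ).eq_iff]
    have h1 := hle u
    have h2 := hle v
    omega
  have hT : ∀ T ∈ M, ∀ u ∈ T, wordClass σ x u = T := by
    intro T hT u hu
    ext v
    rw [hcls]
    constructor
    · intro h
      have hlT := (hl u T hT hu).1
      rw [← h] at hlT
      by_cases hv : ∃ S ∈ M, v ∈ S
      · obtain ⟨S, hS, hvS⟩ := hv
        rwa [hM.eq_of_mem hT hS hlT (hl v S hS hvS).1]
      · rwa [hl' v fun S hS hvS => hv ⟨S, hS, hvS⟩] at hlT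
    · intro hv
      apply posOf_injective σ
      exact le_antisymm ((hl v T hT hv).2 _ (hl u T hT hu).1) ((hl u T hT hu).2 _ (hl v T hT hv).1)
  refine ⟨x, fun q => ?_, ?_⟩
  · by_cases hq : q < n
    · have h1 := hx (σ ⟨q, hq⟩)
      have h2 := hle (σ ⟨q, hq⟩)
      rw [posOf_apply] at h1 h2
      simp only at h1 h2
      omega
    · simp [x, hq]
  · ext T
    simp only [wordMatching, mem_filter, mem_image, mem_univ, true_and]
    constructor
    · rintro ⟨⟨u, rfl⟩, hc⟩
      by_cases hu : ∃ S ∈ M, u ∈ S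
      · obtain ⟨S, hS, huS⟩ := hu
        rwa [hT S hS u huS]
      · exfalso
        have hu' : ∀ S ∈ M, u ∉ S := fun S hS huS => hu ⟨S, hS, huS⟩
        -- The class of an unmatched agent is a singleton and is not taken for a set of the matching
        -- because `2 ≤ d`.
        have : wordClass σ x u ⊆ {u} := by
          intro v hv
          rw [hcls, hl' u hu'] at hv
          rw [mem_singleton]
          by_cases hv' : ∃ S ∈ M, v ∈ S
          · obtain ⟨S, hS, hvS⟩ := hv'
            have := (hl v S hS hvS).1
            rw [hv] at this
            exact absurd this (hu' S hS)
          · rw [← hv, hl' v fun S hS hvS => hv' ⟨S, hS, hvS⟩]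
        have := card_le_card this
        rw [card_singleton] at this
        omega
    · intro hTM
      obtain ⟨u, hu⟩ := card_pos.1 (show 0 < #T by rw [hM.1 T hTM]; omega)
      exact ⟨⟨u, hT T hTM u hu⟩, hM.1 T hTM⟩

/-! ### Windows -/

section Window

variable (I) (ag : ℕ → ℕ) (p L Y : ℕ) (y : ℕ → ℕ)

/-- The class of the local index `i` in the window of length `L` from position `p` on. -/
def localClass (n p L : ℕ) (y : ℕ → ℕ) (i : ℕ) : Finset ℕ :=
  {j ∈ range L | p + j < n ∧ j + y i = i + y j}

/-- The set `B` of local indices is found to be blocking in the window from position `p` on. -/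
def LocalBlocking (B : Finset ℕ) : Prop :=
  #B = d ∧ ∀ i ∈ B, p + i < n ∧ (p = 0 ∨ y i ≤ i) ∧ i + Y < L ∧
    (#(localClass n p L y i) ≠ d ∨
      I.prefAnswer (ag (p + i)) ((B.erase i).image fun j => ag (p + j))
        (((localClass n p L y i).erase i).image fun j => ag (p + j)) ≠ 0)

/-- No blocking set is found in the window from position `p` on. -/
def WindowOK : Prop := ∀ B ⊆ range L, ¬ I.LocalBlocking ag p L Y y B

end Window

theorem prefAnswer_ne_zero {v : Fin n} {s t : Finset (Fin n)} :
    I.prefAnswer v (s.image Fin.val) (t.image Fin.val) ≠ 0 ↔ I.Prefers v s t := by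
  have hinj := Finset.image_injective (f := (Fin.val : Fin n → ℕ)) Fin.val_injective
  rw [prefAnswer]
  split_ifs with h
  · refine iff_of_true one_ne_zero ?_
    obtain ⟨v', s', t', h1, h2, h3, h4⟩ := h
    obtain rfl := Fin.val_injective h1
    obtain rfl := hinj h2
    obtain rfl := hinj h3
    exact h4
  · exact iff_of_false (by simp) fun hpref => h ⟨v, s, t, rfl, rfl, rfl, hpref⟩

/-- The agents at the local indices in `P`. -/
def agentsAt (σ : Equiv.Perm (Fin n)) (p : ℕ) (P : Finset ℕ) : Finset (Fin n) :=
  {v | ∃ j ∈ P, posOf σ v = p + j}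

theorem mem_agentsAt {p : ℕ} {P : Finset ℕ} {v : Fin n} :
    v ∈ agentsAt σ p P ↔ ∃ j ∈ P, posOf σ v = p + j := by simp [agentsAt]

theorem image_agentsAt {ag : ℕ → ℕ} (hag : ∀ i : Fin n, ag i = σ i) {p : ℕ} {P : Finset ℕ}
    (hP : ∀ j ∈ P, p + j < n) :
    (agentsAt σ p P).image Fin.val = P.image fun j => ag (p + j) := by
  ext z
  simp only [mem_image, mem_agentsAt]
  constructor
  · rintro ⟨v, ⟨j, hj, hv⟩, rfl⟩
    refine ⟨j, hj, ?_⟩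
    rw [← hv]
    exact (hag (σ.symm v)).trans (by simp)
  · rintro ⟨j, hj, rfl⟩
    exact ⟨σ ⟨p + j, hP j hj⟩, ⟨j, hj, by simp⟩, (hag ⟨p + j, hP j hj⟩).symm⟩

theorem card_agentsAt {p : ℕ} {P : Finset ℕ} (hP : ∀ j ∈ P, p + j < n) :
    #(agentsAt σ p P) = #P := by
  rw [← card_image_of_injective _ (posOf_injective σ),
    ← card_image_of_injective P (add_right_injective p)]
  congr 1
  ext z
  simp only [mem_image, mem_agentsAt]
  constructor
  · rintro ⟨v, ⟨j, hj, hv⟩, rfl⟩; exact ⟨j, hj, hv.symm⟩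
  · rintro ⟨j, hj, rfl⟩
    exact ⟨σ ⟨p + j, hP j hj⟩, ⟨j, hj, by simp⟩, by simp⟩

theorem agentsAt_erase {p i : ℕ} {P : Finset ℕ} {v : Fin n} (hv : posOf σ v = p + i) :
    agentsAt σ p (P.erase i) = (agentsAt σ p P).erase v := by
  ext u
  simp only [mem_erase, mem_agentsAt]
  constructor
  · rintro ⟨j, ⟨hji, hj⟩, hu⟩
    refine ⟨?_, j, hj, hu⟩
    rintro rfl
    omega
  · rintro ⟨huv, j, hj, hu⟩
    refine ⟨j, ⟨?_, hj⟩, hu⟩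
    rintro rfl
    exact huv (posOf_injective σ (hu.trans hv.symm))

/-- A member of the class of `v` is at position `p + i - x (p + i)` plus its own letter. If `x (p +
i) ≤ i` this is at least `p`, and for `p = 0` nothing precedes the window; it is at most `p + i + Y
< p + L`. So the window contains the whole class. -/
theorem agentsAt_localClass {p L Y i : ℕ} (hY : ∀ q, x q ≤ Y) {v : Fin n}
    (hv : posOf σ v = p + i) (hL : i + Y < L) (hp : p = 0 ∨ x (p + i) ≤ i) :
    agentsAt σ p (localClass n p L (fun i => x (p + i)) i) = wordClass σ x v := by
  ext u
  rw [mem_agentsAt, mem_wordClass, hv]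
  simp only [localClass, mem_filter, mem_range]
  constructor
  · rintro ⟨j, ⟨-, -, hj⟩, hu⟩
    rw [hu]; omega
  · intro h
    have h1 := hY (posOf σ u)
    have h2 := posOf_lt σ u
    have h3 : p ≤ posOf σ u := by omega
    have h4 : p + (posOf σ u - p) = posOf σ u := by omega
    refine ⟨posOf σ u - p, ⟨by omega, by omega, ?_⟩, by omega⟩
    rw [h4]
    omega

/-- Blocking sets of local indices are the blocking sets of agents that fit into the window. -/
theorem localBlocking_iff {ag : ℕ → ℕ} (hag : ∀ i : Fin n, ag i = σ i) {p L Y : ℕ}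
    (hY : ∀ q, x q ≤ Y) {B : Finset ℕ} (hB : ∀ i ∈ B, p + i < n ∧ (p = 0 ∨ x (p + i) ≤ i) ∧
      i + Y < L) :
    I.LocalBlocking ag p L Y (fun i => x (p + i)) B ↔
      I.IsBlocking (wordMatching σ d x) (agentsAt σ p B) := by
  have hBn : ∀ j ∈ B, p + j < n := fun j hj => (hB j hj).1
  have key : ∀ i ∈ B, ∀ v, posOf σ v = p + i →
      ((#(localClass n p L (fun i => x (p + i)) i) ≠ d ∨
      I.prefAnswer (ag (p + i)) ((B.erase i).image fun j => ag (p + j))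
        (((localClass n p L (fun i => x (p + i)) i).erase i).image fun j => ag (p + j)) ≠ 0) ↔
      (#(wordClass σ x v) ≠ d ∨
        I.Prefers v ((agentsAt σ p B).erase v) ((wordClass σ x v).erase v))) := by
    intro i hi v hv
    obtain ⟨h1, h2, h3⟩ := hB i hi
    have hloc : ∀ j ∈ localClass n p L (fun i => x (p + i)) i, p + j < n :=
      fun j hj => (mem_filter.1 hj).2.1
    rw [← card_agentsAt (σ := σ) hloc, ← image_agentsAt hag fun j hj => hBn j (mem_of_mem_erase hj),
      ← image_agentsAt hag fun j hj => hloc j (mem_of_mem_erase hj), agentsAt_erase hv,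
      agentsAt_erase hv, agentsAt_localClass hY hv h3 h2]
    have : ag (p + i) = v := by
      rw [← hv]
      exact (hag (σ.symm v)).trans (by simp)
    rw [this, prefAnswer_ne_zero]
  rw [isBlocking_wordMatching, LocalBlocking, card_agentsAt hBn]
  refine and_congr_right fun _ => ⟨fun h v hv => ?_, fun h i hi => ?_⟩
  · obtain ⟨j, hj, hvj⟩ := mem_agentsAt.1 hv
    exact (key j hj v hvj).1 (h j hj).2.2.2
  · obtain ⟨h1, h2, h3⟩ := hB i hi
    have hv : posOf σ (σ ⟨p + i, h1⟩) = p + i := by simp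
    exact ⟨h1, h2, h3, (key i hi _ hv).2 (h _ (mem_agentsAt.2 ⟨i, hi, hv⟩))⟩

/-- A stable matching exists if and only if some word has only good windows. -/
theorem exists_isStable_iff_windowOK (hd : 2 ≤ d) (hκ : 1 ≤ I.kappa)
    (hσ : I.IsPosition (posOf σ)) {ag : ℕ → ℕ} (hag : ∀ i : Fin n, ag i = σ i) {Y : ℕ}
    (hY : Y = 4 * I.kappa * d ^ 2) :
    (∃ M, I.IsStable M) ↔ ∃ x : ℕ → ℕ, (∀ q, x q ≤ Y) ∧
      ∀ p < n, I.WindowOK ag p (4 * Y) Y (fun i => x (p + i)) := by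
  -- These estimates let `4 κ d ^ 2` absorb both span bounds, `κ d ^ 2 + 2 d` for matched sets and
  -- `d + κ + (κ + 1) d ^ 2` for least blocking sets.
  have hd2 : 2 * d ≤ d ^ 2 := by nlinarith
  have hκd : d ^ 2 ≤ I.kappa * d ^ 2 := Nat.le_mul_of_pos_left _ hκ
  have hκ4 : I.kappa * 4 ≤ I.kappa * d ^ 2 := Nat.mul_le_mul_left _ (by omega)
  have hY' : Y = 4 * (I.kappa * d ^ 2) := by rw [hY]; ring
  constructor
  · rintro ⟨M, hM⟩
    obtain ⟨x, hx, hxM⟩ := exists_wordMatching_eq (Y := Y) σ hd hM.1 fun T hT u hu v hv => by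
      have := hσ.card_between_le hM hT hu hv
      rw [card_between] at this
      omega
    refine ⟨x, hx, fun p _ B _ hB => hM.2 ⟨agentsAt σ p B, ?_⟩⟩
    rw [← hxM]
    exact (localBlocking_iff hag hx fun i hi =>
      ⟨(hB.2 i hi).1, (hB.2 i hi).2.1, (hB.2 i hi).2.2.1⟩).1 hB
  · rintro ⟨x, hx, hwin⟩
    have hMx := isMatching_wordMatching (σ := σ) (x := x) I
    refine ⟨wordMatching σ d x, hMx, ?_⟩
    rintro ⟨B₀, hB₀⟩
    classical
    obtain ⟨B, hB, hleast⟩ := exists_min_image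
      ({B | I.IsBlocking (wordMatching σ d x) B} : Finset (Finset (Fin n)))
      (fun B => ∑ u ∈ B, posOf σ u) ⟨B₀, by simpa using hB₀⟩
    simp only [mem_filter, mem_univ, true_and] at hB hleast
    have hspan : ∀ u ∈ B, ∀ v ∈ B, posOf σ v ≤ posOf σ u + Y := by
      intro u hu v hv
      have := hσ.card_between_le_of_isBlocking hMx hB hleast hu hv
      rw [card_between] at this
      have h2 : (I.kappa + 1) * d ^ 2 = I.kappa * d ^ 2 + d ^ 2 := by ring
      omega
    -- The window starts at the least position that a class of a member of `B` can reach back to,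
    -- cut off at `0`. Then `B` lies within the first `2 Y` places after `p`, and one more `Y`
    -- covers the classes, so length `4 Y` suffices.
    obtain ⟨b, hb, hmin⟩ := exists_min_image B (fun u => posOf σ u - x (posOf σ u))
      (card_pos.1 (by rw [hB.1]; omega))
    set p := posOf σ b - x (posOf σ b) with hp
    have hpb : posOf σ b ≤ p + Y := by have := hx (posOf σ b); omega
    have hge : ∀ u ∈ B, p ≤ posOf σ u := fun u hu => (hmin u hu).trans (Nat.sub_le _ _)
    have hag' : agentsAt σ p (B.image fun u => posOf σ u - p) = B := by
      ext v
      simp only [mem_agentsAt, mem_image, exists_exists_and_eq_and]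
      constructor
      · rintro ⟨u, hu, huv⟩
        have := hge u hu
        rwa [posOf_injective σ (show posOf σ v = posOf σ u by omega)]
      · exact fun hv => ⟨v, hv, by have := hge v hv; omega⟩
    have hloc : ∀ i ∈ B.image fun u => posOf σ u - p, p + i < n ∧ (p = 0 ∨ x (p + i) ≤ i) ∧
        i + Y < 4 * Y := by
      intro i hi
      obtain ⟨u, hu, rfl⟩ := mem_image.1 hi
      have h1 := hge u hu
      have h2 := hmin u hu
      have h3 := hspan b hb u hu
      have h4 := posOf_lt σ u
      have h5 : p + (posOf σ u - p) = posOf σ u := by omega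
      rw [h5]
      refine ⟨h4, by omega, by omega⟩
    refine hwin p (by have := posOf_lt σ b; omega) _ (fun i hi => ?_)
      ((localBlocking_iff hag hx hloc).2 (by rwa [hag']))
    have := (hloc i hi).2.2
    rw [mem_range]; omega

end Instance

/-! ### Words and paths of windows -/

/-- The digit of `c` at index `i` in base `b`. -/
def digit (b c i : ℕ) : ℕ := c / b ^ i % b

/-- This lets a single number below `b ^ L` stand for a window or, with digits `0` and `1`, for a
set of local indices. -/
theorem exists_digit_eq {b : ℕ} (hb : 0 < b) (L : ℕ) (y : ℕ → ℕ) (hy : ∀ i < L, y i < b) :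
    ∃ c < b ^ L, ∀ i < L, digit b c i = y i := by
  induction L generalizing y with
  | zero => exact ⟨0, by simp, by simp⟩
  | succ L ih =>
    obtain ⟨c, hc, h⟩ := ih (fun i => y (i + 1)) fun i hi => hy _ (by omega)
    have h0 := hy 0 (by omega)
    refine ⟨y 0 + b * c, ?_, fun i hi => ?_⟩
    · calc y 0 + b * c < b + b * c := by omega
        _ = b * (c + 1) := by ring
        _ ≤ b * b ^ L := Nat.mul_le_mul_left _ hc
        _ = b ^ (L + 1) := by ring
    · cases i with
      | zero => simp [digit, Nat.mod_eq_of_lt h0]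
      | succ i =>
        rw [← h i (by omega)]
        simp only [digit]
        rw [pow_succ', ← Nat.div_div_eq_div_mul, Nat.add_mul_div_left _ _ hb, Nat.div_eq_of_lt h0,
          zero_add]

/-- The window coded by `c` ends a path of `p` overlapping windows of length `L` of which the
`q`-th satisfies `ok q`. -/
def Reach (b L : ℕ) (ok : ℕ → (ℕ → ℕ) → Prop) : ℕ → ℕ → Prop
  | 0, _ => True
  | p + 1, c' => (∃ c < b ^ L, Reach b L ok p c ∧
      ∀ i, i + 1 < L → digit b c (i + 1) = digit b c' i) ∧ ok p (digit b c')

/-- Overlapping windows agree where they meet, so a path glues to a word; a new window overrides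
only the letters from its own start on. Conversely, a word is cut into its windows. Stage `p + 1`
holds the window from position `p` on, so stage `0` holds a window from position `-1` on that is
never tested; its extra first letter is taken to be `0`. -/
theorem exists_reach_iff {b L : ℕ} (hb : 0 < b) {ok : ℕ → (ℕ → ℕ) → Prop}
    (hok : ∀ p y y', (∀ i < L, y i = y' i) → ok p y → ok p y') (n : ℕ) :
    (∃ c < b ^ L, Reach b L ok n c) ↔
      ∃ x : ℕ → ℕ, (∀ q, x q < b) ∧ ∀ p < n, ok p (fun i => x (p + i)) := by
  constructor
  · rintro ⟨c, hc, h⟩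
    suffices H : ∀ p c, Reach b L ok p c → ∃ x : ℕ → ℕ, (∀ q, x q < b) ∧
        (∀ p' < p, ok p' fun i => x (p' + i)) ∧
        (0 < p → ∀ i < L, digit b c i = x (p - 1 + i)) by
      obtain ⟨x, h1, h2, -⟩ := H n c h
      exact ⟨x, h1, h2⟩
    intro p
    induction p with
    | zero => exact fun c _ => ⟨fun _ => 0, fun _ => hb, by simp, by simp⟩
    | succ p ih =>
      rintro c' ⟨⟨c, -, hc, hover⟩, hc'⟩
      obtain ⟨x, h1, h2, h3⟩ := ih c hc
      refine ⟨fun q => if q < p then x q else digit b c' (q - p), fun q => ?_, fun p' hp' => ?_,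
        fun _ i hi => by simp⟩
      · dsimp only
        split_ifs
        · exact h1 q
        · exact Nat.mod_lt _ hb
      · rcases Nat.lt_succ_iff_lt_or_eq.1 hp' with hp' | rfl
        · refine hok _ _ _ (fun i hi => ?_) (h2 p' hp')
          by_cases hq : p' + i < p
          · simp [hq]
          · simp only [hq, if_false]
            rw [← hover (p' + i - p) (by omega), h3 (by omega) _ (by omega)]
            congr 1
            omega
        · exact hok _ _ _ (fun i hi => by simp) hc'
  · rintro ⟨x, hx, h⟩
    suffices H : ∀ p ≤ n, ∃ c < b ^ L, Reach b L ok p c ∧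
        ∀ i < L, digit b c i = if p + i = 0 then 0 else x (p + i - 1) by
      obtain ⟨c, h1, h2, -⟩ := H n le_rfl
      exact ⟨c, h1, h2⟩
    intro p
    induction p with
    | zero =>
      intro _
      obtain ⟨c, h1, h2⟩ := exists_digit_eq hb L (fun i => if 0 + i = 0 then 0 else x (0 + i - 1))
        fun i _ => by
          split_ifs
          · exact hb
          · exact hx _
      exact ⟨c, h1, trivial, h2⟩
    | succ p ih =>
      intro hp
      obtain ⟨c, h1, h2, h3⟩ := ih (by omega)
      obtain ⟨c', h1', h2'⟩ := exists_digit_eq hb L (fun i => x (p + i)) fun i _ => hx _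
      refine ⟨c', h1', ⟨⟨c, h1, h2, fun i hi => ?_⟩, ?_⟩, fun i hi => ?_⟩
      · rw [h3 _ hi, h2' i (by omega), if_neg (by omega)]
        congr 1
      · exact hok _ _ _ (fun i hi => (h2' i hi).symm) (h p (by omega))
      · rw [h2' i hi, if_neg (by omega)]
        congr 1
        omega

variable {n d : ℕ} {I : Instance (Fin n) d}

theorem Instance.WindowOK.congr {ag : ℕ → ℕ} {p L Y : ℕ} {y y' : ℕ → ℕ}
    (h : ∀ i < L, y i = y' i) (hw : I.WindowOK ag p L Y y) : I.WindowOK ag p L Y y' := by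
  intro B hB hB'
  refine hw B hB ⟨hB'.1, fun i hi => ?_⟩
  have hiL := mem_range.1 (hB hi)
  have hcl : Instance.localClass n p L y i = Instance.localClass n p L y' i := by
    ext j
    simp only [Instance.localClass, mem_filter, mem_range]
    refine and_congr_right fun hj => ?_
    rw [h i hiL, h j hj]
  have := hB'.2 i hi
  rw [hcl, h i hiL]
  exact this

/-! ### Formulas -/

namespace Term

/-- The value of the term is not `0`. -/
def Holds (I : Instance (Fin n) d) (t : Term) (m : Memory) : Prop := t.val I m ≠ 0

/-- Negation. -/
def neg (t : Term) : Term := .sub (.num 1) t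

/-- Conjunction. -/
def and (s t : Term) : Term := (s.neg.add t.neg).neg

/-- Comparison of values. -/
def le (s t : Term) : Term := (s.sub t).neg

/-- Strict comparison of values. -/
def lt (s t : Term) : Term := t.sub s

/-- Equality of values. -/
def eq (s t : Term) : Term := ((s.sub t).add (t.sub s)).neg

/-- Bounded universal quantification. -/
def all (x y : ℕ) (t : Term) : Term := (sum x y t.neg).neg

/-- Bounded counting. -/
def count (x y : ℕ) (t : Term) : Term := sum x y t.neg.neg

variable {s t : Term} {m : Memory} {x y : ℕ}

theorem holds_neg : t.neg.Holds I m ↔ ¬ t.Holds I m := by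
  simp only [Holds, neg, val]; omega

theorem holds_and : (s.and t).Holds I m ↔ s.Holds I m ∧ t.Holds I m := by
  simp only [Holds, neg, and, val]; omega

theorem holds_or : (s.add t).Holds I m ↔ s.Holds I m ∨ t.Holds I m := by
  simp only [Holds, val]; omega

theorem holds_le : (s.le t).Holds I m ↔ s.val I m ≤ t.val I m := by
  simp only [Holds, neg, le, val]; omega

theorem holds_lt : (s.lt t).Holds I m ↔ s.val I m < t.val I m := by
  simp only [Holds, lt, val]; omega

theorem holds_eq : (s.eq t).Holds I m ↔ s.val I m = t.val I m := by
  simp only [Holds, neg, eq, val]; omega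

theorem holds_ex : (t.sum x y).Holds I m ↔ ∃ j < m.reg y, t.Holds I (m.setReg x j) := by
  simp [Holds, val, sum_eq_zero_iff]

theorem holds_all : (t.all x y).Holds I m ↔ ∀ j < m.reg y, t.Holds I (m.setReg x j) := by
  rw [all, holds_neg, holds_ex]
  simp only [holds_neg]
  push Not
  rfl

-- The double negation in `count` turns every nonzero value into `1`.
open Classical in
theorem val_count :
    (t.count x y).val I m = #{j ∈ range (m.reg y) | t.Holds I (m.setReg x j)} := by
  rw [card_filter]
  simp only [count, val]
  refine sum_congr rfl fun j _ => ?_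
  by_cases h : t.val I (m.setReg x j) = 0
  · simp [neg, val, Holds, h]
  · simp only [neg, val, Holds, h, ne_eq, not_false_eq_true, if_true]
    omega

end Term

/-! ### The terms of the algorithm

Registers: `0` and `1` hold `n` and `d`, `4` holds `κ`, `5` to `8` hold the largest letter `Y`, the
base `Y + 1`, the window length `4 * Y` and the number of windows. Register `11` holds the index in
array `5` of the current table of windows, `12` the first position of the current window and `13`
the code of this window. Array `2` holds the keys of the agents, array `3` the agents in sorted
order, array `4` the powers of the base. -/

namespace Term

/-- The quotient of `a` by `b`, both not depending on registers `30` and `31`. -/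
def quot (a b : Term) : Term := sum 30 8 (((sum 31 30 b).add b).le a)

/-- The digit of register `c` whose index is `o` plus register `i`. -/
def dig (c i o : ℕ) : Term :=
  (quot (reg c) (get 4 ((reg i).add (num o)))).sub
    (sum 32 6 (quot (reg c) (get 4 ((reg i).add (num (o + 1))))))

/-- The window in register `20` overlaps with the window in register `13`. -/
def overlap : Term :=
  all 21 7 (((reg 7).le ((reg 21).add (num 1))).add ((dig 20 21 1).eq (dig 13 21 0)))

/-- The local index in register `i` belongs to the set coded in register `22`. -/
def bit (i : ℕ) : Term := (dig 22 i 0).eq (num 1)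

/-- The local index in register `23` is in the class of the one in register `21`. -/
def same : Term :=
  (((reg 12).add (reg 23)).lt (reg 0)).and
    (((reg 23).add (dig 13 21 0)).eq ((reg 21).add (dig 13 23 0)))

/-- The agent at the local index in register `21` prefers the set coded in register `22` to its
class. -/
def prefersBit : Term :=
  pref (get 3 ((reg 12).add (reg 21))) 23 7 ((bit 23).and ((reg 23).eq (reg 21)).neg)
    (same.and ((reg 23).eq (reg 21)).neg) (get 3 ((reg 12).add (reg 23)))

/-- The agent at the local index in register `21` agrees to block with the set coded in
register `22`. -/
def agrees : Term :=
  (((reg 12).add (reg 21)).lt (reg 0)).and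
    ((((reg 12).eq (num 0)).add ((dig 13 21 0).le (reg 21))).and
      ((((reg 21).add (reg 5)).lt (reg 7)).and
        (((count 23 7 same).eq (reg 1)).neg.add prefersBit)))

/-- The set coded in register `22` is blocking. -/
def blocking : Term :=
  ((count 21 7 (bit 21)).eq (reg 1)).and (all 21 7 ((bit 21).neg.add agrees))

/-- The window in register `13` has no blocking set. -/
def windowOK : Term := all 22 8 blocking.neg

/-- The window in register `13` continues a path of windows. -/
def step : Term :=
  (sum 20 8 ((get 5 ((reg 11).add (reg 20))).and overlap)).and windowOK

end Term

/-- The parameters of the main phase have been computed. -/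
structure Setup (n d Y : ℕ) (m : Memory) : Prop where
  reg0 : m.reg 0 = n
  reg1 : m.reg 1 = d
  reg5 : m.reg 5 = Y
  reg6 : m.reg 6 = Y + 1
  reg7 : m.reg 7 = 4 * Y
  reg8 : m.reg 8 = (Y + 1) ^ (4 * Y)
  arr4 : ∀ q ≤ 4 * Y, m.arr 4 q = (Y + 1) ^ q

theorem Setup.setReg {Y x v : ℕ} {m : Memory} (h : Setup n d Y m) (hx : 8 < x) :
    Setup n d Y (m.setReg x v) := by
  obtain ⟨h0, h1, h5, h6, h7, h8, h4⟩ := h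
  constructor
  all_goals simp only [Memory.setReg_reg, Memory.setReg_arr]
  · rwa [if_neg (by omega)]
  · rwa [if_neg (by omega)]
  · rwa [if_neg (by omega)]
  · rwa [if_neg (by omega)]
  · rwa [if_neg (by omega)]
  · rwa [if_neg (by omega)]
  · exact h4

/-- The summed form of division: the condition says `z < a / b`, and `a ≤ N` ensures that no such
`z` is missed. -/
theorem card_filter_quot {N a b : ℕ} (hb : 0 < b) (ha : a ≤ N) :
    #{z ∈ range N | z * b + b ≤ a} = a / b := by
  have : {z ∈ range N | z * b + b ≤ a} = range (a / b) := by
    ext z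
    simp only [mem_filter, mem_range]
    rw [← Nat.succ_mul, ← Nat.le_div_iff_mul_le hb]
    have := Nat.div_le_self a b
    omega
  rw [this, card_range]

namespace Term

variable {Y : ℕ} {m : Memory}

/-- Without multiplication on the machine, `z * b` is the sum of `z` copies of `b`. -/
theorem val_quot {a b : Term} (ha : ∀ j, a.val I (m.setReg 30 j) = a.val I m)
    (hb : ∀ j, b.val I (m.setReg 30 j) = b.val I m)
    (hb' : ∀ j k, b.val I ((m.setReg 30 j).setReg 31 k) = b.val I m)
    (hpos : 0 < b.val I m) (hle : a.val I m ≤ m.reg 8) :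
    (quot a b).val I m = a.val I m / b.val I m := by
  rw [← card_filter_quot hpos hle, card_filter]
  simp only [quot, le, neg, val, ha, hb, hb']
  refine sum_congr rfl fun j _ => ?_
  simp only [sum_const, card_range, smul_eq_mul, Memory.setReg_reg, if_true]
  split_ifs <;> omega

/-- The digit is `c / b ^ i - b * (c / b ^ (i + 1))`, where the product is again a sum with `b`
summands. The table of powers reaches up to index `4 Y`, which covers the second divisor. -/
theorem val_dig (hS : Setup n d Y m) {c i o : ℕ} (hc : c < 30) (hi : i < 30)
    (hcN : m.reg c < (Y + 1) ^ (4 * Y)) (hio : m.reg i + o < 4 * Y) :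
    (dig c i o).val I m = digit (Y + 1) (m.reg c) (m.reg i + o) := by
  have key : ∀ (m' : Memory) (o' : ℕ), Setup n d Y m' → m'.reg c = m.reg c → m'.reg i = m.reg i →
      m.reg i + o' ≤ 4 * Y →
      (quot (reg c) (get 4 ((reg i).add (num o')))).val I m' =
        m.reg c / (Y + 1) ^ (m.reg i + o') := by
    intro m' o' hS' h1 h2 h3
    have e : m'.arr 4 (m.reg i + o') = (Y + 1) ^ (m.reg i + o') := hS'.arr4 _ h3
    rw [val_quot]
    · simp only [val, h1, h2, e]
    · intro j; simp [val, show c ≠ 30 by omega]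
    · intro j; simp [val, show i ≠ 30 by omega]
    · intro j k; simp [val, show i ≠ 30 by omega, show i ≠ 31 by omega]
    · simp only [val, h2, e]; positivity
    · simp only [val, h1, hS'.reg8]; omega
  have h2 : ∀ j, (quot (reg c) (get 4 ((reg i).add (num (o + 1))))).val I (m.setReg 32 j) =
      m.reg c / (Y + 1) ^ (m.reg i + (o + 1)) := fun j =>
    key _ _ (hS.setReg (by omega)) (by simp [show c ≠ 32 by omega])
      (by simp [show i ≠ 32 by omega]) (by omega)
  simp only [dig, val] at *
  rw [key m o hS rfl rfl (by omega)]
  simp only [h2, sum_const, card_range, smul_eq_mul, hS.reg6, digit]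
  rw [← add_assoc, pow_succ, ← Nat.div_div_eq_div_mul, Nat.mod_eq_sub_mul_div]

theorem holds_overlap (hS : Setup n d Y m) (h20 : m.reg 20 < (Y + 1) ^ (4 * Y))
    (h13 : m.reg 13 < (Y + 1) ^ (4 * Y)) :
    overlap.Holds I m ↔ ∀ i, i + 1 < 4 * Y →
      digit (Y + 1) (m.reg 20) (i + 1) = digit (Y + 1) (m.reg 13) i := by
  rw [overlap, holds_all, hS.reg7]
  have key : ∀ i, i + 1 < 4 * Y →
      ((dig 20 21 1).val I (m.setReg 21 i) = digit (Y + 1) (m.reg 20) (i + 1) ∧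
      (dig 13 21 0).val I (m.setReg 21 i) = digit (Y + 1) (m.reg 13) i) := by
    intro i hi
    rw [val_dig (hS.setReg (by omega)) (by omega) (by omega) (by simpa using h20)
        (by simpa using hi),
      val_dig (hS.setReg (by omega)) (by omega) (by omega) (by simpa using h13)
        (by simp; omega)]
    simp
  simp only [holds_or, holds_le, holds_eq]
  constructor
  · intro h i hi
    have := (h i (by omega)).resolve_left (by simp [val, hS.reg7]; omega)
    rwa [(key i hi).1, (key i hi).2] at this
  · intro h i hi
    by_cases hi' : i + 1 < 4 * Y
    · rw [(key i hi').1, (key i hi').2]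
      exact .inr (h i hi')
    · left; simp [val, hS.reg7]; omega

theorem holds_bit (hS : Setup n d Y m) (h22 : m.reg 22 < (Y + 1) ^ (4 * Y)) {i : ℕ}
    (hi : i < 30) (hiL : m.reg i < 4 * Y) :
    (bit i).Holds I m ↔ digit (Y + 1) (m.reg 22) (m.reg i) = 1 := by
  rw [bit, holds_eq, val_dig hS (by omega) hi h22 (by simpa using hiL)]
  simp [val]

theorem holds_same (hS : Setup n d Y m) (h13 : m.reg 13 < (Y + 1) ^ (4 * Y))
    (h21 : m.reg 21 < 4 * Y) (h23 : m.reg 23 < 4 * Y) :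
    same.Holds I m ↔ m.reg 23 ∈
      Instance.localClass n (m.reg 12) (4 * Y) (digit (Y + 1) (m.reg 13)) (m.reg 21) := by
  rw [same, holds_and, holds_lt, holds_eq]
  simp only [val]
  rw [val_dig hS (by omega) (by omega) h13 (by simpa using h21),
    val_dig hS (by omega) (by omega) h13 (by simpa using h23)]
  simp [Instance.localClass, h23, hS.reg0]

theorem holds_agrees (hS : Setup n d Y m) (h13 : m.reg 13 < (Y + 1) ^ (4 * Y))
    (h22 : m.reg 22 < (Y + 1) ^ (4 * Y)) (h21 : m.reg 21 < 4 * Y) {B : Finset ℕ}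
    (hB : B = {i ∈ range (4 * Y) | digit (Y + 1) (m.reg 22) i = 1}) (hBd : #B = d)
    (h21B : m.reg 21 ∈ B) :
    agrees.Holds I m ↔ m.reg 12 + m.reg 21 < n ∧
      (m.reg 12 = 0 ∨ digit (Y + 1) (m.reg 13) (m.reg 21) ≤ m.reg 21) ∧ m.reg 21 + Y < 4 * Y ∧
      (#(Instance.localClass n (m.reg 12) (4 * Y) (digit (Y + 1) (m.reg 13)) (m.reg 21)) ≠ d ∨
        I.prefAnswer (m.arr 3 (m.reg 12 + m.reg 21))
          ((B.erase (m.reg 21)).image fun j => m.arr 3 (m.reg 12 + j))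
          (((Instance.localClass n (m.reg 12) (4 * Y) (digit (Y + 1) (m.reg 13))
            (m.reg 21)).erase (m.reg 21)).image fun j => m.arr 3 (m.reg 12 + j)) ≠ 0) := by
  classical
  set T := Instance.localClass n (m.reg 12) (4 * Y) (digit (Y + 1) (m.reg 13)) (m.reg 21) with hT
  have hsame : ∀ j < 4 * Y, same.Holds I (m.setReg 23 j) ↔ j ∈ T := by
    intro j hj
    rw [holds_same (hS.setReg (by omega)) (by simpa using h13) (by simpa using h21)
      (by simpa using hj)]
    simp [hT]
  have hTL : T ⊆ range (4 * Y) := filter_subset _ _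
  have hcount : (count 23 7 same).val I m = #T := by
    rw [val_count, hS.reg7]
    congr 1
    ext j
    simp only [mem_filter, mem_range]
    exact ⟨fun h => (hsame j h.1).1 h.2, fun h => ⟨mem_range.1 (hTL h),
      (hsame j (mem_range.1 (hTL h))).2 h⟩⟩
  have hfB : {j ∈ range (4 * Y) | ((bit 23).and ((reg 23).eq (reg 21)).neg).val I
      (m.setReg 23 j) ≠ 0} = B.erase (m.reg 21) := by
    ext j
    simp only [mem_filter, mem_range, mem_erase, hB]
    rw [and_left_comm]
    refine and_congr_right fun hj => ?_
    refine holds_and.trans ?_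
    rw [holds_bit (hS.setReg (by omega)) (by simpa using h22) (by omega) (by simpa using hj),
      holds_neg, holds_eq]
    simp [val, and_comm]
  have hfT : {j ∈ range (4 * Y) | (same.and ((reg 23).eq (reg 21)).neg).val I
      (m.setReg 23 j) ≠ 0} = T.erase (m.reg 21) := by
    ext j
    simp only [mem_filter, mem_range, mem_erase]
    constructor
    · rintro ⟨hj, h⟩
      have h' := holds_and.1 h
      rw [hsame j hj, holds_neg, holds_eq] at h'
      exact ⟨by simpa [val] using h'.2, h'.1⟩
    · rintro ⟨h1, h2⟩
      have hj := mem_range.1 (hTL h2)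
      refine ⟨hj, holds_and.2 ?_⟩
      rw [hsame j hj, holds_neg, holds_eq]
      exact ⟨h2, by simpa [val] using h1⟩
  rw [agrees, holds_and, holds_and, holds_and, holds_lt, holds_or, holds_eq, holds_le, holds_lt,
    holds_or, holds_neg, holds_eq, hcount,
    val_dig hS (by omega) (by omega) h13 (by simpa using h21)]
  simp only [val, hS.reg0, hS.reg1, hS.reg5, hS.reg7, add_zero]
  refine and_congr_right fun h1 => and_congr_right fun _ => and_congr_right fun _ => ?_
  -- The preference test matters only if the class has `d` members. Then both partner sets have `d -
  -- 1` members, so the size guard of `pref` is passed.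
  refine or_congr_right' fun h4 => ?_
  have h4' : #T = d := by simpa using h4
  have h21T : m.reg 21 ∈ T := by simp [hT, Instance.localClass, h1, h21]
  have c1 : #(B.erase (m.reg 21)) = d - 1 := by rw [card_erase_of_mem h21B, hBd]
  have c2 : #(T.erase (m.reg 21)) = d - 1 := by rw [card_erase_of_mem h21T, h4']
  have key : prefersBit.val I m = I.prefAnswer (m.arr 3 (m.reg 12 + m.reg 21))
          ((B.erase (m.reg 21)).image fun j => m.arr 3 (m.reg 12 + j))
          ((T.erase (m.reg 21)).image fun j => m.arr 3 (m.reg 12 + j)) := by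
    unfold prefersBit
    rw [val]
    simp only [hS.reg7]
    rw [hfB, hfT, if_pos ⟨c1, c2⟩]
    simp [val]
  rw [Holds, key]

theorem holds_windowOK (hS : Setup n d Y m) (hY : 0 < Y) (h13 : m.reg 13 < (Y + 1) ^ (4 * Y)) :
    windowOK.Holds I m ↔
      I.WindowOK (m.arr 3) (m.reg 12) (4 * Y) Y (digit (Y + 1) (m.reg 13)) := by
  classical
  have key : ∀ e < (Y + 1) ^ (4 * Y), blocking.Holds I (m.setReg 22 e) ↔
      I.LocalBlocking (m.arr 3) (m.reg 12) (4 * Y) Y (digit (Y + 1) (m.reg 13))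
        {i ∈ range (4 * Y) | digit (Y + 1) e i = 1} := by
    intro e he
    set B : Finset ℕ := {i ∈ range (4 * Y) | digit (Y + 1) e i = 1} with hB
    have hS' : Setup n d Y (m.setReg 22 e) := hS.setReg (by omega)
    have hbit : ∀ j < 4 * Y, (bit 21).Holds I ((m.setReg 22 e).setReg 21 j) ↔ j ∈ B := by
      intro j hj
      rw [holds_bit (hS'.setReg (by omega)) (by simpa using he) (by omega) (by simpa using hj)]
      simp [hB, hj]
    have hcount : (count 21 7 (bit 21)).val I (m.setReg 22 e) = #B := by
      rw [val_count, hS'.reg7]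
      congr 1
      ext j
      simp only [mem_filter, mem_range]
      exact ⟨fun h => (hbit j h.1).1 h.2, fun h => ⟨mem_range.1 (mem_filter.1 h).1,
        (hbit j (mem_range.1 (mem_filter.1 h).1)).2 h⟩⟩
    rw [blocking, holds_and, holds_eq, holds_all, hcount, hS'.reg7, Instance.LocalBlocking]
    simp only [val, hS'.reg1]
    refine and_congr_right fun hBd => ?_
    have hag : ∀ j ∈ B, agrees.Holds I ((m.setReg 22 e).setReg 21 j) ↔ _ := fun j hj =>
      holds_agrees (B := B) (hS'.setReg (by omega)) (by simpa using h13) (by simpa using he)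
        (by simpa using (mem_filter.1 hj).1) (by simp [hB]) hBd (by simpa using hj)
    simp only [Memory.setReg_reg, Memory.setReg_arr] at hag
    norm_num at hag
    constructor
    · intro h i hi
      have hiL := mem_range.1 (mem_filter.1 hi).1
      have h2 := holds_or.1 (h i hiL)
      rw [holds_neg, hbit i hiL] at h2
      simpa using (hag i hi).1 (h2.resolve_left (not_not.2 hi))
    · intro h i hiL
      rw [holds_or, holds_neg, hbit i hiL]
      by_cases hi : i ∈ B
      · exact .inr ((hag i hi).2 (by simpa using h i hi))
      · exact .inl hi
  rw [windowOK, holds_all, hS.reg8]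
  constructor
  · intro h B hB hblock
    -- Every set of local indices is coded by its indicator digits, where `0 < Y` makes `1` a digit.
    -- So letting the code run over all window codes tests all sets, some of them repeatedly.
    obtain ⟨e, he, hdig⟩ := exists_digit_eq (b := Y + 1) (by omega) (4 * Y)
      (fun i => if i ∈ B then 1 else 0) fun i _ => by split_ifs <;> omega
    have hBe : B = {i ∈ range (4 * Y) | digit (Y + 1) e i = 1} := by
      ext i
      simp only [mem_filter, mem_range]
      constructor
      · intro hi
        have := mem_range.1 (hB hi)
        exact ⟨this, by rw [hdig i this, if_pos hi]⟩
      · rintro ⟨h1, h2⟩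
        by_contra hi
        rw [hdig i h1, if_neg hi] at h2
        omega
    exact holds_neg.1 (h e he) ((key e he).2 (hBe ▸ hblock))
  · intro h e he
    exact holds_neg.2 fun hb => h _ (filter_subset _ _) ((key e he).1 hb)

theorem holds_step (hS : Setup n d Y m) (hY : 0 < Y) (h13 : m.reg 13 < (Y + 1) ^ (4 * Y)) :
    step.Holds I m ↔ (∃ c < (Y + 1) ^ (4 * Y), m.arr 5 (m.reg 11 + c) ≠ 0 ∧
      ∀ i, i + 1 < 4 * Y → digit (Y + 1) c (i + 1) = digit (Y + 1) (m.reg 13) i) ∧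
      I.WindowOK (m.arr 3) (m.reg 12) (4 * Y) Y (digit (Y + 1) (m.reg 13)) := by
  rw [step, holds_and, holds_windowOK hS hY h13, holds_ex, hS.reg8]
  refine and_congr_left fun _ => exists_congr fun c => and_congr_right fun hc => ?_
  rw [holds_and, holds_overlap (hS.setReg (by omega)) (by simpa using hc) (by simpa using h13)]
  simp [Holds, val]

end Term

/-! ### Assignments of terms -/

namespace Program

/-- Store the value of a term in register `x`. -/
def set (x : ℕ) (t : Term) : Program := .seq (t.comp 100) (.assign x (.reg 100))

/-- Store the value of the term `u` in array `p` at the index given by the term `t`. -/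
def store (p : ℕ) (t u : Term) : Program :=
  .seq (t.comp 100) (.seq (u.comp 101) (.put p (.reg 100) (.reg 101)))

end Program

theorem Frame.setArr_both {k : ℕ} {m m' : Memory} (h : Frame k m m') (p i v : ℕ) :
    Frame k (m.setArr p i v) (m'.setArr p i v) :=
  ⟨fun y hy => by simp [h.1 y hy], fun y hy => by ext j; simp [h.2 y hy]⟩

theorem Runs.set {x : ℕ} {t : Term} {V T : ℕ} {l : List ℕ} {m : Memory} {Q : Memory → Prop}
    (hm : Small d V 100 l m) (ht : t.wf 100 = true) (hl : t.bounded l = true)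
    (hT : t.cost V + 2 ≤ T) (hQ : ∀ m', Frame 100 (m.setReg x (t.val I m)) m' → Q m') :
    Runs I (Program.set x t) m T Q := by
  refine Runs.seq (T' := 2) ((Runs.term t ht hl hm).mono le_rfl ?_) hT
  rintro m' ⟨h1, h2⟩
  refine Runs.assign (by simp [Expr.cost]) (hQ _ ?_)
  simp only [Expr.val, h1]
  exact h2.setReg_both _ _

theorem Runs.store {p : ℕ} {t u : Term} {V T : ℕ} {l : List ℕ} {m : Memory} {Q : Memory → Prop}
    (hm : Small d V 100 l m) (ht : t.wf 100 = true) (hu : u.wf 100 = true)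
    (htl : t.bounded l = true) (hul : u.bounded l = true) (hT : t.cost V + u.cost V + 3 ≤ T)
    (hQ : ∀ m', Frame 100 (m.setArr p (t.val I m) (u.val I m)) m' → Q m') :
    Runs I (Program.store p t u) m T Q := by
  refine Runs.seq (T' := u.cost V + 3) ((Runs.term t ht htl hm).mono le_rfl ?_) (by omega)
  rintro m' ⟨h1, h2⟩
  refine Runs.seq (T' := 3) ((Runs.term u (u.wf_mono hu (by omega)) hul
    ((hm.frame h2).mono (by omega))).mono le_rfl ?_) le_rfl
  rintro m'' ⟨h3, h4⟩
  refine Runs.put (by simp [Expr.cost]) (hQ _ ?_)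
  simp only [Expr.val, h3, h4.1 100 (by omega), h1, u.val_congr hu h2]
  exact (h2.trans (h4.anti (by omega))).setArr_both _ _ _

/-- Only bounded sums and preference queries multiply the cost, each by a constant times `V + 1`, so
the degree is governed by their nesting depth, which is fixed for a fixed term. -/
theorem Term.exists_cost_le (t : Term) : ∃ K e, ∀ V, t.cost V ≤ K * (V + 1) ^ e := by
  have one : ∀ V e : ℕ, 1 ≤ (V + 1) ^ e := fun V e => Nat.one_le_pow _ _ (by omega)
  have mono : ∀ V e e' : ℕ, e ≤ e' → (V + 1) ^ e ≤ (V + 1) ^ e' := fun V e e' h =>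
    Nat.pow_le_pow_right (by omega) h
  have up : ∀ {t : Term} {K e : ℕ}, (∀ V, t.cost V ≤ K * (V + 1) ^ e) → ∀ e', e ≤ e' → ∀ V,
      t.cost V ≤ K * (V + 1) ^ e' := fun h e' he V =>
    (h V).trans (Nat.mul_le_mul_left _ (mono V _ _ he))
  have bin : ∀ (e f : Term), (∃ K k, ∀ V, e.cost V ≤ K * (V + 1) ^ k) →
      (∃ K k, ∀ V, f.cost V ≤ K * (V + 1) ^ k) →
      ∃ K k, ∀ V, e.cost V + f.cost V + 4 ≤ K * (V + 1) ^ k := by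
    rintro e f ⟨K, k, h⟩ ⟨K', k', h'⟩
    refine ⟨K + K' + 4, max k k', fun V => ?_⟩
    have h1 := up h (max k k') (le_max_left _ _) V
    have h2 := up h' (max k k') (le_max_right _ _) V
    have h3 := one V (max k k')
    rw [add_mul, add_mul]
    omega
  induction t with
  | num c => exact ⟨2, 0, fun V => by simp [cost]⟩
  | reg x => exact ⟨2, 0, fun V => by simp [cost]⟩
  | get p e ih =>
    obtain ⟨K, k, h⟩ := ih
    refine ⟨K + 3, k, fun V => ?_⟩
    have h1 := h V
    have h3 := one V k
    rw [add_mul]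
    simp only [cost]
    omega
  | add e f ih ih' => exact bin e f ih ih'
  | sub e f ih ih' => exact bin e f ih ih'
  | ord e f ih ih' => exact bin e f ih ih'
  | sum x y b ih =>
    obtain ⟨K, k, h⟩ := ih
    refine ⟨K + 40, k + 1, fun V => ?_⟩
    have h1 := Nat.mul_le_mul_right (V + 1) (h V)
    have h2 := one V (k + 1)
    have h3 := mono V 1 (k + 1) (by omega)
    rw [pow_one] at h3
    have h4 : K * (V + 1) ^ k * (V + 1) = K * (V + 1) ^ (k + 1) := by ring
    simp only [cost]
    rw [add_mul, add_mul]
    omega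
  | pref v x y φ ψ a ihv ihφ ihψ iha =>
    obtain ⟨K, k, h⟩ := bin _ _ (bin v φ ihv ihφ |> fun ⟨K, k, h⟩ =>
      ⟨K, k, fun V => le_trans (by simp only [cost]; omega) (h V)⟩ :
        ∃ K k, ∀ V, (v.add φ).cost V ≤ K * (V + 1) ^ k) (bin ψ a ihψ iha |> fun ⟨K, k, h⟩ =>
      ⟨K, k, fun V => le_trans (by simp only [cost]; omega) (h V)⟩ :
        ∃ K k, ∀ V, (ψ.add a).cost V ≤ K * (V + 1) ^ k)
    refine ⟨4 * K + 200, k + 1, fun V => ?_⟩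
    have h0 := h V
    simp only [cost] at h0
    have h1 := Nat.mul_le_mul_right (V + 1) h0
    have h2 := one V (k + 1)
    have h3 := mono V 1 (k + 1) (by omega)
    rw [pow_one] at h3
    have h4 : K * (V + 1) ^ k * (V + 1) = K * (V + 1) ^ (k + 1) := by ring
    have h5 : (φ.cost V + a.cost V + 20) * (V + 1) ≤ K * (V + 1) ^ (k + 1) + 20 * (V + 1) := by
      rw [← h4, ← add_mul]
      exact Nat.mul_le_mul_right _ (by omega)
    have h6 : (ψ.cost V + a.cost V + 20) * (V + 1) ≤ K * (V + 1) ^ (k + 1) + 20 * (V + 1) := by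
      rw [← h4, ← add_mul]
      exact Nat.mul_le_mul_right _ (by omega)
    have h7 : v.cost V ≤ K * (V + 1) ^ (k + 1) := by
      rw [← h4]
      exact le_trans (by omega) (Nat.le_mul_of_pos_right _ (by omega))
    have h8 : (4 * K + 200) * (V + 1) ^ (k + 1) =
      4 * (K * (V + 1) ^ (k + 1)) + 200 * (V + 1) ^ (k + 1) := by ring
    simp only [cost]
    omega

/-! ### Sorting the agents -/

theorem Instance.orderAnswer_ne_zero {u v : Fin n} : I.orderAnswer u v ≠ 0 ↔ I.ge u v := by
  rw [orderAnswer]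
  split_ifs with h
  · refine iff_of_true one_ne_zero ?_
    obtain ⟨u', v', h1, h2, h3⟩ := h
    rwa [Fin.val_injective h1, Fin.val_injective h2] at h3
  · exact iff_of_false (by simp) fun h' => h ⟨u, v, rfl, rfl, h'⟩

open Classical in
theorem Term.val_count_of_reg {t : Term} {m : Memory} {x y : ℕ} (hy : m.reg y = n)
    {P : Fin n → Prop} (hP : ∀ w : Fin n, t.Holds I (m.setReg x w) ↔ P w) :
    (t.count x y).val I m = #{w : Fin n | P w} := by
  rw [val_count, hy, card_filter, card_filter, Finset.sum_range]
  simp only [hP]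

namespace Term

/-- The key of the agent in register `2`. -/
def key : Term := count 3 0 (ord (reg 3) (reg 2))

/-- The rank of the agent in register `2`. -/
def rank : Term :=
  count 3 0 (((get 2 (reg 3)).lt (get 2 (reg 2))).add
    (((get 2 (reg 3)).eq (get 2 (reg 2))).and ((reg 3).lt (reg 2))))

/-- The number of agents incomparable to the agent in register `2`. -/
def incomp : Term :=
  count 3 0 ((ord (reg 2) (reg 3)).neg.and (ord (reg 3) (reg 2)).neg)

variable {m : Memory}

theorem val_key (h0 : m.reg 0 = n) {v : Fin n} (hv : m.reg 2 = v) : key.val I m = I.key v := by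
  classical
  rw [key, val_count_of_reg h0 (P := fun w => I.ge w v), Instance.key]
  intro w
  simp only [Holds, val, Memory.setReg_reg]
  simpa [hv] using Instance.orderAnswer_ne_zero

theorem val_rank (h0 : m.reg 0 = n) {v : Fin n} (hv : m.reg 2 = v)
    (hk : ∀ w : Fin n, m.arr 2 w = I.key w) : rank.val I m = I.rank v := by
  classical
  rw [rank, val_count_of_reg h0
    (P := fun w => I.key w < I.key v ∨ I.key w = I.key v ∧ w < v), Instance.rank]
  · congr
  intro w
  rw [holds_or, holds_and, holds_lt, holds_eq, holds_lt]
  simp [val, hv, hk]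

theorem val_incomp (h0 : m.reg 0 = n) {v : Fin n} (hv : m.reg 2 = v) :
    incomp.val I m = #(I.incomp v) := by
  classical
  rw [incomp, val_count_of_reg h0 (P := fun w => IncompRel I.ge v w), Instance.incomp]
  · congr
  intro w
  rw [holds_and, holds_neg, holds_neg, IncompRel]
  simp only [Holds, val, Memory.setReg_reg]
  simp only [hv, if_true, show (2 : ℕ) ≠ 3 by omega, if_false]
  rw [Instance.orderAnswer_ne_zero, Instance.orderAnswer_ne_zero]

end Term

namespace Program

/-- Compute the sorted order of the agents in array `3` and `κ` in register `4`. -/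
def sort : Program :=
  .seq (forTo 2 0 (store 2 (.reg 2) .key))
    (.seq (forTo 2 0 (store 3 .rank (.reg 2)))
      (.seq (set 4 (.num 0))
        (forTo 2 0 (set 4 ((Term.reg 4).add (Term.incomp.sub (.reg 4)))))))

end Program

/-- Three loops over the agents, each evaluating in every round counts over all agents, so the time
is quadratic: keys, then the inverse of the rank, then `κ`. -/
theorem Runs.sort {m : Memory} (h0 : m.reg 0 = n) (h1 : m.reg 1 = d) (hdn : d ≤ n) :
    Runs I Program.sort m (1000 * (n + 1) ^ 2) fun m' => m'.reg 0 = n ∧ m'.reg 1 = d ∧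
      m'.reg 4 = I.kappa ∧ ∀ i : Fin n, m'.arr 3 i = I.sorted i := by
  have small : ∀ m : Memory, m.reg 0 = n → m.reg 1 = d → Small d n 100 [0] m := by
    intro m h0 h1
    exact ⟨by omega, hdn, h1, by simp, by simp [h0]⟩
  have csq : (n + 1) ^ 2 = (n + 1) * (n + 1) := by ring
  refine Runs.seq (T := 300 * (n + 1) ^ 2) (T' := 700 * (n + 1) ^ 2) ?_ (by omega)
  refine Runs.mono (Runs.forTo (B := n) (T := 200 * (n + 1)) (fun j m' =>
    m'.reg 2 = j ∧ m'.reg 0 = n ∧ m'.reg 1 = d ∧ ∀ v : Fin n, (v : ℕ) < j → m'.arr 2 v = I.key v) ?_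
    (fun j m' h => ⟨h.1, h.2.1⟩) ?_ le_rfl) (by rw [csq, ← mul_assoc]; gcongr; omega) ?_
  · simp [h0, h1]
  · rintro j hj m' ⟨i1, i2, i3, i4⟩
    refine Runs.store (small m' i2 i3) rfl rfl rfl rfl ?_ ?_
    · simp only [Term.cost, Term.key, Term.count, Term.neg]; omega
    intro m'' hf
    rw [Term.val_key i2 (v := ⟨j, hj⟩) i1] at hf
    simp only [Memory.setReg_reg, hf.1 2 (by omega), hf.1 0 (by omega), hf.1 1 (by omega),
      Memory.setReg_arr, hf.2 2 (by omega), Memory.setArr_reg, Memory.setArr_arr]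
    refine ⟨i1, by simp, by simp [i2], by simp [i3], fun v hv => ?_⟩
    simp only [Term.val, i1, true_and]
    split_ifs with h
    · congr 1
      exact Fin.ext h.symm
    · exact i4 v (by omega)
  rintro m₁ ⟨-, i2, i3, i4⟩
  replace i4 : ∀ v : Fin n, m₁.arr 2 v = I.key v := fun v => i4 v v.2
  refine Runs.seq (T := 300 * (n + 1) ^ 2) (T' := 400 * (n + 1) ^ 2) ?_ (by omega)
  -- Storing `v` at index `I.rank v` inverts the rank; its injectivity prevents later entries from
  -- overwriting earlier ones.
  refine Runs.mono (Runs.forTo (B := n) (T := 200 * (n + 1)) (fun j m' =>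
    m'.reg 2 = j ∧ m'.reg 0 = n ∧ m'.reg 1 = d ∧ (∀ v : Fin n, m'.arr 2 v = I.key v) ∧
    ∀ v : Fin n, (v : ℕ) < j → m'.arr 3 (I.rank v) = v) ?_
    (fun j m' h => ⟨h.1, h.2.1⟩) ?_ le_rfl) (by rw [csq, ← mul_assoc]; gcongr; omega) ?_
  · simp [i2, i3, i4]
  · rintro j hj m' ⟨i1, i2, i3, i4, i5⟩
    refine Runs.store (small m' i2 i3) rfl rfl rfl rfl ?_ ?_
    · simp only [Term.cost, Term.rank, Term.count, Term.neg, Term.and, Term.eq, Term.lt]; omega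
    intro m'' hf
    rw [Term.val_rank i2 (v := ⟨j, hj⟩) i1 i4] at hf
    simp only [Memory.setReg_reg, hf.1 2 (by omega), hf.1 0 (by omega), hf.1 1 (by omega),
      Memory.setReg_arr, hf.2 2 (by omega), hf.2 3 (by omega), Memory.setArr_reg,
      Memory.setArr_arr]
    refine ⟨i1, by simp, by simp [i2], by simp [i3], by simpa using i4, fun v hv => ?_⟩
    simp only [Term.val, i1, true_and]
    split_ifs with h
    · rw [Instance.rank_injective h]
    · refine i5 v ?_
      by_contra hvj
      refine h ?_
      congr 1
      exact Fin.ext (by simp; omega)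
  rintro m₂ ⟨-, i2, i3, -, i5⟩
  replace i5 : ∀ i : Fin n, m₂.arr 3 i = I.sorted i := fun i => by
    have h := i5 (I.sorted i) (Fin.is_lt _)
    rwa [← Instance.posOf_sorted, Instance.posOf_apply] at h
  refine Runs.seq (T := 4) (T' := 300 * (n + 1) ^ 2) ?_ (by
    have : 1 ≤ (n + 1) ^ 2 := Nat.one_le_pow _ _ (by omega)
    omega)
  refine Runs.set (small _ i2 i3) rfl rfl (by simp [Term.cost]) fun m₃ hf => ?_
  have e0 := hf.1 0 (by omega)
  have e1 := hf.1 1 (by omega)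
  have e4 := hf.1 4 (by omega)
  have e3 := hf.2 3 (by omega)
  simp [Term.val] at e0 e1 e4 e3
  -- With truncated subtraction, `r + (a - r)` is the maximum of `r` and `a`, so register `4` is a
  -- running maximum.
  refine Runs.mono (Runs.forTo (B := n) (T := 200 * (n + 1)) (fun j m' =>
    m'.reg 2 = j ∧ m'.reg 0 = n ∧ m'.reg 1 = d ∧ (∀ i : Fin n, m'.arr 3 i = I.sorted i) ∧
    m'.reg 4 ≤ I.kappa ∧ ∀ v : Fin n, (v : ℕ) < j → #(I.incomp v) ≤ m'.reg 4) ?_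
    (fun j m' h => ⟨h.1, h.2.1⟩) ?_ le_rfl) (by rw [csq, ← mul_assoc]; gcongr; omega) ?_
  · simp [e0, e1, e3, e4, i2, i3, i5]
  · rintro j hj m' ⟨i1, i2, i3, i4, i5, i6⟩
    refine Runs.set (small m' i2 i3) rfl rfl ?_ ?_
    · simp only [Term.cost, Term.incomp, Term.count, Term.neg, Term.and]; omega
    intro m'' hf
    simp only [Term.val] at hf
    rw [Term.val_incomp i2 (v := ⟨j, hj⟩) i1] at hf
    have hle := Instance.card_incomp_le (I := I) ⟨j, hj⟩
    simp only [Memory.setReg_reg, hf.1 2 (by omega), hf.1 0 (by omega), hf.1 1 (by omega),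
      hf.1 4 (by omega), Memory.setReg_arr, hf.2 3 (by omega)]
    refine ⟨i1, by simp, by simp [i2], by simp [i3], i4, by simp; omega, fun v hv => ?_⟩
    simp only [if_true, show (4 : ℕ) ≠ 2 by omega, if_false]
    by_cases hvj : (v : ℕ) = j
    · obtain rfl : v = ⟨j, hj⟩ := Fin.ext hvj
      omega
    · have := i6 v (by omega)
      omega
  · rintro m₄ ⟨-, j2, j3, j4, j5, j6⟩
    refine ⟨j2, j3, le_antisymm j5 (Finset.sup_le fun v _ => ?_), j4⟩
    refine le_trans (le_of_eq ?_) (j6 v v.2)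
    classical
    rw [Instance.incomp, ← Set.ncard_coe_finset]
    simp

/-! ### The main phase -/

namespace Program

/-- Compute the powers of the base. -/
def powers : Program :=
  forTo 9 7 (.seq (set 8 (.sum 20 6 (.reg 8))) (store 4 ((Term.reg 9).add (.num 1)) (.reg 8)))

/-- Compute the parameters and the initial table of the main phase. -/
def setup : Program :=
  .seq (set 5 (.sum 20 4 (.sum 21 1
      (((Term.reg 1).add (.reg 1)).add ((Term.reg 1).add (.reg 1))))))
    (.seq (set 6 ((Term.reg 5).add (.num 1)))
      (.seq (set 7 (((Term.reg 5).add (.reg 5)).add ((Term.reg 5).add (.reg 5))))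
        (.seq (set 8 (.num 1))
          (.seq (store 4 (.num 0) (.num 1))
            (.seq powers
              (.seq (forTo 9 8 (store 5 (.reg 9) (.num 1)))
                (set 11 (.num 0))))))))

/-- Compute the tables of the main phase one after the other. -/
def tables : Program :=
  forTo 12 0 (.seq
    (forTo 13 8 (store 5 (((Term.reg 11).add (.reg 8)).add (.reg 13)) .step))
    (set 11 ((Term.reg 11).add (.reg 8))))

/-- The main phase. -/
def main : Program :=
  .seq setup (.seq tables
    (set 0 (Term.sum 20 8 (.get 5 ((Term.reg 11).add (.reg 20)))).neg.neg))

/-- Decide whether there is a stable matching. -/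
def decideStable : Program :=
  .seq (set 50 (((Term.reg 1).le (.num 1)).add ((Term.reg 0).lt (.reg 1))))
    (.ite (.reg 50) (.assign 0 (.num 1))
      (.seq sort (.ite (.reg 4) main (.assign 0 (.num 1)))))

end Program

/-! ### Verification of the main phase -/

theorem Setup.frame {Y : ℕ} {m m' : Memory} (h : Setup n d Y m) (hf : Frame 100 m m') :
    Setup n d Y m' := by
  obtain ⟨h0, h1, h5, h6, h7, h8, h4⟩ := h
  constructor
  · rw [hf.1 _ (by omega), h0]
  · rw [hf.1 _ (by omega), h1]
  · rw [hf.1 _ (by omega), h5]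
  · rw [hf.1 _ (by omega), h6]
  · rw [hf.1 _ (by omega), h7]
  · rw [hf.1 _ (by omega), h8]
  · rw [hf.2 _ (by omega)]; exact h4

theorem Setup.setArr {Y p i v : ℕ} {m : Memory} (h : Setup n d Y m) (hp : p ≠ 4) :
    Setup n d Y (m.setArr p i v) := by
  obtain ⟨h0, h1, h5, h6, h7, h8, h4⟩ := h
  exact ⟨h0, h1, h5, h6, h7, h8, fun q hq => by simp [hp.symm, h4 q hq]⟩

/-- It lets the number of windows serve as the common bound `V` for all sums of the main phase,
including those up to `4 * Y` and those up to the base. -/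
theorem le_windows {Y : ℕ} (hY : 0 < Y) : 4 * Y + 1 ≤ (Y + 1) ^ (4 * Y) :=
  (Nat.lt_pow_self (by omega : 1 < Y + 1))

/-- Register `8` is multiplied by the base through a sum in every round; when the table of powers is
complete, it holds the number of windows. -/
theorem Runs.powers {m : Memory} {Y : ℕ} (hdY : d ≤ Y) (hY : 0 < Y) (a0 : m.reg 0 = n)
    (a1 : m.reg 1 = d) (a5 : m.reg 5 = Y) (a6 : m.reg 6 = Y + 1) (a7 : m.reg 7 = 4 * Y)
    (a8 : m.reg 8 = 1) (b4 : m.arr 4 0 = 1) :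
    Runs I Program.powers m (300 * ((Y + 1) ^ (4 * Y) + 1) ^ 2) fun m' =>
      Setup n d Y m' ∧ m'.arr 3 = m.arr 3 := by
  have hLN := le_windows hY
  obtain ⟨N, hN⟩ : ∃ N, N = (Y + 1) ^ (4 * Y) := ⟨_, rfl⟩
  rw [← hN] at hLN ⊢
  have csq : (N + 1) ^ 2 = (N + 1) * (N + 1) := by ring
  have small : ∀ m : Memory, m.reg 1 = d → Small d N 100 [] m := fun m h =>
    ⟨by omega, by omega, h, by simp, by simp⟩
  refine Runs.mono (Runs.forTo (B := 4 * Y) (T := 100 * (N + 1)) (fun j m' => m'.reg 9 = j ∧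
    m'.reg 7 = 4 * Y ∧ m'.reg 0 = n ∧ m'.reg 1 = d ∧ m'.reg 5 = Y ∧ m'.reg 6 = Y + 1 ∧
    m'.reg 8 = (Y + 1) ^ j ∧ (∀ q ≤ j, m'.arr 4 q = (Y + 1) ^ q) ∧
    m'.arr 3 = m.arr 3) ?_
    (fun j m' h => ⟨h.1, h.2.1⟩) ?_ le_rfl) (by rw [csq, ← mul_assoc]; gcongr <;> omega) ?_
  · simp [a0, a1, a5, a6, a7, a8, b4]
  · rintro j hj m' ⟨i9, i7, i0, i1, i5, i6, i8, c4, c3⟩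
    refine Runs.seq (T := 50 * (N + 1)) (T' := 50 * (N + 1)) ?_ (by omega)
    refine Runs.set (V := N) (l := [6]) ⟨by omega, by omega, i1, by simp, by simp; omega⟩ rfl rfl
      (by simp only [Term.cost]; omega) fun m₆ f6 => ?_
    have i0 : m₆.reg 0 = n := (f6.1 0 (by omega)).trans (by simp [i0])
    have i1 : m₆.reg 1 = d := (f6.1 1 (by omega)).trans (by simp [i1])
    have i5 : m₆.reg 5 = Y := (f6.1 5 (by omega)).trans (by simp [i5])
    have i8 : m₆.reg 8 = (Y + 1) ^ (j + 1) := (f6.1 8 (by omega)).trans (by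
      simp [i8, i6, Term.val]; exact (pow_succ' _ _).symm)
    have i6 : m₆.reg 6 = Y + 1 := (f6.1 6 (by omega)).trans (by simp [i6])
    have i7 : m₆.reg 7 = 4 * Y := (f6.1 7 (by omega)).trans (by simp [i7])
    have i9 : m₆.reg 9 = j := (f6.1 9 (by omega)).trans (by simp [i9])
    have c3 : m₆.arr 3 = m.arr 3 := (f6.2 3 (by omega)).trans c3
    have c4 : ∀ q ≤ j, m₆.arr 4 q = (Y + 1) ^ q := fun q hq => by
      rw [f6.2 4 (by omega)]; simp [c4 q hq]
    refine Runs.store (small _ i1) rfl rfl rfl rfl (by simp [Term.cost]; omega) fun m₇ f7 => ?_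
    simp only [Memory.setReg_reg, Memory.setReg_arr, f7.1 0 (by omega), f7.1 1 (by omega),
      f7.1 5 (by omega), f7.1 6 (by omega), f7.1 7 (by omega), f7.1 8 (by omega),
      f7.1 9 (by omega), f7.2 3 (by omega), f7.2 4 (by omega), Memory.setArr_reg,
      Memory.setArr_arr, Term.val, i0, i1, i5, i6, i7, i8, i9]
    refine ⟨trivial, by simp, by simp, by simp, by simp, by simp, by simp, by simp, ?_, ?_⟩
    · intro q hq
      by_cases h : q = j + 1
      · simp [h]
      · simpa [h] using c4 q (by omega)
    · ext q
      simp [c3]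
  · rintro m' ⟨-, i7, i0, i1, i5, i6, i8, c4, c3⟩
    exact ⟨⟨i0, i1, i5, i6, i7, i8, c4⟩, c3⟩

theorem Runs.setup {m : Memory} {Y : ℕ} (hd : 2 ≤ d) (hκ : 1 ≤ I.kappa)
    (hY : Y = 4 * I.kappa * d ^ 2) (h0 : m.reg 0 = n) (h1 : m.reg 1 = d)
    (h4 : m.reg 4 = I.kappa) (h3 : ∀ i : Fin n, m.arr 3 i = I.sorted i) :
    Runs I Program.setup m (1000 * ((Y + 1) ^ (4 * Y) + 1) ^ 2) fun m' => Setup n d Y m' ∧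
      m'.reg 11 = 0 ∧ (∀ c < (Y + 1) ^ (4 * Y), m'.arr 5 c ≠ 0) ∧
      ∀ i : Fin n, m'.arr 3 i = I.sorted i := by
  set N := (Y + 1) ^ (4 * Y) with hN
  have hdY : d ≤ Y := by
    rw [hY, pow_two, ← mul_assoc]; exact Nat.le_mul_of_pos_left _ (by positivity)
  have hκY : I.kappa ≤ Y := by
    rw [hY, mul_comm 4, mul_assoc]; exact Nat.le_mul_of_pos_right _ (by positivity)
  have hLN : 4 * Y + 1 ≤ N := le_windows (by omega)
  have csq : (N + 1) ^ 2 = (N + 1) * (N + 1) := by ring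
  have cle : N + 1 ≤ (N + 1) ^ 2 := by rw [csq]; exact Nat.le_mul_of_pos_left _ (by omega)
  refine Runs.seq (T := 100 * (N + 1) ^ 2) (T' := 900 * (N + 1) ^ 2) ?_ (by omega)
  refine Runs.set (V := N) (l := [4, 1]) ⟨by omega, by omega, h1, by simp, by simp; omega⟩ rfl rfl
    (by simp only [Term.cost]; rw [add_mul, add_mul, mul_assoc, ← csq]; omega) fun m₁ f1 => ?_
  have hval : (Term.sum 20 4 (.sum 21 1
      (((Term.reg 1).add (.reg 1)).add ((Term.reg 1).add (.reg 1))))).val I m = Y := by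
    simp [Term.val, h1, h4, hY]; ring
  rw [hval] at f1
  have small : ∀ m : Memory, m.reg 1 = d → Small d N 100 [] m := fun m h =>
    ⟨by omega, by omega, h, by simp, by simp⟩
  have a0 := f1.1 0 (by omega)
  have a1 := f1.1 1 (by omega)
  have a5 := f1.1 5 (by omega)
  have b3 := f1.2 3 (by omega)
  simp [h0, h1] at a0 a1 a5 b3
  refine Runs.seq (T := 10) (T' := 800 * (N + 1) ^ 2) ?_ (by omega)
  refine Runs.set (small _ a1) rfl rfl (by simp [Term.cost]) fun m₂ f2 => ?_
  have a0 : m₂.reg 0 = n := (f2.1 0 (by omega)).trans (by simp [a0])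
  have a1 : m₂.reg 1 = d := (f2.1 1 (by omega)).trans (by simp [a1])
  have a6 : m₂.reg 6 = Y + 1 := (f2.1 6 (by omega)).trans (by simp [a5, Term.val])
  have a5 : m₂.reg 5 = Y := (f2.1 5 (by omega)).trans (by simp [a5])
  have b3 : m₂.arr 3 = m.arr 3 := (f2.2 3 (by omega)).trans (by simp [b3])
  refine Runs.seq (T := 30) (T' := 770 * (N + 1) ^ 2) ?_ (by omega)
  refine Runs.set (small _ a1) rfl rfl (by simp [Term.cost]) fun m₃ f3 => ?_
  have a0 : m₃.reg 0 = n := (f3.1 0 (by omega)).trans (by simp [a0])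
  have a1 : m₃.reg 1 = d := (f3.1 1 (by omega)).trans (by simp [a1])
  have a7 : m₃.reg 7 = 4 * Y := (f3.1 7 (by omega)).trans (by simp [a5, Term.val]; omega)
  have a5 : m₃.reg 5 = Y := (f3.1 5 (by omega)).trans (by simp [a5])
  have a6 : m₃.reg 6 = Y + 1 := (f3.1 6 (by omega)).trans (by simp [a6])
  have b3 : m₃.arr 3 = m.arr 3 := (f3.2 3 (by omega)).trans (by simp [b3])
  refine Runs.seq (T := 10) (T' := 760 * (N + 1) ^ 2) ?_ (by omega)
  refine Runs.set (small _ a1) rfl rfl (by simp [Term.cost]) fun m₄ f4 => ?_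
  have a0 : m₄.reg 0 = n := (f4.1 0 (by omega)).trans (by simp [a0])
  have a1 : m₄.reg 1 = d := (f4.1 1 (by omega)).trans (by simp [a1])
  have a5 : m₄.reg 5 = Y := (f4.1 5 (by omega)).trans (by simp [a5])
  have a6 : m₄.reg 6 = Y + 1 := (f4.1 6 (by omega)).trans (by simp [a6])
  have a7 : m₄.reg 7 = 4 * Y := (f4.1 7 (by omega)).trans (by simp [a7])
  have a8 : m₄.reg 8 = 1 := (f4.1 8 (by omega)).trans (by simp [Term.val])
  have b3 : m₄.arr 3 = m.arr 3 := (f4.2 3 (by omega)).trans (by simp [b3])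
  refine Runs.seq (T := 10) (T' := 750 * (N + 1) ^ 2) ?_ (by omega)
  refine Runs.store (small _ a1) rfl rfl rfl rfl (by simp [Term.cost]) fun m₅ f5 => ?_
  have a0 : m₅.reg 0 = n := (f5.1 0 (by omega)).trans (by simp [a0])
  have a1 : m₅.reg 1 = d := (f5.1 1 (by omega)).trans (by simp [a1])
  have a5 : m₅.reg 5 = Y := (f5.1 5 (by omega)).trans (by simp [a5])
  have a6 : m₅.reg 6 = Y + 1 := (f5.1 6 (by omega)).trans (by simp [a6])
  have a7 : m₅.reg 7 = 4 * Y := (f5.1 7 (by omega)).trans (by simp [a7])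
  have a8 : m₅.reg 8 = 1 := (f5.1 8 (by omega)).trans (by simp [a8])
  have b3 : ∀ i : Fin n, m₅.arr 3 i = I.sorted i := fun i => by
    rw [f5.2 3 (by omega), ← h3 i, ← b3]; simp
  have b4 : m₅.arr 4 0 = 1 := by rw [f5.2 4 (by omega)]; simp [Term.val]
  refine Runs.seq (T := 300 * (N + 1) ^ 2) (T' := 400 * (N + 1) ^ 2) ?_ (by omega)
  refine (Runs.powers (I := I) hdY (by omega) a0 a1 a5 a6 a7 a8 b4).mono le_rfl ?_
  rintro m₆ ⟨hS, c3⟩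
  rw [← c3] at b3
  have i8 := hS.reg8
  refine Runs.seq (T := 300 * (N + 1) ^ 2) (T' := 4) ?_ (by omega)
  refine Runs.mono (Runs.forTo (B := N) (T := 100 * (N + 1)) (fun j m' => m'.reg 9 = j ∧
    m'.reg 8 = N ∧ Setup n d Y m' ∧ (∀ c < j, m'.arr 5 c ≠ 0) ∧
    ∀ i : Fin n, m'.arr 3 i = I.sorted i) ?_
    (fun j m' h => ⟨h.1, h.2.1⟩) ?_ le_rfl) (by rw [csq, ← mul_assoc]; gcongr; omega) ?_
  · exact ⟨by simp, by simp [i8, hN], hS.setReg (by omega), by simp, by simp [b3]⟩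
  · rintro j hj m' ⟨i9, i8, hS, c5, c3⟩
    refine Runs.store (small _ hS.reg1) rfl rfl rfl rfl (by simp [Term.cost]; omega)
      fun m₇ f7 => ?_
    have hS' : Setup n d Y m₇ := (hS.setArr (by omega)).frame f7
    refine ⟨?_, by simp, ?_, hS'.setReg (by omega), fun c hc => ?_, fun i => ?_⟩
    · rw [f7.1 9 (by omega)]; simp [i9]
    · simp [hS'.reg8, hN]
    · rw [Memory.setReg_arr, f7.2 5 (by omega), Memory.setArr_arr]
      simp only [Term.val, i9, true_and]
      split_ifs with h
      · omega
      · exact c5 c (by omega)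
    · rw [Memory.setReg_arr, f7.2 3 (by omega), Memory.setArr_arr]
      simp [c3]
  rintro m₇ ⟨-, -, hS, c5, c3⟩
  refine Runs.set (small _ hS.reg1) rfl rfl (by simp [Term.cost]) fun m₈ f8 => ?_
  refine ⟨(hS.setReg (by omega)).frame f8, ?_, fun c hc => ?_, fun i => ?_⟩
  · rw [f8.1 11 (by omega)]; simp [Term.val]
  · rw [f8.2 5 (by omega)]; simpa using c5 c hc
  · rw [f8.2 3 (by omega)]; simp [c3]

/-- Row `p` of the dynamic program is kept at offset `p * N` in array `5` and records the windows
that end a path of `p` windows. Row `p + 1` is written behind row `p`, which therefore stays intact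
while it is read. The offset is advanced by adding `N`. -/
theorem Runs.tables {m : Memory} {Y T : ℕ} (hdY : d ≤ Y) (hY : 0 < Y) (hS : Setup n d Y m)
    (h11 : m.reg 11 = 0) (h5 : ∀ c < (Y + 1) ^ (4 * Y), m.arr 5 c ≠ 0)
    (hT : ((Term.step.cost ((Y + 1) ^ (4 * Y)) + 30) * ((Y + 1) ^ (4 * Y) + 1) + 30) * (n + 1)
      ≤ T) :
    Runs I Program.tables m T fun m' => Setup n d Y m' ∧ m'.reg 11 = n * (Y + 1) ^ (4 * Y) ∧
      ∀ c < (Y + 1) ^ (4 * Y), m'.arr 5 (n * (Y + 1) ^ (4 * Y) + c) ≠ 0 ↔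
        Reach (Y + 1) (4 * Y) (fun p => I.WindowOK (m.arr 3) p (4 * Y) Y) n c := by
  set N := (Y + 1) ^ (4 * Y) with hN
  set R := Reach (Y + 1) (4 * Y) (fun p => I.WindowOK (m.arr 3) p (4 * Y) Y) with hR
  have hLN : 4 * Y + 1 ≤ N := le_windows hY
  have small : ∀ m : Memory, Setup n d Y m → Small d N 100 [6, 7, 8] m := fun m h =>
    ⟨by omega, by omega, h.reg1, by simp, by simp [h.reg6, h.reg7, h.reg8, ← hN]; omega⟩
  refine Runs.mono (Runs.forTo (B := n) (T := (Term.step.cost N + 30) * (N + 1) + 20)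
    (fun p m' => m'.reg 12 = p ∧ m'.reg 0 = n ∧ Setup n d Y m' ∧ m'.reg 11 = p * N ∧
      m'.arr 3 = m.arr 3 ∧ ∀ c < N, m'.arr 5 (p * N + c) ≠ 0 ↔ R p c) ?_
    (fun j m' h => ⟨h.1, h.2.1⟩) ?_ le_rfl) (le_trans (Nat.mul_le_mul_right _ (by omega)) hT) ?_
  · refine ⟨by simp, by simp [hS.reg0], hS.setReg (by omega), by simp [h11], rfl, fun c hc => ?_⟩
    simp [h5 c hc, hR, Reach]
  · rintro p hp m₁ ⟨i12, i0, hS, i11, i3, i5⟩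
    refine Runs.seq (T := (Term.step.cost N + 30) * (N + 1)) (T' := 20) ?_ le_rfl
    refine Runs.mono (Runs.forTo (B := N) (T := Term.step.cost N + 20)
      (fun j m' => m'.reg 13 = j ∧ m'.reg 8 = N ∧ m'.reg 12 = p ∧ Setup n d Y m' ∧
        m'.reg 11 = p * N ∧ m'.arr 3 = m.arr 3 ∧ (∀ c < N, m'.arr 5 (p * N + c) ≠ 0 ↔ R p c) ∧
        ∀ c < j, m'.arr 5 ((p + 1) * N + c) ≠ 0 ↔ R (p + 1) c) ?_
      (fun j m' h => ⟨h.1, h.2.1⟩) ?_ le_rfl) (Nat.mul_le_mul_right _ (by omega)) ?_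
    · exact ⟨by simp, by simp [hS.reg8, hN], by simp [i12], hS.setReg (by omega), by simp [i11],
        i3, i5, by simp⟩
    · rintro j hj m₂ ⟨j13, -, j12, hS, j11, j3, j5, j5'⟩
      refine Runs.store (small _ hS) rfl rfl rfl rfl (by simp [Term.cost]; omega) fun m₃ hf => ?_
      have hstep : Term.step.val I m₂ ≠ 0 ↔ R (p + 1) j := by
        refine (Term.holds_step hS hY (by rw [j13]; exact hj)).trans ?_
        rw [j11, j12, j13, j3]
        simp only [hR, Reach]
        refine and_congr_left fun _ => exists_congr fun c => and_congr_right fun hc => ?_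
        rw [j5 c hc]
      have hidx : (((Term.reg 11).add (.reg 8)).add (.reg 13)).val I m₂ = (p + 1) * N + j := by
        simp [Term.val, j11, j13, hS.reg8, ← hN]; ring
      rw [hidx] at hf
      have hS' : Setup n d Y m₃ := (hS.setArr (by omega)).frame hf
      have e5 : ∀ q, m₃.arr 5 q = if q = (p + 1) * N + j then Term.step.val I m₂ else
          m₂.arr 5 q := fun q => by rw [hf.2 5 (by omega)]; simp
      have e3 : m₃.arr 3 = m₂.arr 3 := by rw [hf.2 3 (by omega)]; ext q; simp
      have esucc : (p + 1) * N = p * N + N := by ring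
      refine ⟨?_, by simp, by simp [hS'.reg8, hN], ?_, hS'.setReg (by omega), ?_, e3.trans j3, ?_,
        ?_⟩
      · rw [hf.1 13 (by omega)]; simp [j13]
      · rw [Memory.setReg_reg, if_neg (by omega), hf.1 12 (by omega)]; simp [j12]
      · rw [Memory.setReg_reg, if_neg (by omega), hf.1 11 (by omega)]; simp [j11]
      · intro c hc
        rw [Memory.setReg_arr, e5, if_neg (by omega)]
        exact j5 c hc
      · intro c hc
        rw [Memory.setReg_arr, e5]
        split_ifs with h
        · obtain rfl : c = j := by omega
          exact hstep
        · exact j5' c (by omega)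
    · rintro m₂ ⟨-, -, j12, hS, j11, j3, -, j5'⟩
      refine Runs.set (small _ hS) rfl rfl (by simp [Term.cost]) fun m₃ hf => ?_
      have hS' : Setup n d Y m₃ := (hS.setReg (by omega)).frame hf
      refine ⟨?_, by simp, by simp [hS'.reg0], hS'.setReg (by omega), ?_, ?_, fun c hc => ?_⟩
      · rw [hf.1 12 (by omega)]; simp [j12]
      · rw [Memory.setReg_reg, if_neg (by omega), hf.1 11 (by omega)]
        simp [Term.val, j11, hS.reg8, ← hN]; ring
      · rw [Memory.setReg_arr, hf.2 3 (by omega)]; simp [j3]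
      · rw [Memory.setReg_arr, hf.2 5 (by omega)]; exact j5' c hc
  · rintro m' ⟨-, -, hS, i11, -, i5⟩
    exact ⟨hS, i11, i5⟩

theorem Runs.main {m : Memory} {Y T : ℕ} (hd : 2 ≤ d) (hκ : 1 ≤ I.kappa)
    (hY : Y = 4 * I.kappa * d ^ 2) (h0 : m.reg 0 = n) (h1 : m.reg 1 = d)
    (h4 : m.reg 4 = I.kappa) (h3 : ∀ i : Fin n, m.arr 3 i = I.sorted i)
    (hT : (1000 * ((Y + 1) ^ (4 * Y) + 1) ^ 2 +
      (Term.step.cost ((Y + 1) ^ (4 * Y)) + 130) * ((Y + 1) ^ (4 * Y) + 1) + 100) * (n + 1)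
      ≤ T) :
    Runs I Program.main m T fun m' => ((∃ M, I.IsStable M) → m'.reg 0 = 1) ∧
      ((¬ ∃ M, I.IsStable M) → m'.reg 0 = 0) := by
  set N := (Y + 1) ^ (4 * Y) with hN
  have hdY : d ≤ Y := by
    rw [hY, pow_two, ← mul_assoc]; exact Nat.le_mul_of_pos_left _ (by positivity)
  have hLN : 4 * Y + 1 ≤ N := le_windows (by omega)
  set A := 1000 * (N + 1) ^ 2
  set Z := (Term.step.cost N + 30) * (N + 1) with hZ
  have hZ' : (Term.step.cost N + 130) * (N + 1) = Z + 100 * (N + 1) := by rw [hZ]; ring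
  have hT' : A + (Z + 30) * (n + 1) + (100 * (N + 1) + 70) ≤ T := by
    refine le_trans ?_ hT
    rw [hZ']
    calc A + (Z + 30) * (n + 1) + (100 * (N + 1) + 70)
        ≤ A * (n + 1) + (Z + 30) * (n + 1) + (100 * (N + 1) + 70) * (n + 1) :=
          add_le_add (add_le_add (Nat.le_mul_of_pos_right _ (by omega)) le_rfl)
            (Nat.le_mul_of_pos_right _ (by omega))
      _ = _ := by ring
  refine Runs.seq (T := A) (T' := (Z + 30) * (n + 1) + (100 * (N + 1) + 70)) ?_ (by omega)
  refine (Runs.setup hd hκ hY h0 h1 h4 h3).mono le_rfl ?_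
  rintro m₁ ⟨hS, i11, i5, i3⟩
  refine Runs.seq (T := (Z + 30) * (n + 1)) (T' := 100 * (N + 1) + 70) ?_ le_rfl
  refine (Runs.tables hdY (by omega) hS i11 i5 le_rfl).mono le_rfl ?_
  rintro m₂ ⟨hS, j11, j5⟩
  refine Runs.set (V := N) (l := [8]) ⟨by omega, by omega, hS.reg1, by simp,
    by simp [hS.reg8, hN]⟩ rfl rfl (by simp only [Term.cost, Term.neg]; omega) fun m₃ hf => ?_
  -- Stable matchings correspond to words with good windows, these to paths of `n` windows, and the
  -- ends of such paths are the nonzero entries of the last row.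
  have key : (∃ M, I.IsStable M) ↔
      (Term.sum 20 8 (.get 5 ((Term.reg 11).add (.reg 20)))).Holds I m₂ := by
    rw [Instance.exists_isStable_iff_windowOK hd hκ Instance.isPosition_sorted i3 hY,
      Term.holds_ex, hS.reg8]
    have := exists_reach_iff (b := Y + 1) (L := 4 * Y) (by omega)
      (ok := fun p => I.WindowOK (m₁.arr 3) p (4 * Y) Y) (fun p y y' h hw => hw.congr h) n
    simp only [Nat.lt_succ_iff] at this
    rw [← this]
    refine exists_congr fun c => and_congr_right fun hc => ?_
    rw [← j5 c hc]
    simp [Term.Holds, Term.val, j11]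
  rw [hf.1 0 (by omega), Memory.setReg_reg, if_pos rfl, key]
  simp only [Term.neg, Term.val, Term.Holds]
  omega

/-! ### The total running time -/

/-- From `4 ≤ d ^ 2` follows `Y ≤ X` with `X = κ d ^ 4`. So the base `Y + 1` is at most `X ^ 2` and
the exponent at most `4 X`; the added `1` is absorbed by one more factor of `X`. -/
theorem one_add_windows_le {κ d : ℕ} (hd : 2 ≤ d) (hκ : 1 ≤ κ) :
    (4 * κ * d ^ 2 + 1) ^ (4 * (4 * κ * d ^ 2)) + 1 ≤ (κ * d ^ 4) ^ (9 * (κ * d ^ 4)) := by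
  set X := κ * d ^ 4 with hX
  have hd4 : 4 ≤ d ^ 2 := by nlinarith
  have hd16 : 16 ≤ d ^ 4 := by nlinarith [show d ^ 4 = d ^ 2 * d ^ 2 by ring]
  have hX16 : 16 ≤ X := by nlinarith
  have hYX : 4 * κ * d ^ 2 ≤ X := by
    calc 4 * κ * d ^ 2 = κ * d ^ 2 * 4 := by ring
      _ ≤ κ * d ^ 2 * d ^ 2 := Nat.mul_le_mul_left _ hd4
      _ = X := by rw [hX]; ring
  have h1 : (4 * κ * d ^ 2 + 1) ^ (4 * (4 * κ * d ^ 2)) ≤ X ^ (8 * X) := by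
    calc (4 * κ * d ^ 2 + 1) ^ (4 * (4 * κ * d ^ 2)) ≤ (X ^ 2) ^ (4 * (4 * κ * d ^ 2)) :=
          Nat.pow_le_pow_left (by nlinarith) _
      _ ≤ (X ^ 2) ^ (4 * X) := Nat.pow_le_pow_right (by positivity) (by omega)
      _ = X ^ (8 * X) := by rw [← pow_mul]; congr 1; ring
  calc (4 * κ * d ^ 2 + 1) ^ (4 * (4 * κ * d ^ 2)) + 1 ≤ X ^ (8 * X) + X ^ (8 * X) :=
        add_le_add h1 (Nat.one_le_pow _ _ (by omega))
    _ = 2 * X ^ (8 * X) := by ring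
    _ ≤ X * X ^ (8 * X) := Nat.mul_le_mul_right _ (by omega)
    _ = X ^ (8 * X + 1) := by ring
    _ ≤ X ^ (9 * X) := Nat.pow_le_pow_right (by omega) (by omega)

theorem exists_main_cost_le : ∃ C : ℕ, ∀ κ d n : ℕ, 2 ≤ d → 1 ≤ κ → 1 ≤ n →
    ∀ N, N = (4 * κ * d ^ 2 + 1) ^ (4 * (4 * κ * d ^ 2)) →
      (1000 * (N + 1) ^ 2 + (Term.step.cost N + 130) * (N + 1) + 100) * (n + 1) ≤
        (κ * d ^ 4) ^ (C * (κ * d ^ 4)) * n := by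
  obtain ⟨K, e, hK⟩ := Term.step.exists_cost_le
  -- The cost per position is at most `(K + 1230) (N + 1) ^ (e + 2)` with `1230 = 1000 + 130 + 100`,
  -- and the `2` comes from `n + 1 ≤ 2 n`. The constant factor goes into the exponent because `2 ≤
  -- X`, and `N + 1 ≤ X ^ (9 X)` gives the other summand.
  refine ⟨2 * (K + 1230) + 9 * (e + 2), fun κ d n hd hκ hn N hN => ?_⟩
  have hN1 := one_add_windows_le hd hκ
  rw [← hN] at hN1
  set X := κ * d ^ 4 with hX
  have hX2 : 2 ≤ X := by
    have : 2 ^ 4 ≤ d ^ 4 := Nat.pow_le_pow_left hd 4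
    nlinarith
  have p1 : ∀ a b, a ≤ b → (N + 1) ^ a ≤ (N + 1) ^ b := fun a b h =>
    Nat.pow_le_pow_right (by omega) h
  have h1 := p1 2 (e + 2) (by omega)
  have h2 : Term.step.cost N * (N + 1) ≤ K * (N + 1) ^ (e + 2) := by
    calc Term.step.cost N * (N + 1) ≤ K * (N + 1) ^ e * (N + 1) := Nat.mul_le_mul_right _ (hK N)
      _ = K * (N + 1) ^ (e + 1) := by ring
      _ ≤ _ := Nat.mul_le_mul_left _ (p1 _ _ (by omega))
  have h3 := p1 1 (e + 2) (by omega)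
  rw [pow_one] at h3
  have h4 : 1 ≤ (N + 1) ^ (e + 2) := Nat.one_le_pow _ _ (by omega)
  have h5 : 1000 * (N + 1) ^ 2 + (Term.step.cost N + 130) * (N + 1) + 100 ≤
      (K + 1230) * (N + 1) ^ (e + 2) := by
    rw [add_mul, add_mul]; omega
  calc (1000 * (N + 1) ^ 2 + (Term.step.cost N + 130) * (N + 1) + 100) * (n + 1)
      ≤ ((K + 1230) * (N + 1) ^ (e + 2)) * (2 * n) := Nat.mul_le_mul h5 (by omega)
    _ = (2 * (K + 1230)) * (N + 1) ^ (e + 2) * n := by ring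
    _ ≤ X ^ (2 * (K + 1230) * X) * (X ^ (9 * X)) ^ (e + 2) * n := by
        refine Nat.mul_le_mul_right _ (Nat.mul_le_mul ?_ (Nat.pow_le_pow_left hN1 _))
        calc 2 * (K + 1230) ≤ X ^ (2 * (K + 1230)) := (Nat.lt_pow_self (by omega)).le
          _ ≤ _ := Nat.pow_le_pow_right (by omega) (Nat.le_mul_of_pos_right _ (by omega))
    _ = X ^ ((2 * (K + 1230) + 9 * (e + 2)) * X) * n := by
        rw [← pow_mul, ← pow_add]; congr 2; ring

/-- The cases `d = 1` and `κ = 0` must be answered separately, as the base `κ d ^ 4` may then be `1`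
or `0` and leaves no room for constants. The case `n < d` is answered before sorting to meet the
hypothesis `d ≤ n` of `Runs.sort`. -/
theorem exists_decidesWithin : ∃ C : ℕ, ∀ n d : ℕ, 1 ≤ n → 1 ≤ d → ∀ I : Instance (Fin n) d,
    Program.decideStable.DecidesWithin I (∃ M, I.IsStable M)
      (C * n ^ 2 + (I.kappa * d ^ 4) ^ (C * (I.kappa * d ^ 4)) * n) := by
  obtain ⟨C, hC⟩ := exists_main_cost_le
  refine ⟨C + 5000, fun n d hn hd I => ?_⟩
  set T := (C + 5000) * n ^ 2 + (I.kappa * d ^ 4) ^ ((C + 5000) * (I.kappa * d ^ 4)) * n with hT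
  have hn2 : 1 ≤ n ^ 2 := Nat.one_le_pow _ _ hn
  have hT5 : 5000 * n ^ 2 ≤ T := by rw [hT, add_mul]; omega
  have hsq : (n + 1) ^ 2 ≤ 4 * n ^ 2 := by nlinarith
  suffices H : Runs I Program.decideStable (initialMemory n d) T fun m' =>
      ((∃ M, I.IsStable M) → m'.reg 0 = 1) ∧ ((¬ ∃ M, I.IsStable M) → m'.reg 0 = 0) from H
  have triv : ∀ m, (∃ M, I.IsStable M) → ∀ U, 2 ≤ U →
      Runs I (.assign 0 (.num 1)) m U fun m' =>
        ((∃ M, I.IsStable M) → m'.reg 0 = 1) ∧ ((¬ ∃ M, I.IsStable M) → m'.reg 0 = 0) :=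
    fun m h U hU => Runs.assign hU ⟨fun _ => by simp [Expr.val], fun h' => absurd h h'⟩
  refine Runs.seq (T := 100) (T' := T - 100) ?_ (by omega)
  refine Runs.set (V := d) (l := []) ⟨by omega, le_rfl, rfl, by simp, by simp⟩ rfl rfl
    (by simp [Term.cost, Term.le, Term.lt, Term.neg]) fun m₁ f1 => ?_
  have a0 : m₁.reg 0 = n := f1.1 0 (by omega)
  have a1 : m₁.reg 1 = d := f1.1 1 (by omega)
  have a50 : m₁.reg 50 ≠ 0 ↔ d ≤ 1 ∨ n < d := by
    rw [f1.1 50 (by omega), Memory.setReg_reg, if_pos rfl]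
    exact Term.holds_or.trans (or_congr Term.holds_le Term.holds_lt)
  refine Runs.ite (T := T - 200) (fun h => ?_) (fun h => ?_) (by simp [Expr.cost]; omega)
  · refine triv _ ?_ _ (by omega)
    rcases a50.1 h with h | h
    · exact Instance.exists_isStable_of_one (by omega)
    · exact Instance.exists_isStable_of_lt h
  · have h' : ¬ (d ≤ 1 ∨ n < d) := fun hc => a50.2 hc h
    refine Runs.seq (T := 4000 * n ^ 2) (T' := T - 4000 * n ^ 2 - 200) ?_ (by omega)
    refine (Runs.sort a0 a1 (by omega)).mono (by omega) ?_
    rintro m₂ ⟨b0, b1, b4, b3⟩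
    refine Runs.ite (T := T - 4000 * n ^ 2 - 300) (fun h => ?_) (fun h => ?_)
      (by simp [Expr.cost]; omega)
    · have hκ : 1 ≤ I.kappa := by
        simp only [Expr.val, b4] at h; omega
      refine Runs.main (by omega) hκ rfl b0 b1 b4 b3 ?_
      refine (hC I.kappa d n (by omega) hκ hn _ rfl).trans ?_
      have h1 : (I.kappa * d ^ 4) ^ (C * (I.kappa * d ^ 4)) * n ≤
          (I.kappa * d ^ 4) ^ ((C + 5000) * (I.kappa * d ^ 4)) * n :=
        Nat.mul_le_mul_right _ (Nat.pow_le_pow_right (by positivity)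
          (Nat.mul_le_mul_right _ (by omega)))
      have h2 : 5000 * n ^ 2 ≤ (C + 5000) * n ^ 2 := Nat.mul_le_mul_right _ (by omega)
      omega
    · refine triv _ (Instance.exists_isStable_of_kappa hd ?_) _ (by omega)
      simpa [Expr.val, b4] using h

end MDSR

theorem mainTheorem7 :
    (∃ (c : MDSR.Program) (C : ℕ), ∀ (n d : ℕ), 1 ≤ n → 1 ≤ d →
      ∀ I : MDSR.Instance (Fin n) d,
        c.DecidesWithin I (∃ M, I.IsStable M)
          (C * n ^ 2 + (I.kappa * d ^ 4) ^ (C * (I.kappa * d ^ 4)) * n)) ∧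
    (∀ (n d : ℕ), 1 ≤ n → 1 ≤ d → ∀ I : MDSR.Instance (Fin n) d,
      (∃ σ : Equiv.Perm (Fin n), I.Approximates σ) ∧
      ∀ σ : Equiv.Perm (Fin n), I.Approximates σ → ∀ M, I.IsStable M →
        MDSR.Instance.GapsAtMost σ M
          (2 * I.kappa * d ^ 2 + 4 * I.kappa + 3 * d + 1)) := by
  refine ⟨?_, fun n d _ _ I => ⟨⟨I.sorted, MDSR.Instance.isPosition_sorted.approximates⟩,
    fun σ hσ M hM => MDSR.Instance.gapsAtMost hσ hM⟩⟩
  obtain ⟨C, hC⟩ := MDSR.exists_decidesWithin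
  exact ⟨MDSR.Program.decideStable, C, hC⟩
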